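/- Let $\Omega\subseteq\mathbb R^d$ be an arbitrary open set, let $D\subseteq\partial\Omega$ be closed, and let $V$ be the closure in $W^{1,2}(\Omega)$ (complex-valued functions) of either $\{u|_\Omega : u\in C_0^\infty(\mathbb R^d),\ \operatorname{dist}(\operatorname{supp}u,D)>0\}$ or $\{u\in W^{1,2}(\Omega):\operatorname{dist}(\operatorname{supp}u,D)>0\}$. Let $\mu:\Omega\to\mathbb C^{d\times d}$ be bounded and Lebesgue measurable, let $m:\Omega\to\mathbb R$ and $m_\bullet>0$ be such that, for almost every $x\in\Omega$, $m(x)\ge m_\bullet$ and $\operatorname{Re}(\mu(x)\xi,\xi)\ge m(x)|\xi|^2$ for all $\xi\in\mathbb C^d$, and assume that $\operatorname{Im}\mu$ does not vanish a.e. Here and below $\operatorname{Re}\mu(x)$ and $\operatorname{Im}\mu(x)$ are the componentwise real and imaginary parts, and $\|\cdot\|$ is the operator norm on Euclidean $\mathbb R^d$. Let $A$ be the operator in $L^2(\Omega)$ induced by the form $\mathfrak t(u,v)=\int_\Omega(\mu\nabla u,\nabla v)\,dx$ on $V$: $u\in\operatorname{dom}(A)$ and $Au=f$ if and only if $u\in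 V$, $f\in L^2(\Omega)$ and $\mathfrak t(u,v)=(f,v)_{L^2(\Omega)}$ for all $v\in V$. Let $T$ be the strongly continuous semigroup on $L^2(\Omega)$ generated by $-A$. Whenever there is a (necessarily unique) strongly continuous semigroup $T_p$ on $L^p(\Omega)$ that agrees with $T$ on $L^2(\Omega)\cap L^p(\Omega)$, let $A_p$ be its negative generator. For an operator $B$ in a Banach space $X$ put $N(B)=\{u^*(Bu): u\in\operatorname{dom}(B),\ \|u\|=1,\ u^*\in X^*,\ u^*(u)=\|u\|,\ \|u^*\|=1\}$; $B$ is called accretive if $N(B)\subseteq\{\operatorname{Re}z\ge0\}$. Put $\Sigma_\theta=\{z\in\mathbb C:|\arg z|\le\theta\}\cup\{0\}$ and, for a matrix $L\in\mathbb C^{d\times d}$, $\omega_L=\inf\{\theta\in[0,\pi): (L\xi,\xi)\in\Sigma_\theta\text{ for all }\xi\in\mathbb C^d,\ |\xi|=1\}$. Finally let $\Psi(s)=\frac{2\sqrt{s-1}}{s-2}$ for $s>2$ and $\sigma_p=\frac{p-2}{2\sqrt{p-1}}$ for $p>1$. Set $\eta=\operatorname{ess\,sup}_{x\in\Omega}\frac{\|\operatorname{Im}\mu(x)\|}{m(x)}$.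 Then there is exactly one $q\in(2,\infty)$ with $\Psi(q)=\eta$. With $q'=\frac q{q-1}$, the operators $A_p$ are well defined for all $p\in[q',q]$, the operators $A_q$ and $A_{q'}$ are accretive, and for every $p\in(q',q)$ there is $\alpha_p\in[0,\frac\pi2)$ such that $$\tan(\alpha_p)=\operatorname*{ess\,sup}_{x\in\Omega}\frac{\tan(\omega_{\mu(x)})\,m(x)+|\sigma_p|\,\|\operatorname{Re}\mu(x)\|}{m(x)-|\sigma_p|\,\|\operatorname{Im}\mu(x)\|}\qquad\text{and}\qquad N(A_p)\subseteq\Sigma_{\alpha_p}.$$ -/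

import Mathlib

open MeasureTheory Set Filter Topology
open scoped ENNReal NNReal ContDiff

noncomputable section

namespace LpSector

/-! ### Sectors, numerical ranges, accretivity -/

/-- The closed sector `Σ_θ = {z : |arg z| ≤ θ} ∪ {0}`. -/
def sector (θ : ℝ) : Set ℂ := {z | |z.arg| ≤ θ} ∪ {0}

section Banach

variable {X : Type*} [NormedAddCommGroup X] [NormedSpace ℂ X]

/-- The duality mapping `J(u) = {u* : u*(u) = ‖u‖, ‖u*‖ = 1}`. -/
def dualityMap (u : X) : Set (StrongDual ℂ X) := {φ | φ u = (‖u‖ : ℂ) ∧ ‖φ‖ = 1}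

/-- The numerical range `{u*(Bu) : u ∈ dom B, ‖u‖ = 1, u* ∈ J(u)}` of an operator `B` in `X`
that is given by its graph. -/
def numRange (B : Set (X × X)) : Set ℂ :=
  {z | ∃ w ∈ B, ‖w.1‖ = 1 ∧ ∃ φ ∈ dualityMap w.1, z = φ w.2}

/-- Accretivity: the numerical range lies in the closed right half-plane. -/
def Accretive (B : Set (X × X)) : Prop := numRange B ⊆ {z | 0 ≤ z.re}

/-- Strongly continuous one-parameter semigroups of bounded operators. -/
structure IsC0Semigroup (T : ℝ≥0 → X →L[ℂ] X) : Prop where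
  zero : T 0 = ContinuousLinearMap.id ℂ X
  add : ∀ s t, T (s + t) = (T s).comp (T t)
  cont : ∀ u, Continuous fun t => T t u

/-- The graph of the negative generator of `T`:
`(u, f)` belongs to it iff `(u - T(t)u) / t → f` as `t ↓ 0`. -/
def negGenerator (T : ℝ≥0 → X →L[ℂ] X) : Set (X × X) :=
  {w | Tendsto (fun t : ℝ≥0 => ((t : ℝ) : ℂ)⁻¹ • (w.1 - T t w.1)) (𝓝[>] 0) (𝓝 w.2)}

end Banach

variable {d : ℕ}

/-! ### Matrices -/

/-- The numerical range of a complex matrix. The product `(Lξ, ξ)`, linear in the first slot, is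
`inner ℂ ξ (Lξ)`. -/
def matNumRange (L : Matrix (Fin d) (Fin d) ℂ) : Set ℂ :=
  {z | ∃ ξ : EuclideanSpace ℂ (Fin d), ‖ξ‖ = 1 ∧
    z = inner ℂ ξ (Matrix.toEuclideanCLM (𝕜 := ℂ) L ξ)}

/-- The optimal angle `ω_L = inf {θ ∈ [0, π) : N(L) ⊆ Σ_θ}`. -/
def omega (L : Matrix (Fin d) (Fin d) ℂ) : ℝ :=
  sInf {θ | 0 ≤ θ ∧ θ < Real.pi ∧ matNumRange L ⊆ sector θ}

/-- `Re L ⪰ c`, for the operator real part: `Re (Lξ, ξ) ≥ c |ξ|²` for all `ξ ∈ ℂ^d`. -/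
def CoerciveWith (L : Matrix (Fin d) (Fin d) ℂ) (c : ℝ) : Prop :=
  ∀ ξ : EuclideanSpace ℂ (Fin d),
    c * ‖ξ‖ ^ 2 ≤ (inner ℂ ξ (Matrix.toEuclideanCLM (𝕜 := ℂ) L ξ)).re

/-- The operator norm on Euclidean `ℝ^d` of the componentwise real part. -/
def normRe (L : Matrix (Fin d) (Fin d) ℂ) : ℝ :=
  ‖Matrix.toEuclideanCLM (𝕜 := ℝ) (L.map Complex.re)‖

/-- The operator norm on Euclidean `ℝ^d` of the componentwise imaginary part. -/
def normIm (L : Matrix (Fin d) (Fin d) ℂ) : ℝ :=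
  ‖Matrix.toEuclideanCLM (𝕜 := ℝ) (L.map Complex.im)‖

/-! ### Function spaces on `Ω ⊆ ℝ^d` -/

/-- `L^p(Ω)`, complex-valued, with Lebesgue measure. -/
abbrev LpC (Ω : Set (EuclideanSpace ℝ (Fin d))) (p : ℝ≥0∞) : Type :=
  Lp ℂ p (volume.restrict Ω)

/-- `L²(Ω; ℂ^d)`. -/
abbrev L2Vec (Ω : Set (EuclideanSpace ℝ (Fin d))) : Type :=
  Lp (EuclideanSpace ℂ (Fin d)) 2 (volume.restrict Ω)

/-- `G` is the weak gradient of `u` on `Ω`. -/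
def IsWeakGradient (Ω : Set (EuclideanSpace ℝ (Fin d))) (u : LpC Ω 2) (G : L2Vec Ω) : Prop :=
  ∀ φ : EuclideanSpace ℝ (Fin d) → ℝ, ContDiff ℝ ∞ φ → HasCompactSupport φ → tsupport φ ⊆ Ω →
    ∀ i : Fin d,
      ∫ x in Ω, ((fderiv ℝ φ x (EuclideanSpace.single i 1) : ℝ) : ℂ) * u x
        = -∫ x in Ω, (φ x : ℂ) * G x i

/-- The Sobolev space `W^{1,2}(Ω)`. An element `u` is represented by the pair `(u, ∇u)`, and the
topology induced by `L²(Ω) × L²(Ω; ℂ^d)` is that of the `W^{1,2}`-norm. -/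
def W12 (Ω : Set (EuclideanSpace ℝ (Fin d))) : Set (LpC Ω 2 × L2Vec Ω) :=
  {w | IsWeakGradient Ω w.1 w.2}

/-- `dist (S, D) > 0`, which is the case if one of the sets is empty. -/
def PosDist (S D : Set (EuclideanSpace ℝ (Fin d))) : Prop :=
  ∃ δ : ℝ, 0 < δ ∧ ∀ x ∈ S, ∀ y ∈ D, δ ≤ dist x y

/-- The support of an a.e.-class of functions on `Ω`: the points without a neighbourhood on which
the function vanishes a.e. -/
def essSupport (Ω : Set (EuclideanSpace ℝ (Fin d))) (u : LpC Ω 2) :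
    Set (EuclideanSpace ℝ (Fin d)) :=
  {x | ∀ U ∈ 𝓝 x, ¬ ∀ᵐ y ∂(volume.restrict Ω), y ∈ U → u y = 0}

/-- Restrictions to `Ω` of the functions in `C_0^∞(ℝ^d)` whose support has positive distance
to `D`. -/
def smoothD (Ω D : Set (EuclideanSpace ℝ (Fin d))) : Set (LpC Ω 2 × L2Vec Ω) :=
  {w | w ∈ W12 Ω ∧ ∃ φ : EuclideanSpace ℝ (Fin d) → ℂ, ContDiff ℝ ∞ φ ∧ HasCompactSupport φ ∧
    PosDist (tsupport φ) D ∧ ∀ᵐ x ∂(volume.restrict Ω), w.1 x = φ x}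

/-- The functions in `W^{1,2}(Ω)` whose support has positive distance to `D`. -/
def sobolevD (Ω D : Set (EuclideanSpace ℝ (Fin d))) : Set (LpC Ω 2 × L2Vec Ω) :=
  {w | w ∈ W12 Ω ∧ PosDist (essSupport Ω w.1) D}

/-- Closure in `W^{1,2}(Ω)`. -/
def closureW12 (Ω : Set (EuclideanSpace ℝ (Fin d))) (S : Set (LpC Ω 2 × L2Vec Ω)) :
    Set (LpC Ω 2 × L2Vec Ω) :=
  W12 Ω ∩ closure S

/-! ### The operators -/

/-- The form `𝔱(u, v) = ∫_Ω (μ ∇u, ∇v) dx`. -/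
def form (Ω : Set (EuclideanSpace ℝ (Fin d)))
    (μ : EuclideanSpace ℝ (Fin d) → Matrix (Fin d) (Fin d) ℂ) (u v : LpC Ω 2 × L2Vec Ω) : ℂ :=
  ∫ x in Ω, inner ℂ (v.2 x) (Matrix.toEuclideanCLM (𝕜 := ℂ) (μ x) (u.2 x))

/-- The graph of the operator `A` in `L²(Ω)` induced by the form restricted to `V`:
`u ∈ V` and `𝔱(u, v) = (f, v)` for all `v ∈ V`. -/
def formOperator (Ω : Set (EuclideanSpace ℝ (Fin d)))
    (μ : EuclideanSpace ℝ (Fin d) → Matrix (Fin d) (Fin d) ℂ) (V : Set (LpC Ω 2 × L2Vec Ω)) :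
    Set (LpC Ω 2 × LpC Ω 2) :=
  {w | ∃ u ∈ V, u.1 = w.1 ∧ ∀ v ∈ V, form Ω μ u v = inner ℂ v.1 w.2}

/-- `T` is the strongly continuous semigroup on `L²(Ω)` generated by `-A`, and `S` is a strongly
continuous semigroup on `L^p(Ω)` that agrees with `T` on `L²(Ω) ∩ L^p(Ω)`. -/
structure IsExtrapolation (Ω : Set (EuclideanSpace ℝ (Fin d))) (A : Set (LpC Ω 2 × LpC Ω 2))
    (p : ℝ≥0∞) [Fact (1 ≤ p)] (T : ℝ≥0 → LpC Ω 2 →L[ℂ] LpC Ω 2)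
    (S : ℝ≥0 → LpC Ω p →L[ℂ] LpC Ω p) : Prop where
  semigroup : IsC0Semigroup T
  generator : negGenerator T = A
  semigroup_p : IsC0Semigroup S
  consistent : ∀ (t : ℝ≥0) (f : LpC Ω 2) (g : LpC Ω p),
    f =ᵐ[volume.restrict Ω] g → T t f =ᵐ[volume.restrict Ω] S t g

/-- The semigroup generated by `-A` on `L²(Ω)` exists and extrapolates to `L^p(Ω)`. -/
def Extrapolates (Ω : Set (EuclideanSpace ℝ (Fin d))) (A : Set (LpC Ω 2 × LpC Ω 2))
    (p : ℝ≥0∞) [Fact (1 ≤ p)] : Prop :=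
  ∃ T S, IsExtrapolation Ω A p T S

/-- The graph of the realization `A_p` of `A` in `L^p(Ω)`: the negative generator of the
extrapolated semigroup. (`T` and `S` are uniquely determined by `A` and `p` if they exist.) -/
def realization (Ω : Set (EuclideanSpace ℝ (Fin d))) (A : Set (LpC Ω 2 × LpC Ω 2))
    (p : ℝ≥0∞) [Fact (1 ≤ p)] : Set (LpC Ω p × LpC Ω p) :=
  {w | ∃ T S, IsExtrapolation Ω A p T S ∧ w ∈ negGenerator S}

/-! ### The constants -/

/-- `Ψ(s) = 2 √(s - 1) / (s - 2)`, used for `s > 2`. -/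
def Psi (s : ℝ) : ℝ := 2 * √(s - 1) / (s - 2)

/-- `σ_p = (p - 2) / (2 √(p - 1))`, used for `p > 1`. -/
def sigma (p : ℝ) : ℝ := (p - 2) / (2 * √(p - 1))

/-- `η = esssup_{x ∈ Ω} ‖Im μ(x)‖ / m(x)`, as an extended real number. -/
def eta (Ω : Set (EuclideanSpace ℝ (Fin d)))
    (μ : EuclideanSpace ℝ (Fin d) → Matrix (Fin d) (Fin d) ℂ)
    (m : EuclideanSpace ℝ (Fin d) → ℝ) : EReal :=
  essSup (fun x => ((normIm (μ x) / m x : ℝ) : EReal)) (volume.restrict Ω)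

/-- The essential supremum over `Ω` of
`(tan ω_{μ(x)} m(x) + |σ_p| ‖Re μ(x)‖) / (m(x) - |σ_p| ‖Im μ(x)‖)`, as an extended real number. -/
def kappa (Ω : Set (EuclideanSpace ℝ (Fin d)))
    (μ : EuclideanSpace ℝ (Fin d) → Matrix (Fin d) (Fin d) ℂ)
    (m : EuclideanSpace ℝ (Fin d) → ℝ) (p : ℝ) : EReal :=
  essSup (fun x => (((Real.tan (omega (μ x)) * m x + |sigma p| * normRe (μ x)) /
    (m x - |sigma p| * normIm (μ x)) : ℝ) : EReal)) (volume.restrict Ω)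

end LpSector

end

/-! Everything rests on one pointwise estimate. The L^p theory is governed by the number (Lξ, (p-1)
Re ξ + i Im ξ), called `pForm`. With ξ = a + ib, s = √(p-1) and s • a as the new variable a, it
becomes (L(s⁻¹a + ib), sa + ib). Compared with (L(a + ib), a + ib), the terms pairing a with a and b
with b are unchanged, and the mixed terms pick up factors s and s⁻¹. Since σ_p = (s - s⁻¹)/2, the
change is at most |σ_p| ‖Im L‖ |ξ|² in the real part and |σ_p| ‖Re L‖ |ξ|² in the imaginary part
(`inner_cplx_smul_sub_le`). Hence the real part is nonnegative once |σ_p| ‖Im L‖ ≤ m, and the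
tangent of the angle is bounded by the quotient in the theorem (`pForm_bounds`). As Ψ = 1/σ, σ is
strictly increasing and σ_{q'} = -σ_q, the equation Ψ(q) = η makes [q', q] the set of all p > 1 with
|σ_p| η ≤ 1.

Nonnegativity of Re `pForm` makes the resolvents of A contractive on L^p
(`lpContractive_of_isFormResolvent`). For p ≥ 2 the resolvent equation is tested with a
regularization of |u|^{p-2}u; a chain rule shows that V is invariant under such maps for every open
Ω (`exists_isFormDomain`). For p < 2 duality applies, because p-ellipticity of μ is p'-ellipticity
of μ*. Yosida approximation turns consistent contractive resolvents on L² and L^p into consistent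
semigroups with the right generators (`IsResolventFamily.negGenerator_semigroup`,
`IsResolventPair.isExtrapolation`).

The sector comes from rotation. If k exceeds the essential supremum κ, the coefficients (k ± i)μ are
still coercive and still have nonnegative Re `pForm`. So (k ± i)A_p also has contractive resolvents,
which forces Re((k ± i) u*(A_p u)) ≥ 0 (`IsResolventPair.re_mul_nonneg`). The two half-planes meet
in the sector |Im z| ≤ k Re z, and k decreases to κ (`numRange_realization_subset`). -/

noncomputable section

namespace LpSector

set_option linter.unusedSectionVars false

/-! ### Generation of contraction semigroups from resolvents -/

section HilleYosida

variable {X : Type*} [NormedAddCommGroup X] [NormedSpace ℂ X]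

/-- Bounded operators form a normed algebra over `ℚ`, as the exponential series requires. -/
abbrev normedAlgebraRat : NormedAlgebra ℚ (X →L[ℂ] X) :=
  NormedAlgebra.restrictScalars ℚ ℂ (X →L[ℂ] X)

attribute [local instance] normedAlgebraRat

/-- The semigroup `e^{s(J-1)}` generated by the bounded operator `J - 1`. -/
def expSub (J : X →L[ℂ] X) (s : ℝ) : X →L[ℂ] X := Real.exp (-s) • NormedSpace.exp (s • J)

lemma norm_pow_le_one {J : X →L[ℂ] X} (hJ : ‖J‖ ≤ 1) (n : ℕ) : ‖J ^ n‖ ≤ 1 := by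
  induction n with
  | zero => simpa [ContinuousLinearMap.one_def] using ContinuousLinearMap.norm_id_le
  | succ n ih =>
    rw [pow_succ]
    calc ‖J ^ n * J‖ ≤ ‖J ^ n‖ * ‖J‖ := norm_mul_le _ _
      _ ≤ 1 := mul_le_one₀ ih (norm_nonneg _) hJ

lemma expSub_zero (J : X →L[ℂ] X) : expSub J 0 = 1 := by simp [expSub]

lemma commute_expSub {J K : X →L[ℂ] X} (h : Commute J K) (s : ℝ) : Commute (expSub J s) K :=
  ((h.smul_left s).exp_left).smul_left _

lemma map_smul_real (L : X →L[ℂ] X) (c : ℝ) (x : X) : L (c • x) = c • L x :=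
  L.map_smul_of_tower c x

variable [CompleteSpace X]

/-- The series of e^{sJ} is dominated term by term by that of e^s, which the prefactor e^{-s}
cancels. -/
lemma norm_expSub_le {J : X →L[ℂ] X} (hJ : ‖J‖ ≤ 1) {s : ℝ} (hs : 0 ≤ s) :
    ‖expSub J s‖ ≤ 1 := by
  have h1 : HasSum (fun n : ℕ => ((n.factorial : ℝ)⁻¹) • (s • J) ^ n)
      (NormedSpace.exp (s • J)) := NormedSpace.exp_series_hasSum_exp' (𝕂 := ℝ) (s • J)
  have h2 : HasSum (fun n : ℕ => ((n.factorial : ℝ)⁻¹) • s ^ n) (Real.exp s) := by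
    rw [Real.exp_eq_exp_ℝ]
    exact NormedSpace.exp_series_hasSum_exp' (𝕂 := ℝ) s
  have h3 : ‖NormedSpace.exp (s • J)‖ ≤ Real.exp s := by
    rw [← h1.tsum_eq]
    refine tsum_of_norm_bounded h2 fun n => ?_
    rw [norm_smul, smul_pow, norm_smul, smul_eq_mul, norm_inv, Real.norm_natCast,
      Real.norm_of_nonneg (pow_nonneg hs n)]
    have := norm_pow_le_one hJ n
    have h4 : 0 ≤ s ^ n := pow_nonneg hs n
    gcongr
    nlinarith
  unfold expSub
  rw [norm_smul, Real.norm_of_nonneg (Real.exp_pos _).le]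
  calc Real.exp (-s) * ‖NormedSpace.exp (s • J)‖ ≤ Real.exp (-s) * Real.exp s := by gcongr
    _ = 1 := by rw [← Real.exp_add]; simp

lemma expSub_add (J : X →L[ℂ] X) (s t : ℝ) : expSub J (s + t) = expSub J s * expSub J t := by
  unfold expSub
  rw [neg_add, Real.exp_add, add_smul, NormedSpace.exp_add_of_commute, smul_mul_smul_comm]
  exact ((Commute.refl J).smul_right t).smul_left s

lemma continuous_expSub (J : X →L[ℂ] X) : Continuous (expSub J) := by
  have h1 : Continuous fun s : ℝ => NormedSpace.exp (s • J) :=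
    NormedSpace.exp_continuous.comp (continuous_id.smul continuous_const)
  have h2 : Continuous fun s : ℝ => Real.exp (-s) := by fun_prop
  exact h2.smul h1

lemma hasDerivAt_expSub (J : X →L[ℂ] X) (s : ℝ) :
    HasDerivAt (expSub J) (expSub J s * (J - 1)) s := by
  have h1 : HasDerivAt (fun s : ℝ => Real.exp (-s)) (-Real.exp (-s)) s := by
    simpa using (hasDerivAt_neg s).exp
  have h2 := hasDerivAt_exp_smul_const (𝕂 := ℝ) J s
  refine (h1.smul h2).congr_deriv ?_
  simp only [expSub, mul_sub, mul_one, smul_mul_assoc, neg_smul]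
  abel

/-- The curve r ↦ e^{ar(J-1)} e^{b(t-r)(K-1)} x joins the two vectors. As J and K commute, its
derivative is a contraction applied to a(J-1)x - b(K-1)x, so the mean value inequality gives the
bound. -/
lemma norm_expSub_sub_expSub_le {J K : X →L[ℂ] X} (hJ : ‖J‖ ≤ 1) (hK : ‖K‖ ≤ 1)
    (h : Commute J K) {a b t : ℝ} (ha : 0 ≤ a) (hb : 0 ≤ b) (ht : 0 ≤ t) (x : X) :
    ‖expSub J (a * t) x - expSub K (b * t) x‖ ≤ ‖a • (J x - x) - b • (K x - x)‖ * t := by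
  set C := ‖a • (J x - x) - b • (K x - x)‖
  let f : ℝ → X →L[ℂ] X := fun r => expSub J (a * r) * expSub K (b * (t - r))
  have hf : ∀ r, HasDerivAt f ((expSub J (a * r) * expSub K (b * (t - r))) *
      (a • (J - 1) - b • (K - 1))) r := by
    intro r
    have h1 : HasDerivAt (fun r => expSub J (a * r)) (a • (expSub J (a * r) * (J - 1))) r := by
      have := (hasDerivAt_expSub J (a * r)).scomp r ((hasDerivAt_id r).const_mul a)
      simpa [Function.comp_def] using this
    have h2 : HasDerivAt (fun r => expSub K (b * (t - r)))
        ((-b) • (expSub K (b * (t - r)) * (K - 1))) r := by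
      have := (hasDerivAt_expSub K (b * (t - r))).scomp r
        (((hasDerivAt_id r).const_sub t).const_mul b)
      simpa [Function.comp_def] using this
    refine (h1.mul h2).congr_deriv ?_
    have hc : (J - 1) * expSub K (b * (t - r)) = expSub K (b * (t - r)) * (J - 1) :=
      (((commute_expSub h.symm _).sub_right (Commute.one_right _))).eq.symm
    rw [smul_mul_assoc, mul_assoc _ (J - 1), hc, mul_sub (expSub J _ * _),
      mul_smul_comm, mul_smul_comm, mul_smul_comm, neg_smul, ← mul_assoc, ← mul_assoc]
    exact (sub_eq_add_neg _ _).symm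
  have hfx : ∀ r, HasDerivAt (fun r => f r x) (((expSub J (a * r) * expSub K (b * (t - r))) *
      (a • (J - 1) - b • (K - 1))) x) r := fun r => by
    have h2 := ((ContinuousLinearMap.apply ℂ X x).restrictScalars ℝ).hasFDerivAt.comp_hasDerivAt r
      (hf r)
    exact h2
  have key := norm_image_sub_le_of_norm_deriv_le_segment' (f := fun r => f r x) (a := 0) (b := t)
    (C := C) (fun r _ => (hfx r).hasDerivWithinAt) (fun r hr => ?_) t ⟨ht, le_rfl⟩
  · simpa [f, expSub_zero] using key
  · have e1 := norm_expSub_le hJ (mul_nonneg ha hr.1)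
    have e2 := norm_expSub_le hK (mul_nonneg hb (sub_nonneg.2 hr.2.le))
    have e3 : ‖expSub J (a * r) * expSub K (b * (t - r))‖ ≤ 1 :=
      (norm_mul_le _ _).trans (mul_le_one₀ e1 (norm_nonneg _) e2)
    calc _ ≤ ‖expSub J (a * r) * expSub K (b * (t - r))‖ * C := by
          exact ContinuousLinearMap.le_opNorm (expSub J (a * r) * expSub K (b * (t - r)))
            ((a • (J - 1) - b • (K - 1)) x)
      _ ≤ C := by
          have : 0 ≤ C := norm_nonneg _
          nlinarith

/-- The resolvents `J t = (1 + t A)⁻¹`, `t > 0`, of a densely defined m-accretive operator. -/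
structure IsResolventFamily (J : ℝ → X →L[ℂ] X) : Prop where
  norm_le : ∀ t, 0 < t → ‖J t‖ ≤ 1
  identity : ∀ s t, 0 < s → 0 < t → ∀ x,
    J s (((s / t : ℝ) : ℂ) • x + ((1 - s / t : ℝ) : ℂ) • J t x) = J t x
  tendsto : ∀ x, Tendsto (fun t => J t x) (𝓝[>] 0) (𝓝 x)

/-- The graph of the operator `A` with `J 1 = (1 + A)⁻¹`. -/
def resolventGraph (J : X →L[ℂ] X) : Set (X × X) := {w | ∃ y, w = (J y, y - J y)}

/-- The semigroups generated by the Yosida approximations. -/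
def yosida (J : ℝ → X →L[ℂ] X) (n : ℕ) (t : ℝ) : X →L[ℂ] X :=
  expSub (J ((n : ℝ) + 1)⁻¹) (((n : ℝ) + 1) * t)

namespace IsResolventFamily

variable {J : ℝ → X →L[ℂ] X}

lemma identity_real (h : IsResolventFamily J) (s t : ℝ) (hs : 0 < s) (ht : 0 < t) (x : X) :
    J s ((s / t) • x + (1 - s / t) • J t x) = J t x := by
  simpa only [Complex.coe_smul] using h.identity s t hs ht x

/-- The resolvent identity, read in both orders, turns (1 - s/t) J_s J_t x and (1 - s/t) J_t J_s x
into the same expression J_t x - (s/t) J_s x. -/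
lemma commute (h : IsResolventFamily J) {s t : ℝ} (hs : 0 < s) (ht : 0 < t) :
    Commute (J s) (J t) := by
  rcases eq_or_ne s t with rfl | hst
  · exact Commute.refl _
  ext x
  have h1 := h.identity_real s t hs ht x
  have h2 := h.identity_real t s ht hs x
  rw [map_add, map_smul_real, map_smul_real] at h1 h2
  have e1 : (1 - s / t) ≠ 0 := by
    rw [sub_ne_zero]; intro e; field_simp at e; exact hst e.symm
  have h3 : (1 - s / t) • J s (J t x) = J t x - (s / t) • J s x :=
    eq_sub_iff_add_eq'.2 h1
  have h4 : (1 - s / t) • J t (J s x) = J t x - (s / t) • J s x := by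
    have e2 : (1 - s / t) = -(s / t) * (1 - t / s) := by field_simp; ring
    have h5 : (1 - t / s) • J t (J s x) = J s x - (t / s) • J t x :=
      eq_sub_iff_add_eq'.2 h2
    rw [e2, mul_smul, h5, smul_sub, smul_smul]
    have : -(s / t) * (t / s) = -1 := by field_simp
    rw [this]; simp only [neg_smul, one_smul]; abel
  have := h3.trans h4.symm
  simpa using (smul_right_injective X e1) this

/-- The range of J_1 is the domain of A, with A(J_1 y) = y - J_1 y. In these terms the Yosida
approximation (1 - J_s)/s acts on the domain as J_s A. -/
lemma inv_smul_sub_apply (h : IsResolventFamily J) {s : ℝ} (hs : 0 < s) (y : X) :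
    s⁻¹ • (J 1 y - J s (J 1 y)) = J s (y - J 1 y) := by
  have h1 := h.identity_real s 1 hs one_pos y
  rw [map_add, map_smul_real, map_smul_real] at h1
  simp only [div_one] at h1
  rw [inv_smul_eq_iff₀ hs.ne', map_sub, smul_sub]
  nth_rewrite 1 [← h1]
  rw [sub_smul, one_smul]; abel

lemma mem_range (h : IsResolventFamily J) {t : ℝ} (ht : 0 < t) (x : X) :
    J t x ∈ Set.range (J 1) := ⟨_, h.identity_real 1 t one_pos ht x⟩

lemma denseRange (h : IsResolventFamily J) : DenseRange (J 1) := by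
  intro x
  refine mem_closure_of_tendsto (h.tendsto x) ?_
  filter_upwards [self_mem_nhdsWithin] with t ht using h.mem_range ht x

lemma tendsto_inv (h : IsResolventFamily J) (x : X) :
    Tendsto (fun n : ℕ => J ((n : ℝ) + 1)⁻¹ x) atTop (𝓝 x) := by
  refine (h.tendsto x).comp (tendsto_nhdsWithin_iff.2 ⟨?_, .of_forall fun n => ?_⟩)
  · simpa using tendsto_one_div_add_atTop_nhds_zero_nat (𝕜 := ℝ)
  · exact inv_pos.2 (by positivity : (0 : ℝ) < n + 1)

lemma norm_yosida_le (h : IsResolventFamily J) (n : ℕ) {t : ℝ} (ht : 0 ≤ t) :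
    ‖yosida J n t‖ ≤ 1 := norm_expSub_le (h.norm_le _ (by positivity)) (by positivity)

lemma norm_yosida_apply_le (h : IsResolventFamily J) (n : ℕ) {t : ℝ} (ht : 0 ≤ t) (x : X) :
    ‖yosida J n t x‖ ≤ ‖x‖ := by
  simpa using (yosida J n t).le_of_opNorm_le (h.norm_yosida_le n ht) x

lemma yosida_smul_sub (h : IsResolventFamily J) (n : ℕ) (y : X) :
    ((n : ℝ) + 1) • (J ((n : ℝ) + 1)⁻¹ (J 1 y) - J 1 y) = -J ((n : ℝ) + 1)⁻¹ (y - J 1 y) := by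
  have := h.inv_smul_sub_apply (s := ((n : ℝ) + 1)⁻¹) (by positivity) y
  rw [← this, inv_inv, ← smul_neg, neg_sub]

lemma norm_yosida_sub_le (h : IsResolventFamily J) (n m : ℕ) {t : ℝ} (ht : 0 ≤ t) (y : X) :
    ‖yosida J n t (J 1 y) - yosida J m t (J 1 y)‖ ≤
      ‖J ((n : ℝ) + 1)⁻¹ (y - J 1 y) - J ((m : ℝ) + 1)⁻¹ (y - J 1 y)‖ * t := by
  have hn : 0 < ((n : ℝ) + 1)⁻¹ := by positivity
  have hm : 0 < ((m : ℝ) + 1)⁻¹ := by positivity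
  have := norm_expSub_sub_expSub_le (h.norm_le _ hn) (h.norm_le _ hm) (h.commute hn hm)
    (a := (n : ℝ) + 1) (b := (m : ℝ) + 1) (by positivity) (by positivity) ht (J 1 y)
  rw [h.yosida_smul_sub, h.yosida_smul_sub, neg_sub_neg, norm_sub_rev (J _ _)] at this
  exact this

/-- On the domain, two approximations differ by at most t times the difference of J_{1/(n+1)} and
J_{1/(m+1)} at a fixed vector. Uniform contractivity carries the Cauchy property over to the closure
of the domain, which is everything. -/
lemma cauchySeq_yosida (h : IsResolventFamily J) {t : ℝ} (ht : 0 ≤ t) (x : X) :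
    CauchySeq fun n => yosida J n t x := by
  rw [Metric.cauchySeq_iff]
  intro ε hε
  obtain ⟨_, hy, ⟨y, rfl⟩⟩ := Metric.dense_iff.1 h.denseRange x (ε / 4) (by positivity)
  have hc : CauchySeq fun n : ℕ => J ((n : ℝ) + 1)⁻¹ (y - J 1 y) :=
    (h.tendsto_inv (y - J 1 y)).cauchySeq
  obtain ⟨N, hN⟩ := Metric.cauchySeq_iff.1 hc (ε / (4 * (t + 1))) (by positivity)
  refine ⟨N, fun n hn m hm => ?_⟩
  have h1 := h.norm_yosida_sub_le n m ht y
  have h2 := hN n hn m hm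
  rw [dist_eq_norm] at h2
  have h3 : ‖J ((n : ℝ) + 1)⁻¹ (y - J 1 y) - J ((m : ℝ) + 1)⁻¹ (y - J 1 y)‖ * t ≤ ε / 4 := by
    calc _ ≤ (ε / (4 * (t + 1))) * (t + 1) := by gcongr; linarith
      _ = ε / 4 := by field_simp
  rw [Metric.mem_ball, dist_eq_norm] at hy
  have h4 : ∀ k, ‖yosida J k t x - yosida J k t (J 1 y)‖ < ε / 4 := fun k => by
    rw [← map_sub]
    refine (h.norm_yosida_apply_le k ht _).trans_lt ?_
    rwa [norm_sub_rev]
  rw [dist_eq_norm]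
  calc _ = ‖(yosida J n t x - yosida J n t (J 1 y)) + (yosida J n t (J 1 y) - yosida J m t (J 1 y))
        - (yosida J m t x - yosida J m t (J 1 y))‖ := by congr 1; abel
    _ ≤ _ := norm_sub_le _ _
    _ ≤ (‖yosida J n t x - yosida J n t (J 1 y)‖ + ‖yosida J n t (J 1 y) - yosida J m t (J 1 y)‖)
        + ‖yosida J m t x - yosida J m t (J 1 y)‖ := by gcongr; exact norm_add_le _ _
    _ < ε := by linarith [h4 n, h4 m]

/-- The semigroup generated by `-A`. -/
def semigroup (h : IsResolventFamily J) (t : ℝ≥0) : X →L[ℂ] X :=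
  continuousLinearMapOfTendsto (fun n => yosida J n t)
    (tendsto_pi_nhds.2 fun x => (cauchySeq_tendsto_of_complete
      (h.cauchySeq_yosida t.2 x)).choose_spec)

lemma tendsto_semigroup (h : IsResolventFamily J) (t : ℝ≥0) (x : X) :
    Tendsto (fun n => yosida J n t x) atTop (𝓝 (h.semigroup t x)) :=
  (cauchySeq_tendsto_of_complete (h.cauchySeq_yosida t.2 x)).choose_spec

lemma norm_semigroup_apply_le (h : IsResolventFamily J) (t : ℝ≥0) (x : X) :
    ‖h.semigroup t x‖ ≤ ‖x‖ :=
  le_of_tendsto (h.tendsto_semigroup t x).norm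
    (.of_forall fun n => h.norm_yosida_apply_le n t.2 x)

lemma tendsto_semigroup_of_tendsto (h : IsResolventFamily J) (t : ℝ≥0) {x : X} {u : ℕ → X}
    (hu : Tendsto u atTop (𝓝 x)) :
    Tendsto (fun n => yosida J n t (u n)) atTop (𝓝 (h.semigroup t x)) := by
  have h1 : Tendsto (fun n => yosida J n t (u n - x)) atTop (𝓝 0) := by
    refine squeeze_zero_norm (fun n => h.norm_yosida_apply_le n t.2 _) ?_
    simpa using (hu.sub_const x).norm
  simpa using h1.add (h.tendsto_semigroup t x)

lemma hasDerivAt_yosida (h : IsResolventFamily J) (n : ℕ) (t : ℝ) (y : X) :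
    HasDerivAt (fun t => yosida J n t (J 1 y))
      (-(yosida J n t (J ((n : ℝ) + 1)⁻¹ (y - J 1 y)))) t := by
  have h1 := (hasDerivAt_expSub (J ((n : ℝ) + 1)⁻¹) (((n : ℝ) + 1) * t)).scomp t
    ((hasDerivAt_id t).const_mul ((n : ℝ) + 1))
  have h2 := ((ContinuousLinearMap.apply ℂ X (J 1 y)).restrictScalars ℝ).hasFDerivAt.comp_hasDerivAt
    t h1
  refine HasDerivAt.congr_deriv (f := fun t => yosida J n t (J 1 y)) h2 ?_
  have := h.yosida_smul_sub n y
  rw [mul_one]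
  rw [← map_neg, ← this, map_smul_real]
  rfl

lemma lipschitz_yosida (h : IsResolventFamily J) (n : ℕ) {s t : ℝ} (hs : 0 ≤ s) (ht : 0 ≤ t)
    (y : X) : ‖yosida J n t (J 1 y) - yosida J n s (J 1 y)‖ ≤ ‖y - J 1 y‖ * ‖t - s‖ := by
  refine (convex_Ici (0 : ℝ)).norm_image_sub_le_of_norm_hasDerivWithin_le
    (fun r _ => (h.hasDerivAt_yosida n r y).hasDerivWithinAt) (fun r hr => ?_) hs ht
  rw [norm_neg]
  refine (h.norm_yosida_apply_le n hr _).trans ?_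
  simpa using (J ((n : ℝ) + 1)⁻¹).le_of_opNorm_le (h.norm_le _ (by positivity)) (y - J 1 y)

lemma lipschitz_semigroup (h : IsResolventFamily J) (s t : ℝ≥0) (y : X) :
    ‖h.semigroup t (J 1 y) - h.semigroup s (J 1 y)‖ ≤ ‖y - J 1 y‖ * ‖(t : ℝ) - s‖ :=
  le_of_tendsto ((h.tendsto_semigroup t _).sub (h.tendsto_semigroup s _)).norm
    (.of_forall fun n => h.lipschitz_yosida n s.2 t.2 y)

lemma continuous_semigroup (h : IsResolventFamily J) (x : X) :
    Continuous fun t => h.semigroup t x := by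
  have hy : ∀ y, Continuous fun t => h.semigroup t (J 1 y) := fun y => by
    refine (LipschitzWith.of_dist_le_mul (K := ‖y - J 1 y‖₊) fun s t => ?_).continuous
    rw [dist_eq_norm, NNReal.dist_eq]
    exact h.lipschitz_semigroup t s y
  refine continuous_of_uniform_approx_of_continuous fun u hu => ?_
  obtain ⟨ε, hε, hu⟩ := Metric.mem_uniformity_dist.1 hu
  obtain ⟨_, hxy, ⟨y, rfl⟩⟩ := Metric.dense_iff.1 h.denseRange x ε hε
  refine ⟨_, hy y, fun t => hu ?_⟩
  rw [dist_eq_norm, ← map_sub]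
  refine (h.norm_semigroup_apply_le t _).trans_lt ?_
  rwa [Metric.mem_ball', dist_eq_norm] at hxy

lemma isC0Semigroup (h : IsResolventFamily J) : IsC0Semigroup h.semigroup where
  zero := by
    ext x
    refine tendsto_nhds_unique (h.tendsto_semigroup 0 x) ?_
    simp [yosida, expSub_zero]
  add s t := by
    ext x
    refine tendsto_nhds_unique (h.tendsto_semigroup (s + t) x) ?_
    refine (h.tendsto_semigroup_of_tendsto s (h.tendsto_semigroup t x)).congr fun n => ?_
    simp only [yosida, NNReal.coe_add, mul_add, expSub_add]
    rfl
  cont := h.continuous_semigroup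

/-- The fundamental theorem of calculus holds for the approximating exponentials and survives the
limit by dominated convergence. It replaces a direct differentiation of the limit semigroup. -/
lemma sub_semigroup_eq_integral (h : IsResolventFamily J) (t : ℝ≥0) (y : X) :
    J 1 y - h.semigroup t (J 1 y) = ∫ s in (0 : ℝ)..t, h.semigroup s.toNNReal (y - J 1 y) := by
  have hcont : ∀ (n : ℕ) (w : X), Continuous fun s => yosida J n s w := fun n w => by
    have h0 := continuous_expSub (J ((n : ℝ) + 1)⁻¹)
    have h1 : Continuous fun s : ℝ => ((n : ℝ) + 1) * s := by fun_prop
    have h2 : Continuous fun s : ℝ => expSub (J ((n : ℝ) + 1)⁻¹) (((n : ℝ) + 1) * s) := h0.comp h1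
    exact h2.clm_apply continuous_const
  have h1 : ∀ n : ℕ, J 1 y - yosida J n t (J 1 y) =
      ∫ s in (0 : ℝ)..t, yosida J n s (J ((n : ℝ) + 1)⁻¹ (y - J 1 y)) := fun n => by
    have := intervalIntegral.integral_eq_sub_of_hasDerivAt (a := 0) (b := t)
      (f := fun s => yosida J n s (J 1 y))
      (f' := fun s => -(yosida J n s (J ((n : ℝ) + 1)⁻¹ (y - J 1 y))))
      (fun s _ => h.hasDerivAt_yosida n s y) (((hcont n _).neg).intervalIntegrable _ _)
    rw [intervalIntegral.integral_neg, neg_eq_iff_eq_neg, neg_sub] at this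
    rw [this]
    simp [yosida, expSub_zero]
  refine tendsto_nhds_unique ((h.tendsto_semigroup t (J 1 y)).const_sub (J 1 y)) ?_
  simp_rw [h1]
  refine intervalIntegral.tendsto_integral_filter_of_dominated_convergence
    (F := fun (n : ℕ) (s : ℝ) => yosida J n s (J ((n : ℝ) + 1)⁻¹ (y - J 1 y)))
    (fun _ => ‖y - J 1 y‖) (Eventually.of_forall fun n => Continuous.aestronglyMeasurable ?_)
    (Eventually.of_forall fun n => Eventually.of_forall fun s hs => ?_) (by simp)
    (Eventually.of_forall fun s hs => ?_)
  · exact hcont n _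
  · rw [uIoc_of_le (NNReal.coe_nonneg t)] at hs
    refine (h.norm_yosida_apply_le n hs.1.le _).trans ?_
    simpa using (J ((n : ℝ) + 1)⁻¹).le_of_opNorm_le (h.norm_le _ (by positivity)) (y - J 1 y)
  · rw [uIoc_of_le (NNReal.coe_nonneg t)] at hs
    have := h.tendsto_semigroup_of_tendsto s.toNNReal (h.tendsto_inv (y - J 1 y))
    rwa [Real.coe_toNNReal _ hs.1.le] at this

lemma tendsto_coe_nhdsGT_zero : Tendsto (fun t : ℝ≥0 => (t : ℝ)) (𝓝[>] 0) (𝓝[>] 0) := by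
  refine tendsto_nhdsWithin_iff.2 ⟨?_, ?_⟩
  · exact (NNReal.continuous_coe.tendsto' 0 0 rfl).mono_left nhdsWithin_le_nhds
  · filter_upwards [self_mem_nhdsWithin] with t ht using NNReal.coe_pos.2 ht

lemma resolventGraph_subset (h : IsResolventFamily J) :
    resolventGraph (J 1) ⊆ negGenerator h.semigroup := by
  rintro _ ⟨y, rfl⟩
  have hc : Continuous fun s : ℝ => h.semigroup s.toNNReal (y - J 1 y) :=
    (h.continuous_semigroup _).comp continuous_real_toNNReal
  have hd := (hc.integral_hasStrictDerivAt 0 0).hasDerivAt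
  have h2 := hd.tendsto_slope_zero_right.comp tendsto_coe_nhdsGT_zero
  simp only [Real.toNNReal_zero, h.isC0Semigroup.zero, intervalIntegral.integral_same, sub_zero,
    zero_add, ContinuousLinearMap.id_apply] at h2
  refine h2.congr fun t => ?_
  simp only [Function.comp_apply]
  rw [← h.sub_semigroup_eq_integral, ← Complex.ofReal_inv, Complex.coe_smul]

/-- The generator extends A, and A is already surjective after adding 1. If (u, g) is in the
generator, then v = u - J_1(u + g) is mapped to -v by it, and contractivity leaves only v = 0. -/
lemma negGenerator_semigroup (h : IsResolventFamily J) :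
    negGenerator h.semigroup = resolventGraph (J 1) := by
  refine Subset.antisymm ?_ h.resolventGraph_subset
  rintro ⟨u, g⟩ hu
  have hx := h.resolventGraph_subset ⟨u + g, rfl⟩
  change Tendsto (fun t : ℝ≥0 => ((t : ℝ) : ℂ)⁻¹ • (u - h.semigroup t u)) _ (𝓝 g) at hu
  change Tendsto (fun t : ℝ≥0 => ((t : ℝ) : ℂ)⁻¹ • (J 1 (u + g) - h.semigroup t (J 1 (u + g)))) _
    (𝓝 (u + g - J 1 (u + g))) at hx
  obtain ⟨z, hz⟩ : ∃ z, z = J 1 (u + g) := ⟨_, rfl⟩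
  rw [← hz] at hx
  obtain ⟨v, hv⟩ : ∃ v, v = u - z := ⟨_, rfl⟩
  have h1 : Tendsto (fun t : ℝ≥0 => ((t : ℝ) : ℂ)⁻¹ • (v - h.semigroup t v)) (𝓝[>] 0) (𝓝 (-v)) := by
    have := hu.sub hx
    refine (this.congr fun t => ?_).trans_eq ?_
    · rw [← smul_sub, hv, map_sub]; congr 1; abel
    · congr 1; rw [hv]; abel
  have h2 : Tendsto (fun t : ℝ≥0 => ‖v + ((t : ℝ) : ℂ)⁻¹ • (v - h.semigroup t v)‖) (𝓝[>] 0)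
      (𝓝 0) := by
    simpa using (h1.const_add v).norm
  -- Reverse triangle inequality: the vector on the right is (1 + 1/t)v - (1/t)T(t)v, of norm at
  -- least (1 + 1/t)‖v‖ - (1/t)‖v‖.
  have h3 : ∀ᶠ t : ℝ≥0 in 𝓝[>] 0,
      ‖v‖ ≤ ‖v + ((t : ℝ) : ℂ)⁻¹ • (v - h.semigroup t v)‖ := by
    filter_upwards [self_mem_nhdsWithin] with t ht
    have ht' : (0 : ℝ) < t := NNReal.coe_pos.2 ht
    have e : ((t : ℝ) : ℂ)⁻¹ • h.semigroup t v =
        (1 + ((t : ℝ) : ℂ)⁻¹) • v - (v + ((t : ℝ) : ℂ)⁻¹ • (v - h.semigroup t v)) := by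
      rw [add_smul, one_smul, smul_sub, add_sub_add_left_eq_sub, sub_sub_cancel]
    have e1 : ‖((t : ℝ) : ℂ)⁻¹ • h.semigroup t v‖ ≤ (t : ℝ)⁻¹ * ‖v‖ := by
      rw [norm_smul, norm_inv, Complex.norm_real, Real.norm_of_nonneg ht'.le]
      gcongr
      exact h.norm_semigroup_apply_le t v
    have e2 : ‖(1 + ((t : ℝ) : ℂ)⁻¹) • v‖ = (1 + (t : ℝ)⁻¹) * ‖v‖ := by
      rw [norm_smul]
      congr 1
      rw [← Complex.ofReal_inv, ← Complex.ofReal_one, ← Complex.ofReal_add, Complex.norm_real,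
        Real.norm_of_nonneg (by positivity)]
    have e3 := norm_sub_norm_le ((1 + ((t : ℝ) : ℂ)⁻¹) • v)
      (v + ((t : ℝ) : ℂ)⁻¹ • (v - h.semigroup t v))
    rw [← e, e2] at e3
    nlinarith
  have h4 : ‖v‖ ≤ 0 := ge_of_tendsto h2 h3
  have h5 : v = 0 := norm_le_zero_iff.1 h4
  rw [hv, sub_eq_zero, hz] at h5
  refine ⟨u + g, ?_⟩
  rw [← h5]; simp

end IsResolventFamily

end HilleYosida

/-! ### Invariant closed subspaces of a product under pairs of semigroups -/

section Consistency

variable {X Y : Type*} [NormedAddCommGroup X] [NormedSpace ℂ X] [CompleteSpace X]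
  [NormedAddCommGroup Y] [NormedSpace ℂ Y] [CompleteSpace Y]

lemma hasSum_expSub_apply (J : X →L[ℂ] X) (s : ℝ) (x : X) :
    HasSum (fun n : ℕ => (Real.exp (-s) * ((n.factorial : ℝ)⁻¹ * s ^ n)) • (J ^ n) x)
      (expSub J s x) := by
  have h1 : HasSum (fun n : ℕ => ((n.factorial : ℝ)⁻¹) • (s • J) ^ n)
      (NormedSpace.exp (s • J)) := NormedSpace.exp_series_hasSum_exp' (𝕂 := ℝ) (s • J)
  have h2 := (h1.const_smul (Real.exp (-s))).mapL
    ((ContinuousLinearMap.apply ℂ X x).restrictScalars ℝ)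
  convert h2 using 2 with n
  · simp [smul_pow, mul_smul]
  · rfl

/-- Agreement of operators on L² ∩ L^p amounts to invariance of the closed subspace `diagLp` of L² ×
L^p. In this form it passes to powers, to convergent series and to the Yosida limit. -/
lemma expSub_mem_of_invariant {Z : Submodule ℂ (X × Y)} (hZ : IsClosed (Z : Set (X × Y)))
    {J : X →L[ℂ] X} {K : Y →L[ℂ] Y} (h : ∀ w ∈ Z, (J w.1, K w.2) ∈ Z) (s : ℝ) :
    ∀ w ∈ Z, (expSub J s w.1, expSub K s w.2) ∈ Z := by
  intro w hw
  have hpow : ∀ n : ℕ, ((J ^ n) w.1, (K ^ n) w.2) ∈ Z := fun n => by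
    induction n with
    | zero => simpa using hw
    | succ n ih => simpa [pow_succ'] using h _ ih
  have hs := (hasSum_expSub_apply J s w.1).prodMk (hasSum_expSub_apply K s w.2)
  refine hZ.mem_of_tendsto hs (.of_forall fun F => ?_)
  refine Submodule.sum_mem _ fun n _ => ?_
  exact (Z.restrictScalars ℝ).smul_mem _ (hpow n)

lemma semigroup_mem_of_invariant {Z : Submodule ℂ (X × Y)} (hZ : IsClosed (Z : Set (X × Y)))
    {J : ℝ → X →L[ℂ] X} {K : ℝ → Y →L[ℂ] Y} (hJ : IsResolventFamily J) (hK : IsResolventFamily K)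
    (h : ∀ t, 0 < t → ∀ w ∈ Z, (J t w.1, K t w.2) ∈ Z) (t : ℝ≥0) :
    ∀ w ∈ Z, (hJ.semigroup t w.1, hK.semigroup t w.2) ∈ Z := by
  intro w hw
  refine hZ.mem_of_tendsto ((hJ.tendsto_semigroup t w.1).prodMk_nhds (hK.tendsto_semigroup t w.2))
    (.of_forall fun n => ?_)
  exact expSub_mem_of_invariant hZ (h _ (by positivity)) _ w hw

end Consistency

/-! ### A semigroup is determined by its accretive generator -/

section Uniqueness

variable {H : Type*} [NormedAddCommGroup H] [InnerProductSpace ℂ H]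

lemma negGenerator_sub {X : Type*} [NormedAddCommGroup X] [NormedSpace ℂ X]
    {T : ℝ≥0 → X →L[ℂ] X} {v w : X × X} (hv : v ∈ negGenerator T) (hw : w ∈ negGenerator T) :
    v - w ∈ negGenerator T := by
  refine (hv.sub hw).congr fun t => ?_
  rw [← smul_sub, Prod.fst_sub, map_sub]; congr 1; abel

lemma negGenerator_invariant {X : Type*} [NormedAddCommGroup X] [NormedSpace ℂ X]
    {T : ℝ≥0 → X →L[ℂ] X} (hT : IsC0Semigroup T) {w : X × X} (hw : w ∈ negGenerator T) (s : ℝ≥0) :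
    (T s w.1, T s w.2) ∈ negGenerator T := by
  refine (((T s).continuous.tendsto _).comp hw).congr fun t => ?_
  have : T s (T t w.1) = T t (T s w.1) := by
    have h1 := DFunLike.congr_fun (hT.add s t) w.1
    have h2 := DFunLike.congr_fun (hT.add t s) w.1
    rw [add_comm t s] at h2
    exact h1.symm.trans h2
  simp only [Function.comp_apply, map_smul, map_sub, this]

/-- The generator is a limit at time 0; T(y) = T(r)T(y - r) moves it to time r, but only from the
right. -/
lemma hasDerivWithinAt_semigroup {X : Type*} [NormedAddCommGroup X] [NormedSpace ℂ X]
    {T : ℝ≥0 → X →L[ℂ] X} (hT : IsC0Semigroup T) {w : X × X} (hw : w ∈ negGenerator T)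
    {r : ℝ} (hr : 0 ≤ r) :
    HasDerivWithinAt (fun r : ℝ => T r.toNNReal w.1) (-(T r.toNNReal w.2)) (Ici r) r := by
  rw [← hasDerivWithinAt_Ioi_iff_Ici, hasDerivWithinAt_iff_tendsto_slope' (by simp)]
  have h1 : Tendsto (fun y : ℝ => (y - r).toNNReal) (𝓝[>] r) (𝓝[>] 0) := by
    refine tendsto_nhdsWithin_iff.2 ⟨?_, ?_⟩
    · have : Continuous fun y : ℝ => (y - r).toNNReal := by fun_prop
      exact (this.tendsto' r 0 (by simp)).mono_left nhdsWithin_le_nhds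
    · filter_upwards [self_mem_nhdsWithin] with y hy
      simpa using hy
  have h2 := (((T r.toNNReal).continuous.tendsto _).comp (hw.comp h1)).neg
  refine h2.congr' ?_
  filter_upwards [self_mem_nhdsWithin] with y hy
  have hy' : r < y := hy
  have e : y.toNNReal = r.toNNReal + (y - r).toNNReal := by
    rw [← Real.toNNReal_add hr (sub_pos.2 hy').le]; congr 1; ring
  simp only [Function.comp_apply, slope, vsub_eq_sub, e, hT.add, ContinuousLinearMap.comp_apply,
    Real.coe_toNNReal _ (sub_pos.2 hy').le, map_smul, map_sub]
  rw [← Complex.ofReal_inv, Complex.coe_smul, ← smul_neg, neg_sub]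

/-- An accretive, densely defined operator generates at most one semigroup. -/
lemma eq_of_negGenerator_eq {S T : ℝ≥0 → H →L[ℂ] H} (hS : IsC0Semigroup S) (hT : IsC0Semigroup T)
    (h : negGenerator S = negGenerator T)
    (hacc : ∀ w ∈ negGenerator T, 0 ≤ (inner ℂ w.1 w.2).re)
    (hd : Dense (Prod.fst '' negGenerator T)) : S = T := by
  let _ : InnerProductSpace ℝ H := InnerProductSpace.complexToReal
  ext1 t
  refine ContinuousLinearMap.ext_on (s := Prod.fst '' negGenerator T) ?_ ?_
  · exact hd.mono Submodule.subset_span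
  rintro _ ⟨w, hw, rfl⟩
  let f : ℝ → H := fun r => S r.toNNReal w.1 - T r.toNNReal w.1
  have hf : ∀ r ∈ Ico (0 : ℝ) t, HasDerivWithinAt f
      (-(S r.toNNReal w.2) - -(T r.toNNReal w.2)) (Ici r) r := fun r hr =>
    (hasDerivWithinAt_semigroup hS (h ▸ hw) hr.1).sub (hasDerivWithinAt_semigroup hT hw hr.1)
  have hc : Continuous f := ((hS.cont _).comp continuous_real_toNNReal).sub
    ((hT.cont _).comp continuous_real_toNNReal)
  -- The difference f of the two orbits stays in the common domain and satisfies f' = -Af, so ‖f‖²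
  -- has right derivative -2 Re(Af, f) ≤ 0 and starts at 0.
  have key := image_le_of_deriv_right_le_deriv_boundary (f := fun r => ‖f r‖ ^ 2) (a := 0)
    (b := t) (B := fun _ => 0) (B' := fun _ => 0) (hc.norm.pow 2).continuousOn
    (fun r hr => (hf r hr).norm_sq) (by simp [f, hS.zero, hT.zero]) continuousOn_const
    (fun r _ => hasDerivWithinAt_const _ _ _) (fun r hr => ?_) (right_mem_Icc.2 t.2)
  · have : f t = 0 := by
      have : ‖f t‖ ^ 2 = 0 := le_antisymm key (sq_nonneg _)
      simpa using this
    simpa [f, sub_eq_zero] using this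
  · have hmem : (S r.toNNReal w.1, S r.toNNReal w.2) - (T r.toNNReal w.1, T r.toNNReal w.2) ∈
        negGenerator T :=
      negGenerator_sub (h ▸ negGenerator_invariant hS (h ▸ hw) _) (negGenerator_invariant hT hw _)
    have h1 := hacc _ hmem
    have h2 : -(S r.toNNReal w.2) - -(T r.toNNReal w.2) =
      -(S r.toNNReal w.2 - T r.toNNReal w.2) := by abel
    rw [h2, inner_neg_right]
    have h3 : inner ℝ (f r) (S r.toNNReal w.2 - T r.toNNReal w.2) =
      (inner ℂ (f r) (S r.toNNReal w.2 - T r.toNNReal w.2)).re := rfl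
    rw [h3]
    simp only [Prod.mk_sub_mk] at h1
    simp only [f]
    linarith

end Uniqueness

/-! ### Operators associated with elliptic forms in Hilbert spaces -/

section Forms

variable {H K : Type*} [NormedAddCommGroup H] [InnerProductSpace ℂ H] [CompleteSpace H]
  [NormedAddCommGroup K] [InnerProductSpace ℂ K] [CompleteSpace K]

local notation "⟪" x "," y "⟫" => inner ℂ x y

/-- `Re (M k, k) ≥ c ‖k‖²`. -/
def CoerciveOp (M : K →L[ℂ] K) (c : ℝ) : Prop := ∀ k, c * ‖k‖ ^ 2 ≤ (⟪k, M k⟫).re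

/-- `J = (1 + A)⁻¹`, where `A` is the operator induced by the form `(M u₂, v₂)` on `V`. -/
def IsFormResolvent (V : Submodule ℂ (H × K)) (M : K →L[ℂ] K) (J : H →L[ℂ] H) : Prop :=
  ∀ f, ∃ u ∈ V, u.1 = J f ∧ ∀ v ∈ V, ⟪v.1, u.1⟫ + ⟪v.2, M u.2⟫ = ⟪v.1, f⟫

/-- The graph of the operator induced by the form `(M u₂, v₂)` on `V`. -/
def formGraph (V : Submodule ℂ (H × K)) (M : K →L[ℂ] K) : Set (H × H) :=
  {w | ∃ u ∈ V, u.1 = w.1 ∧ ∀ v ∈ V, ⟪v.2, M u.2⟫ = ⟪v.1, w.2⟫}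

/-- Lax–Milgram on V: the operator (u₁, u₂) ↦ (u₁, M u₂), compressed to V by the orthogonal
projection, is coercive with constant min(1, c). The passage through `WithLp 2` supplies the Hilbert
norm that the plain product lacks. -/
lemma exists_isFormResolvent {V : Submodule ℂ (H × K)} (hV : IsClosed (V : Set (H × K)))
    {M : K →L[ℂ] K} {c : ℝ} (hc : 0 < c) (hM : CoerciveOp M c) :
    ∃ J : H →L[ℂ] H, IsFormResolvent V M J := by
  let e := WithLp.prodContinuousLinearEquiv 2 ℂ H K
  let W : Submodule ℂ (WithLp 2 (H × K)) := V.comap (e : WithLp 2 (H × K) →ₗ[ℂ] H × K)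
  have hW : IsClosed (W : Set (WithLp 2 (H × K))) := hV.preimage e.continuous
  have : CompleteSpace W := hW.completeSpace_coe
  let N : WithLp 2 (H × K) →L[ℂ] WithLp 2 (H × K) :=
    (e.symm : H × K →L[ℂ] WithLp 2 (H × K)) ∘L
      ((ContinuousLinearMap.id ℂ H).prodMap M) ∘L (e : WithLp 2 (H × K) →L[ℂ] H × K)
  let P := W.orthogonalProjectionOnto
  let B : W →L[ℂ] W := P ∘L N ∘L W.subtypeL
  have hB : ∀ v w : W, ⟪v, B w⟫ = ⟪(v : WithLp 2 (H × K)).fst, (w : WithLp 2 (H × K)).fst⟫ +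
      ⟪(v : WithLp 2 (H × K)).snd, M (w : WithLp 2 (H × K)).snd⟫ := fun v w => by
    have : ⟪v, B w⟫ = ⟪(v : WithLp 2 (H × K)), N w⟫ :=
      W.inner_orthogonalProjectionOnto_eq_of_mem_left v (N w)
    rw [this, WithLp.prod_inner_apply]
    rfl
  have hpos : (0 : ℝ) < min 1 c := lt_min one_pos hc
  have hunit : IsUnit B := by
    refine ContinuousLinearMap.isUnit_of_forall_le_norm_inner_map B
      (c := ⟨min 1 c, hpos.le⟩) hpos fun x => ?_
    rw [← inner_conj_symm, RCLike.norm_conj, hB]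
    refine le_trans ?_ (Complex.re_le_norm _)
    have h1 := hM (x : WithLp 2 (H × K)).snd
    have h2 : ‖x‖ ^ 2 = ‖(x : WithLp 2 (H × K)).fst‖ ^ 2 + ‖(x : WithLp 2 (H × K)).snd‖ ^ 2 := by
      rw [← WithLp.prod_norm_sq_eq_of_L2]; rfl
    rw [Complex.add_re, h2]
    have h3 : (⟪(x : WithLp 2 (H × K)).fst, (x : WithLp 2 (H × K)).fst⟫).re =
      ‖(x : WithLp 2 (H × K)).fst‖ ^ 2 := by
      rw [inner_self_eq_norm_sq_to_K]; norm_cast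
    rw [h3]
    change _ * min 1 c ≤ _
    have h4 : min 1 c ≤ 1 := min_le_left _ _
    have h5 : min 1 c ≤ c := min_le_right _ _
    nlinarith [sq_nonneg ‖(x : WithLp 2 (H × K)).fst‖, sq_nonneg ‖(x : WithLp 2 (H × K)).snd‖]
  obtain ⟨Bu, hBu⟩ := hunit
  let R : W →L[ℂ] W := ↑Bu⁻¹
  have hBR : ∀ w, B (R w) = w := fun w => by
    have : B * R = 1 := by rw [← hBu]; exact Bu.mul_inv
    exact DFunLike.congr_fun this w
  refine ⟨(ContinuousLinearMap.fst ℂ H K) ∘L (e : WithLp 2 (H × K) →L[ℂ] H × K) ∘L W.subtypeL ∘L R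
    ∘L P ∘L (e.symm : H × K →L[ℂ] WithLp 2 (H × K)) ∘L ContinuousLinearMap.inl ℂ H K, fun f => ?_⟩
  refine ⟨e (R (P (e.symm (f, 0)))), (R (P (e.symm (f, 0)))).2, rfl, fun v hv => ?_⟩
  let v' : W := ⟨e.symm v, by simpa [W] using hv⟩
  have h1 := hB v' (R (P (e.symm (f, 0))))
  rw [hBR] at h1
  have h2 : ⟪v', P (e.symm (f, 0))⟫ = ⟪(v' : WithLp 2 (H × K)), e.symm (f, 0)⟫ :=
    W.inner_orthogonalProjectionOnto_eq_of_mem_left v' _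
  rw [h2, WithLp.prod_inner_apply] at h1
  refine h1.symm.trans ?_
  change ⟪v.1, f⟫ + ⟪v.2, (0 : K)⟫ = _
  simp

variable {V : Submodule ℂ (H × K)} {M : K →L[ℂ] K} {c : ℝ}

lemma re_inner_self_eq (x : H) : (⟪x, x⟫).re = ‖x‖ ^ 2 := by
  rw [inner_self_eq_norm_sq_to_K]; norm_cast

lemma fst_unique_of_form (hc : 0 < c) (hM : CoerciveOp M c) {f : H} {u w : H × K}
    (hu : u ∈ V) (hw : w ∈ V) (h1 : ∀ v ∈ V, ⟪v.1, u.1⟫ + ⟪v.2, M u.2⟫ = ⟪v.1, f⟫)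
    (h2 : ∀ v ∈ V, ⟪v.1, w.1⟫ + ⟪v.2, M w.2⟫ = ⟪v.1, f⟫) : u = w := by
  have hd := V.sub_mem hu hw
  have h3 : ⟪(u - w).1, (u - w).1⟫ + ⟪(u - w).2, M (u - w).2⟫ = 0 := by
    have := (h1 _ hd).trans (h2 _ hd).symm
    rw [← sub_eq_zero] at this
    rw [← this]
    simp only [Prod.fst_sub, Prod.snd_sub, map_sub, inner_sub_right]
    ring
  have h4 := congrArg Complex.re h3
  rw [Complex.add_re, re_inner_self_eq] at h4
  have h5 := hM (u - w).2
  have h6 : ‖(u - w).1‖ ^ 2 = 0 := by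
    have : 0 ≤ c * ‖(u - w).2‖ ^ 2 := by positivity
    have := sq_nonneg ‖(u - w).1‖
    simp only [Complex.zero_re] at h4
    linarith
  have h7 : c * ‖(u - w).2‖ ^ 2 = 0 := by
    have : 0 ≤ c * ‖(u - w).2‖ ^ 2 := by positivity
    simp only [Complex.zero_re] at h4
    linarith
  have h8 : (u - w).1 = 0 := by simpa using h6
  have h9 : (u - w).2 = 0 := by simpa [hc.ne'] using h7
  exact sub_eq_zero.1 (Prod.ext h8 h9)

namespace IsFormResolvent

variable {J : H →L[ℂ] H}

lemma apply_eq (hJ : IsFormResolvent V M J) (hc : 0 < c) (hM : CoerciveOp M c) {f : H} {u : H × K}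
    (hu : u ∈ V) (h : ∀ v ∈ V, ⟪v.1, u.1⟫ + ⟪v.2, M u.2⟫ = ⟪v.1, f⟫) : J f = u.1 := by
  obtain ⟨w, hw, hw1, hw2⟩ := hJ f
  rw [← hw1, fst_unique_of_form hc hM hw hu hw2 h]

lemma norm_apply_le (hJ : IsFormResolvent V M J) (hc : 0 < c) (hM : CoerciveOp M c) (f : H) :
    ‖J f‖ ≤ ‖f‖ := by
  obtain ⟨u, hu, hu1, hu2⟩ := hJ f
  have h1 := congrArg Complex.re (hu2 u hu)
  rw [Complex.add_re, re_inner_self_eq] at h1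
  have h2 := hM u.2
  have h3 : (⟪u.1, f⟫).re ≤ ‖u.1‖ * ‖f‖ := (Complex.re_le_norm _).trans (norm_inner_le_norm _ _)
  have h4 : 0 ≤ c * ‖u.2‖ ^ 2 := by positivity
  rw [← hu1]
  by_contra! hlt
  have : 0 ≤ ‖f‖ := norm_nonneg f
  nlinarith

lemma norm_le (hJ : IsFormResolvent V M J) (hc : 0 < c) (hM : CoerciveOp M c) : ‖J‖ ≤ 1 :=
  J.opNorm_le_bound zero_le_one fun f => by simpa using hJ.norm_apply_le hc hM f

/-- This is the resolvent J = (1 + zA)⁻¹ with a complex parameter: later z = k ± i rotates the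
operator. -/
lemma mem_formGraph {z : ℂ} (hJ : IsFormResolvent V (z • M) J) (hz : z ≠ 0) (f : H) :
    (J f, z⁻¹ • (f - J f)) ∈ formGraph V M := by
  obtain ⟨u, hu, hu1, hu2⟩ := hJ f
  refine ⟨u, hu, hu1, fun v hv => ?_⟩
  have h := hu2 v hv
  simp only [smul_apply, inner_smul_right] at h
  simp only [inner_smul_right, inner_sub_right, ← hu1, ← h]
  field_simp
  ring

lemma apply_add_smul {z : ℂ} (hJ : IsFormResolvent V (z • M) J) (hc : 0 < c)
    (hM : CoerciveOp (z • M) c) {w : H × H} (hw : w ∈ formGraph V M) : J (w.1 + z • w.2) = w.1 := by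
  obtain ⟨u, hu, hu1, hu2⟩ := hw
  rw [hJ.apply_eq hc hM hu, hu1]
  intro v hv
  simp only [smul_apply, inner_smul_right, inner_add_right, hu2 v hv, hu1]

/-- The resolvent identity. -/
lemma identity {J' : H →L[ℂ] H} {z w : ℂ} (hJ : IsFormResolvent V (z • M) J) (hz : z ≠ 0)
    (hJ' : IsFormResolvent V (w • M) J') (hc : 0 < c) (hM : CoerciveOp (w • M) c) (f : H) :
    J' ((w / z) • f + (1 - w / z) • J f) = J f := by
  have := hJ'.apply_add_smul hc hM (hJ.mem_formGraph hz f)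
  simp only at this
  refine Eq.trans ?_ this
  congr 1
  rw [smul_smul, smul_sub, sub_smul, one_smul, div_eq_mul_inv]
  abel

/-- Each of the two resolvent equations is tested with the solution of the other. -/
lemma inner_apply_left {M' : K →L[ℂ] K} {J' : H →L[ℂ] H} (hJ : IsFormResolvent V M J)
    (hJ' : IsFormResolvent V M' J') (hadj : ∀ k l, ⟪k, M' l⟫ = ⟪M k, l⟫) (f g : H) :
    ⟪J f, g⟫ = ⟪f, J' g⟫ := by
  obtain ⟨u, hu, hu1, hu2⟩ := hJ f
  obtain ⟨v, hv, hv1, hv2⟩ := hJ' g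
  have h1 := congrArg (starRingEnd ℂ) (hu2 v hv)
  have h2 := hv2 u hu
  rw [map_add, inner_conj_symm, inner_conj_symm, inner_conj_symm] at h1
  rw [hadj] at h2
  rw [← hu1, ← hv1, ← h1, h2]

/-- For w in V, testing the equation for J_t w₁ with the difference of solution and w bounds the
squared error by a multiple of t. Density and contractivity extend the convergence to all of H. -/
lemma tendsto {J : ℝ → H →L[ℂ] H} (hJ : ∀ t : ℝ, 0 < t → IsFormResolvent V ((t : ℂ) • M) (J t))
    (hc : 0 < c) (hM : CoerciveOp M c) (hd : Dense (Prod.fst '' (V : Set (H × K)))) (f : H) :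
    Tendsto (fun t => J t f) (𝓝[>] 0) (𝓝 f) := by
  have hMt : ∀ t : ℝ, 0 < t → CoerciveOp ((t : ℂ) • M) (t * c) := fun t ht k => by
    have := hM k
    simp only [smul_apply, inner_smul_right, Complex.re_ofReal_mul, mul_assoc]
    gcongr
  have hV : ∀ w ∈ V, Tendsto (fun t => J t w.1) (𝓝[>] 0) (𝓝 w.1) := fun w hw => by
    have hb : ∀ t : ℝ, 0 < t → ‖J t w.1 - w.1‖ ^ 2 ≤ t * ((‖M‖ * ‖w.2‖) ^ 2 / (4 * c)) := by
      intro t ht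
      obtain ⟨u, hu, hu1, hu2⟩ := hJ t ht w.1
      have h1 := hu2 (u - w) (V.sub_mem hu hw)
      have h2 : ⟪(u - w).1, (u - w).1⟫ + t * (⟪(u - w).2, M (u - w).2⟫ + ⟪(u - w).2, M w.2⟫)
          = 0 := by
        simp only [smul_apply, inner_smul_right] at h1
        rw [← sub_eq_zero] at h1
        rw [← h1]
        simp only [Prod.fst_sub, Prod.snd_sub, map_sub, inner_sub_right]
        ring
      have h3 := congrArg Complex.re h2
      simp only [Complex.add_re, Complex.re_ofReal_mul, re_inner_self_eq, Complex.zero_re]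
        at h3
      have h4 := hM (u - w).2
      have h5 : -(⟪(u - w).2, M w.2⟫).re ≤ ‖(u - w).2‖ * (‖M‖ * ‖w.2‖) := by
        refine (neg_le_abs _).trans ((Complex.abs_re_le_norm _).trans ?_)
        refine (norm_inner_le_norm _ _).trans ?_
        gcongr
        exact M.le_opNorm _
      rw [← hu1]
      set a := ‖(u - w).2‖
      set b := ‖M‖ * ‖w.2‖
      -- The maximum of a ↦ ab - ca², by completing the square.
      have h6 : a * b - c * a ^ 2 ≤ b ^ 2 / (4 * c) := by
        rw [le_div_iff₀ (by positivity)]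
        nlinarith [sq_nonneg (2 * c * a - b)]
      have h7 : ‖(u - w).1‖ ^ 2 ≤ t * (a * b - c * a ^ 2) := by
        nlinarith
      have h8 : (u - w).1 = u.1 - w.1 := rfl
      rw [← h8]
      exact h7.trans (by gcongr)
    rw [tendsto_iff_norm_sub_tendsto_zero]
    have h0 : Tendsto (fun t : ℝ => t * ((‖M‖ * ‖w.2‖) ^ 2 / (4 * c))) (𝓝[>] 0) (𝓝 0) := by
      have : Continuous fun t : ℝ => t * ((‖M‖ * ‖w.2‖) ^ 2 / (4 * c)) := by fun_prop
      exact (this.tendsto' 0 0 (by simp)).mono_left nhdsWithin_le_nhds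
    have h1 : Tendsto (fun t => ‖J t w.1 - w.1‖ ^ 2) (𝓝[>] 0) (𝓝 0) := by
      refine tendsto_of_tendsto_of_tendsto_of_le_of_le' tendsto_const_nhds h0
        (.of_forall fun _ => sq_nonneg _) ?_
      filter_upwards [self_mem_nhdsWithin] with t ht using hb t ht
    have h2 := h1.sqrt
    simpa using h2
  rw [Metric.tendsto_nhds]
  intro ε hε
  obtain ⟨_, hg, ⟨w, hw, rfl⟩⟩ := Metric.dense_iff.1 hd f (ε / 3) (by positivity)
  filter_upwards [self_mem_nhdsWithin, Metric.tendsto_nhds.1 (hV w hw) (ε / 3) (by positivity)]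
    with t ht h1
  have ht' : (0 : ℝ) < t := ht
  have h2 : dist (J t f) (J t w.1) < ε / 3 := by
    rw [dist_eq_norm, ← map_sub]
    refine ((hJ t ht).norm_apply_le (mul_pos ht' hc) (hMt t ht) _).trans_lt ?_
    rwa [Metric.mem_ball', dist_eq_norm] at hg
  calc dist (J t f) f ≤ dist (J t f) (J t w.1) + dist (J t w.1) w.1 + dist w.1 f :=
        dist_triangle4 _ _ _ _
    _ < ε := by rw [Metric.mem_ball] at hg; linarith

lemma isResolventFamily {J : ℝ → H →L[ℂ] H}
    (hJ : ∀ t : ℝ, 0 < t → IsFormResolvent V ((t : ℂ) • M) (J t))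
    (hc : 0 < c) (hM : CoerciveOp M c) (hd : Dense (Prod.fst '' (V : Set (H × K)))) :
    IsResolventFamily J where
  norm_le t ht := (hJ t ht).norm_le (mul_pos ht hc) fun k => by
    have := hM k
    simp only [smul_apply, inner_smul_right, Complex.re_ofReal_mul, mul_assoc]
    gcongr
  identity s t hs ht x := by
    have := (hJ t ht).identity (by exact_mod_cast ht.ne') (hJ s hs) (mul_pos hs hc) (fun k => by
      have := hM k
      simp only [smul_apply, inner_smul_right, Complex.re_ofReal_mul, mul_assoc]
      gcongr) x
    push_cast
    exact this
  tendsto := tendsto hJ hc hM hd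

lemma resolventGraph_eq (hJ : IsFormResolvent V M J) (hc : 0 < c) (hM : CoerciveOp M c) :
    resolventGraph J = formGraph V M := by
  have hJ1 : IsFormResolvent V ((1 : ℂ) • M) J := by rwa [one_smul]
  ext w
  constructor
  · rintro ⟨y, rfl⟩
    simpa using hJ1.mem_formGraph one_ne_zero y
  · intro hw
    have := hJ1.apply_add_smul hc (by rwa [one_smul]) hw
    rw [one_smul] at this
    refine ⟨w.1 + w.2, ?_⟩
    rw [this]; simp

end IsFormResolvent

lemma accretive_formGraph (hc : 0 < c) (hM : CoerciveOp M c) {w : H × H} (hw : w ∈ formGraph V M) :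
    0 ≤ (⟪w.1, w.2⟫).re := by
  obtain ⟨u, hu, hu1, hu2⟩ := hw
  rw [← hu1, ← hu2 u hu]
  exact le_trans (by positivity) (hM u.2)

end Forms

/-! ### Sectors and matrices -/

lemma abs_arg_le_iff {z : ℂ} (hz : 0 < z.re) {θ : ℝ} (h0 : 0 ≤ θ) (hθ : θ < Real.pi / 2) :
    |z.arg| ≤ θ ↔ |z.im| ≤ Real.tan θ * z.re := by
  have h1 : |z.arg| < Real.pi / 2 := Complex.abs_arg_lt_pi_div_two_iff.2 (Or.inl hz)
  have h2 : z.arg ∈ Ioo (-(Real.pi / 2)) (Real.pi / 2) := abs_lt.1 h1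
  have h3 : θ ∈ Ioo (-(Real.pi / 2)) (Real.pi / 2) := ⟨by linarith [Real.pi_pos], hθ⟩
  have h4 : -θ ∈ Ioo (-(Real.pi / 2)) (Real.pi / 2) := ⟨by linarith, by linarith [Real.pi_pos]⟩
  rw [abs_le, abs_le, ← Real.strictMonoOn_tan.le_iff_le h4 h2, ← Real.strictMonoOn_tan.le_iff_le h2 h3,
    Complex.tan_arg, Real.tan_neg, div_le_iff₀ hz, le_div_iff₀ hz, neg_mul]

section Matrices

variable {d : ℕ}

/-- Coercivity makes arctan(‖L‖/m) an admissible angle, so the infimum defining ω_L is below π/2 and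
tan ω_L is controlled by ‖L‖/m. For each unit vector |arg| is a lower bound of the admissible
angles, hence at most ω_L; homogeneity gives all vectors. -/
lemma im_inner_le_of_coercive {L : Matrix (Fin d) (Fin d) ℂ} {m : ℝ} (hm : 0 < m)
    (h : CoerciveWith L m) : 0 ≤ omega L ∧ omega L < Real.pi / 2 ∧
      Real.tan (omega L) * m ≤ ‖Matrix.toEuclideanCLM (𝕜 := ℂ) L‖ ∧
      ∀ ξ, |(inner ℂ ξ (Matrix.toEuclideanCLM (𝕜 := ℂ) L ξ)).im| ≤
        Real.tan (omega L) * (inner ℂ ξ (Matrix.toEuclideanCLM (𝕜 := ℂ) L ξ)).re := by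
  set A := Matrix.toEuclideanCLM (𝕜 := ℂ) L
  have hre : ∀ ξ : EuclideanSpace ℂ (Fin d), ‖ξ‖ = 1 → m ≤ (inner ℂ ξ (A ξ)).re := fun ξ hξ => by
    simpa [hξ] using h ξ
  have him : ∀ ξ : EuclideanSpace ℂ (Fin d), ‖ξ‖ = 1 → |(inner ℂ ξ (A ξ)).im| ≤ ‖A‖ := fun ξ hξ => by
    refine (Complex.abs_im_le_norm _).trans ((norm_inner_le_norm _ _).trans ?_)
    rw [hξ, one_mul]
    simpa [hξ] using A.le_opNorm ξ
  have hA : 0 ≤ ‖A‖ / m := by positivity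
  set θ := Real.arctan (‖A‖ / m)
  have hθ0 : 0 ≤ θ := Real.arctan_nonneg.2 hA
  have hθ : θ < Real.pi / 2 := Real.arctan_lt_pi_div_two _
  have hmem : θ ∈ {θ | 0 ≤ θ ∧ θ < Real.pi ∧ matNumRange L ⊆ sector θ} := by
    refine ⟨hθ0, by linarith [Real.pi_pos], ?_⟩
    rintro _ ⟨ξ, hξ, rfl⟩
    left
    refine (abs_arg_le_iff (hm.trans_le (hre ξ hξ)) hθ0 hθ).2 ?_
    rw [Real.tan_arctan]
    refine (him ξ hξ).trans ?_
    rw [div_mul_eq_mul_div, le_div_iff₀ hm]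
    exact mul_le_mul_of_nonneg_left (hre ξ hξ) (norm_nonneg _)
  have hbdd : BddBelow {θ | 0 ≤ θ ∧ θ < Real.pi ∧ matNumRange L ⊆ sector θ} := ⟨0, fun _ h => h.1⟩
  have h0 : 0 ≤ omega L := le_csInf ⟨θ, hmem⟩ fun _ h => h.1
  have h1 : omega L ≤ θ := csInf_le hbdd hmem
  have h2 : omega L < Real.pi / 2 := h1.trans_lt hθ
  refine ⟨h0, h2, ?_, fun ξ => ?_⟩
  · have : Real.tan (omega L) ≤ Real.tan θ :=
      (Real.strictMonoOn_tan.le_iff_le ⟨by linarith [Real.pi_pos], h2⟩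
        ⟨by linarith [Real.pi_pos], hθ⟩).2 h1
    rwa [Real.tan_arctan, le_div_iff₀ hm] at this
  · rcases eq_or_ne ξ 0 with rfl | hξ
    · simp
    set ζ := ((‖ξ‖ : ℂ)⁻¹) • ξ with hζ
    have hn : ‖ξ‖ ≠ 0 := norm_ne_zero_iff.2 hξ
    have hζ1 : ‖ζ‖ = 1 := by
      rw [hζ, norm_smul, norm_inv, Complex.norm_real, norm_norm, inv_mul_cancel₀ hn]
    have e : inner ℂ ξ (A ξ) = ((‖ξ‖ ^ 2 : ℝ) : ℂ) * inner ℂ ζ (A ζ) := by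
      rw [hζ, map_smul, inner_smul_left, inner_smul_right, map_inv₀, Complex.conj_ofReal]
      have : (‖ξ‖ : ℂ) ≠ 0 := by exact_mod_cast hn
      push_cast
      field_simp
    have hpos : 0 < (inner ℂ ζ (A ζ)).re := hm.trans_le (hre ζ hζ1)
    have key : |(inner ℂ ζ (A ζ)).im| ≤ Real.tan (omega L) * (inner ℂ ζ (A ζ)).re := by
      rw [← abs_arg_le_iff hpos h0 h2]
      refine le_csInf ⟨θ, hmem⟩ fun θ' h' => ?_
      rcases h'.2.2 ⟨ζ, hζ1, rfl⟩ with h'' | h''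
      · exact h''
      · have : inner ℂ ζ (A ζ) = 0 := h''
        rw [this] at hpos
        simp at hpos
    rw [e, Complex.re_ofReal_mul, Complex.im_ofReal_mul, abs_mul, abs_of_nonneg (by positivity),
      mul_left_comm]
    gcongr

/-- The vector `a + i b`. -/
def cplx (a b : EuclideanSpace ℝ (Fin d)) : EuclideanSpace ℂ (Fin d) :=
  WithLp.toLp 2 fun i => ⟨a i, b i⟩

lemma norm_cplx_sq (a b : EuclideanSpace ℝ (Fin d)) : ‖cplx a b‖ ^ 2 = ‖a‖ ^ 2 + ‖b‖ ^ 2 := by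
  simp only [EuclideanSpace.norm_sq_eq, cplx, ← Finset.sum_add_distrib]
  refine Finset.sum_congr rfl fun i _ => ?_
  rw [Complex.sq_norm, Complex.normSq_mk, Real.norm_eq_abs, Real.norm_eq_abs, sq_abs, sq_abs]
  ring

lemma toEuclideanCLM_apply_coord {𝕜 : Type*} [RCLike 𝕜] (L : Matrix (Fin d) (Fin d) 𝕜)
    (ξ : EuclideanSpace 𝕜 (Fin d)) (i : Fin d) :
    Matrix.toEuclideanCLM (𝕜 := 𝕜) L ξ i = ∑ j, L i j * ξ j := rfl

lemma inner_toEuclideanCLM {𝕜 : Type*} [RCLike 𝕜] (L : Matrix (Fin d) (Fin d) 𝕜)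
    (ζ ξ : EuclideanSpace 𝕜 (Fin d)) :
    inner 𝕜 ζ (Matrix.toEuclideanCLM (𝕜 := 𝕜) L ξ) =
      ∑ i, ∑ j, L i j * ξ j * (starRingEnd 𝕜) (ζ i) := by
  simp only [PiLp.inner_apply, RCLike.inner_apply, toEuclideanCLM_apply_coord, Finset.sum_mul]

lemma inner_cplx_re (L : Matrix (Fin d) (Fin d) ℂ) (a b a' b' : EuclideanSpace ℝ (Fin d)) :
    (inner ℂ (cplx a' b') (Matrix.toEuclideanCLM (𝕜 := ℂ) L (cplx a b))).re =
      inner ℝ a' (Matrix.toEuclideanCLM (𝕜 := ℝ) (L.map Complex.re) a) +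
      inner ℝ b' (Matrix.toEuclideanCLM (𝕜 := ℝ) (L.map Complex.re) b) -
      inner ℝ a' (Matrix.toEuclideanCLM (𝕜 := ℝ) (L.map Complex.im) b) +
      inner ℝ b' (Matrix.toEuclideanCLM (𝕜 := ℝ) (L.map Complex.im) a) := by
  simp only [inner_toEuclideanCLM, Complex.re_sum, ← Finset.sum_add_distrib,
    ← Finset.sum_sub_distrib]
  refine Finset.sum_congr rfl fun i _ => Finset.sum_congr rfl fun j _ => ?_
  simp [cplx]
  ring

lemma inner_cplx_im (L : Matrix (Fin d) (Fin d) ℂ) (a b a' b' : EuclideanSpace ℝ (Fin d)) :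
    (inner ℂ (cplx a' b') (Matrix.toEuclideanCLM (𝕜 := ℂ) L (cplx a b))).im =
      inner ℝ a' (Matrix.toEuclideanCLM (𝕜 := ℝ) (L.map Complex.re) b) -
      inner ℝ b' (Matrix.toEuclideanCLM (𝕜 := ℝ) (L.map Complex.re) a) +
      inner ℝ a' (Matrix.toEuclideanCLM (𝕜 := ℝ) (L.map Complex.im) a) +
      inner ℝ b' (Matrix.toEuclideanCLM (𝕜 := ℝ) (L.map Complex.im) b) := by
  simp only [inner_toEuclideanCLM, Complex.im_sum, ← Finset.sum_add_distrib,
    ← Finset.sum_sub_distrib]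
  refine Finset.sum_congr rfl fun i _ => Finset.sum_congr rfl fun j _ => ?_
  simp [cplx]
  ring

/-- Cauchy–Schwarz, followed by 2‖a‖‖b‖ ≤ ‖a‖² + ‖b‖², which absorbs the factor 2 in front of σ. -/
lemma abs_bilin_add_le {E : Type*} [NormedAddCommGroup E] [InnerProductSpace ℝ E] (A : E →L[ℝ] E)
    (a b : E) {x y σ : ℝ} (h : |x| + |y| ≤ 2 * σ) :
    |x * inner ℝ a (A b) + y * inner ℝ b (A a)| ≤ σ * ‖A‖ * (‖a‖ ^ 2 + ‖b‖ ^ 2) := by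
  have h1 : |inner ℝ a (A b)| ≤ ‖A‖ * (‖a‖ * ‖b‖) := by
    refine (abs_real_inner_le_norm _ _).trans ?_
    have := A.le_opNorm b
    nlinarith [norm_nonneg a]
  have h2 : |inner ℝ b (A a)| ≤ ‖A‖ * (‖a‖ * ‖b‖) := by
    refine (abs_real_inner_le_norm _ _).trans ?_
    have := A.le_opNorm a
    nlinarith [norm_nonneg b]
  have h3 : 0 ≤ ‖A‖ * (‖a‖ * ‖b‖) := by positivity
  calc _ ≤ |x| * |inner ℝ a (A b)| + |y| * |inner ℝ b (A a)| := by
        refine (abs_add_le _ _).trans ?_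
        rw [abs_mul, abs_mul]
    _ ≤ |x| * (‖A‖ * (‖a‖ * ‖b‖)) + |y| * (‖A‖ * (‖a‖ * ‖b‖)) := by gcongr
    _ = (|x| + |y|) * (‖A‖ * (‖a‖ * ‖b‖)) := by ring
    _ ≤ 2 * σ * (‖A‖ * (‖a‖ * ‖b‖)) := by gcongr
    _ = σ * ‖A‖ * (2 * ‖a‖ * ‖b‖) := by ring
    _ ≤ σ * ‖A‖ * (‖a‖ ^ 2 + ‖b‖ ^ 2) := by
        have : 0 ≤ σ := by linarith [abs_nonneg x, abs_nonneg y]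
        gcongr
        exact two_mul_le_add_sq _ _

/-- The numbers s - 1 and 1 - s⁻¹ have the same sign. -/
lemma abs_sub_one_add_abs {s : ℝ} (hs : 0 < s) : |s - 1| + |s⁻¹ - 1| = |s - s⁻¹| := by
  rcases le_total 1 s with h | h
  · have h1 : s⁻¹ ≤ 1 := inv_le_one_of_one_le₀ h
    rw [abs_of_nonneg (by linarith), abs_of_nonpos (by linarith), abs_of_nonneg (by linarith)]
    ring
  · have h1 : 1 ≤ s⁻¹ := (one_le_inv₀ hs).2 h
    rw [abs_of_nonpos (by linarith), abs_of_nonneg (by linarith), abs_of_nonpos (by linarith)]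
    ring

/-- Replacing a by s⁻¹a in one slot and by sa in the other leaves the a–a and b–b terms alone. The
mixed terms change by s - 1 and s⁻¹ - 1; they carry Im L in the real part and Re L in the imaginary
part, which is why the two bounds involve different norms. -/
lemma inner_cplx_smul_sub_le (L : Matrix (Fin d) (Fin d) ℂ) (a b : EuclideanSpace ℝ (Fin d))
    {s : ℝ} (hs : 0 < s) :
    |(inner ℂ (cplx (s • a) b) (Matrix.toEuclideanCLM (𝕜 := ℂ) L (cplx (s⁻¹ • a) b))).re -
      (inner ℂ (cplx a b) (Matrix.toEuclideanCLM (𝕜 := ℂ) L (cplx a b))).re| ≤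
        |(s - s⁻¹) / 2| * normIm L * (‖a‖ ^ 2 + ‖b‖ ^ 2) ∧
    |(inner ℂ (cplx (s • a) b) (Matrix.toEuclideanCLM (𝕜 := ℂ) L (cplx (s⁻¹ • a) b))).im -
      (inner ℂ (cplx a b) (Matrix.toEuclideanCLM (𝕜 := ℂ) L (cplx a b))).im| ≤
        |(s - s⁻¹) / 2| * normRe L * (‖a‖ ^ 2 + ‖b‖ ^ 2) := by
  have hσ : |s - 1| + |s⁻¹ - 1| = 2 * |(s - s⁻¹) / 2| := by
    rw [abs_sub_one_add_abs hs, abs_div, abs_two]; ring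
  have hs' := hs.ne'
  constructor
  · rw [inner_cplx_re, inner_cplx_re]
    have := abs_bilin_add_le (Matrix.toEuclideanCLM (𝕜 := ℝ) (L.map Complex.im)) a b
      (x := -(s - 1)) (y := s⁻¹ - 1) (σ := |(s - s⁻¹) / 2|) (by rw [abs_neg, hσ])
    refine le_trans (le_of_eq ?_) this
    simp only [map_smul, inner_smul_left, inner_smul_right, RCLike.conj_to_real]
    congr 1
    field_simp
    ring
  · rw [inner_cplx_im, inner_cplx_im]
    have := abs_bilin_add_le (Matrix.toEuclideanCLM (𝕜 := ℝ) (L.map Complex.re)) a b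
      (x := s - 1) (y := -(s⁻¹ - 1)) (σ := |(s - s⁻¹) / 2|) (by rw [abs_neg, hσ])
    refine le_trans (le_of_eq ?_) this
    simp only [map_smul, inner_smul_left, inner_smul_right, RCLike.conj_to_real]
    congr 1
    field_simp
    ring

/-- The number `(L ξ, (p - 1) Re ξ + i Im ξ)` for `ξ = a + i b`. -/
def pForm (L : Matrix (Fin d) (Fin d) ℂ) (p : ℝ) (a b : EuclideanSpace ℝ (Fin d)) : ℂ :=
  inner ℂ (cplx ((p - 1) • a) b) (Matrix.toEuclideanCLM (𝕜 := ℂ) L (cplx a b))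

lemma sigma_eq {p : ℝ} (hp : 1 < p) : sigma p = (√(p - 1) - (√(p - 1))⁻¹) / 2 := by
  have h1 : 0 < √(p - 1) := Real.sqrt_pos.2 (by linarith)
  have h2 : √(p - 1) ^ 2 = p - 1 := Real.sq_sqrt (by linarith)
  unfold sigma
  have h3 : p - 2 = √(p - 1) ^ 2 - 1 := by rw [h2]; ring
  rw [h3]
  field_simp

/-- With ξ = √(p-1) a + ib, `pForm` is a perturbation of (Lξ, ξ) of the size just computed.
Coercivity and the angle ω_L control (Lξ, ξ) itself. -/
lemma pForm_bounds {L : Matrix (Fin d) (Fin d) ℂ} {m p : ℝ} (hm : 0 < m) (hp : 1 < p)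
    (h : CoerciveWith L m) (hσ : |sigma p| * normIm L ≤ m) (a b : EuclideanSpace ℝ (Fin d)) :
    0 ≤ (pForm L p a b).re ∧
    (|sigma p| * normIm L < m →
      |(pForm L p a b).im| ≤ (Real.tan (omega L) * m + |sigma p| * normRe L) /
        (m - |sigma p| * normIm L) * (pForm L p a b).re) := by
  set s := √(p - 1)
  have hs : 0 < s := Real.sqrt_pos.2 (by linarith)
  have hs2 : s ^ 2 = p - 1 := Real.sq_sqrt (by linarith)
  have e : pForm L p a b = inner ℂ (cplx (s • (s • a)) b)
      (Matrix.toEuclideanCLM (𝕜 := ℂ) L (cplx (s⁻¹ • (s • a)) b)) := by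
    rw [pForm, inv_smul_smul₀ hs.ne', smul_smul, ← pow_two, hs2]
  obtain ⟨h1, h2⟩ := inner_cplx_smul_sub_le L (s • a) b hs
  rw [← e, ← sigma_eq hp] at h1 h2
  obtain ⟨ho, -, -, h4⟩ := im_inner_le_of_coercive hm h
  replace h4 := h4 (cplx (s • a) b)
  have h5 := h (cplx (s • a) b)
  have hn := norm_cplx_sq (s • a) b
  rw [hn] at h5
  set N := ‖s • a‖ ^ 2 + ‖b‖ ^ 2
  have hN : 0 ≤ N := by positivity
  set z := inner ℂ (cplx (s • a) b) (Matrix.toEuclideanCLM (𝕜 := ℂ) L (cplx (s • a) b))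
  set w := pForm L p a b
  have hI : 0 ≤ |sigma p| * normIm L := mul_nonneg (abs_nonneg _) (norm_nonneg _)
  have hR : 0 ≤ |sigma p| * normRe L := mul_nonneg (abs_nonneg _) (norm_nonneg _)
  set i := |sigma p| * normIm L
  set r := |sigma p| * normRe L
  have h6 := abs_le.1 h1
  have h7 := abs_le.1 h2
  have h8 := abs_le.1 h4
  have hiN : i * N ≤ m * N := by gcongr
  have hw : z.re - i * N ≤ w.re := by linarith
  refine ⟨by linarith, fun hlt => ?_⟩
  have hpos : 0 < m - i := by linarith
  rw [div_mul_eq_mul_div, le_div_iff₀ hpos]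
  have ht : 0 ≤ Real.tan (omega L) :=
    Real.tan_nonneg_of_nonneg_of_le_pi_div_two ho (by
      linarith [(im_inner_le_of_coercive hm h).2.1])
  set t := Real.tan (omega L)
  have h9 : |w.im| ≤ t * z.re + r * N := by
    rw [abs_le]; constructor <;> linarith
  calc |w.im| * (m - i) ≤ (t * z.re + r * N) * (m - i) := by gcongr
    _ ≤ (t * m + r) * (z.re - i * N) := by
        -- This product is exactly the difference of the two sides to be compared; it is nonnegative
        -- since Re(Lξ, ξ) ≥ m|ξ|².
        have h10 : 0 ≤ (r + t * i) * (z.re - m * N) :=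
          mul_nonneg (by positivity) (by linarith)
        nlinarith
    _ ≤ (t * m + r) * w.re := by gcongr

lemma norm_toEuclideanCLM_le {𝕜 : Type*} [RCLike 𝕜] (L : Matrix (Fin d) (Fin d) 𝕜) {C : ℝ}
    (h : ∀ i j, ‖L i j‖ ≤ C) : ‖Matrix.toEuclideanCLM (𝕜 := 𝕜) L‖ ≤
      C * ∑ i, ∑ j, ‖Matrix.toEuclideanCLM (n := Fin d) (𝕜 := 𝕜) (Matrix.single i j (1 : 𝕜))‖ := by
  conv_lhs => rw [Matrix.matrix_eq_sum_single L, map_sum]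
  rw [Finset.mul_sum]
  refine norm_sum_le_of_le _ fun i _ => ?_
  rw [map_sum, Finset.mul_sum]
  refine norm_sum_le_of_le _ fun j _ => ?_
  have : Matrix.single i j (L i j) = L i j • Matrix.single i j (1 : 𝕜) := by
    rw [Matrix.smul_single, smul_eq_mul, mul_one]
  rw [this, map_smul, norm_smul]
  gcongr
  exact h i j

end Matrices

/-! ### The constants -/

lemma Psi_eq (s : ℝ) : Psi s = (sigma s)⁻¹ := by
  unfold Psi sigma
  rw [inv_div]

lemma strictMonoOn_sigma : StrictMonoOn sigma (Ioi 1) := by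
  intro p hp q hq hpq
  have hp' : 1 < p := hp
  have hq' : 1 < q := hq
  have h1 : 0 < √(p - 1) := Real.sqrt_pos.2 (by linarith)
  have h2 : √(p - 1) < √(q - 1) := Real.sqrt_lt_sqrt (by linarith) (by linarith)
  have h3 : (√(q - 1))⁻¹ < (√(p - 1))⁻¹ := by gcongr
  rw [sigma_eq hp', sigma_eq hq']
  linarith

/-- Since q' - 1 = 1/(q - 1), conjugation inverts s in (s - s⁻¹)/2. -/
lemma sigma_conj {q : ℝ} (hq : 1 < q) : sigma (q / (q - 1)) = -sigma q := by
  have h1 : 0 < q - 1 := by linarith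
  have h3 : q / (q - 1) - 1 = (q - 1)⁻¹ := by field_simp; ring
  have h4 : 1 < q / (q - 1) := by rw [lt_div_iff₀ h1]; linarith
  rw [sigma_eq h4, sigma_eq hq, h3, Real.sqrt_inv, inv_inv]
  ring

lemma exists_sigma_eq {x : ℝ} (hx : 0 < x) : ∃ q, 2 < q ∧ sigma q = x := by
  -- The positive root of (r - r⁻¹)/2 = x; then q - 1 = r².
  set r := x + √(x ^ 2 + 1)
  have h1 : 1 < √(x ^ 2 + 1) := by
    rw [Real.lt_sqrt zero_le_one]; nlinarith
  have h2 : √(x ^ 2 + 1) ^ 2 = x ^ 2 + 1 := Real.sq_sqrt (by positivity)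
  have hr : 1 < r := by simp only [r]; linarith
  have hr0 : r ^ 2 + 1 - 1 = r ^ 2 := by ring
  refine ⟨r ^ 2 + 1, by nlinarith, ?_⟩
  rw [sigma_eq (by nlinarith), hr0, Real.sqrt_sq (by linarith)]
  have : r ^ 2 - 1 = 2 * x * r := by simp only [r]; nlinarith
  field_simp
  linarith

/-! ### Finiteness of the essential suprema -/

section EssSup

variable {d : ℕ} {Ω : Set (EuclideanSpace ℝ (Fin d))}
  {μ : EuclideanSpace ℝ (Fin d) → Matrix (Fin d) (Fin d) ℂ}
  {m : EuclideanSpace ℝ (Fin d) → ℝ} {m₀ : ℝ}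

lemma exists_norm_bound (hμ_bdd : ∃ C : ℝ, ∀ᵐ x ∂(volume.restrict Ω), ∀ i j, ‖μ x i j‖ ≤ C) :
    ∃ C : ℝ, 0 ≤ C ∧ ∀ᵐ x ∂(volume.restrict Ω), ‖Matrix.toEuclideanCLM (𝕜 := ℂ) (μ x)‖ ≤ C ∧
      normRe (μ x) ≤ C ∧ normIm (μ x) ≤ C := by
  obtain ⟨C, hC⟩ := hμ_bdd
  set K₁ := |C| * ∑ i, ∑ j, ‖Matrix.toEuclideanCLM (n := Fin d) (𝕜 := ℂ) (Matrix.single i j (1 : ℂ))‖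
  set K₂ := |C| * ∑ i, ∑ j, ‖Matrix.toEuclideanCLM (n := Fin d) (𝕜 := ℝ) (Matrix.single i j (1 : ℝ))‖
  have h1 : 0 ≤ K₁ := by positivity
  have h2 : 0 ≤ K₂ := by positivity
  refine ⟨K₁ + K₂, by positivity, ?_⟩
  filter_upwards [hC] with x hx
  have hx' : ∀ i j, ‖μ x i j‖ ≤ |C| := fun i j => (hx i j).trans (le_abs_self C)
  refine ⟨(norm_toEuclideanCLM_le _ hx').trans (by linarith), ?_, ?_⟩
  · refine (norm_toEuclideanCLM_le _ (C := |C|) fun i j => ?_).trans (show K₂ ≤ K₁ + K₂ by linarith)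
    exact (Complex.abs_re_le_norm _).trans (hx' i j)
  · refine (norm_toEuclideanCLM_le _ (C := |C|) fun i j => ?_).trans (show K₂ ≤ K₁ + K₂ by linarith)
    exact (Complex.abs_im_le_norm _).trans (hx' i j)

/-- Boundedness of μ and m ≥ m₀ make η finite; if it were not positive, Im μ would vanish almost
everywhere. -/
lemma exists_eta_eq (hm₀ : 0 < m₀)
    (hμ_bdd : ∃ C : ℝ, ∀ᵐ x ∂(volume.restrict Ω), ∀ i j, ‖μ x i j‖ ≤ C)
    (hm : ∀ᵐ x ∂(volume.restrict Ω), m₀ ≤ m x ∧ CoerciveWith (μ x) (m x))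
    (hIm : ¬ ∀ᵐ x ∂(volume.restrict Ω), (μ x).map Complex.im = 0) :
    ∃ η : ℝ, 0 < η ∧ (η : EReal) = eta Ω μ m ∧
      ∀ᵐ x ∂(volume.restrict Ω), normIm (μ x) ≤ η * m x := by
  obtain ⟨C, hC0, hC⟩ := exists_norm_bound hμ_bdd
  have hae : ∀ᵐ x ∂(volume.restrict Ω), ((normIm (μ x) / m x : ℝ) : EReal) ≤ eta Ω μ m :=
    ae_le_essSup
  have hle : eta Ω μ m ≤ ((C / m₀ : ℝ) : EReal) := by
    refine essSup_le_of_ae_le _ ?_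
    filter_upwards [hC, hm] with x hx hmx
    rw [EReal.coe_le_coe_iff]
    have : 0 < m x := hm₀.trans_le hmx.1
    gcongr
    · exact hx.2.2
    · exact hmx.1
  have hpos : 0 < eta Ω μ m := by
    by_contra! hneg
    apply hIm
    filter_upwards [hae, hm] with x hx hmx
    have h1 : ((normIm (μ x) / m x : ℝ) : EReal) ≤ ((0 : ℝ) : EReal) := hx.trans hneg
    rw [EReal.coe_le_coe_iff] at h1
    have h2 : 0 < m x := hm₀.trans_le hmx.1
    have h3 : normIm (μ x) ≤ 0 := by
      rw [div_le_iff₀ h2] at h1; simpa using h1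
    have h4 : Matrix.toEuclideanCLM (𝕜 := ℝ) ((μ x).map Complex.im) = 0 := norm_le_zero_iff.1 h3
    simpa using h4
  have hcoe : ((eta Ω μ m).toReal : EReal) = eta Ω μ m :=
    EReal.coe_toReal (ne_top_of_le_ne_top (EReal.coe_ne_top _) hle) (ne_bot_of_gt hpos)
  refine ⟨(eta Ω μ m).toReal, ?_, hcoe, ?_⟩
  · rw [← hcoe] at hpos; exact_mod_cast hpos
  · filter_upwards [hae, hm] with x hx hmx
    have h2 : 0 < m x := hm₀.trans_le hmx.1
    rw [← hcoe, EReal.coe_le_coe_iff, div_le_iff₀ h2] at hx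
    exact hx

/-- The strict inequality |σ_p| η < 1 keeps the denominators above m₀(1 - |σ_p| η). The quotient
dominates tan ω_{μ(x)}, so κ also controls the numerical range of μ(x) itself, which the rotated L²
forms require. -/
lemma exists_kappa_eq (hm₀ : 0 < m₀)
    (hμ_bdd : ∃ C : ℝ, ∀ᵐ x ∂(volume.restrict Ω), ∀ i j, ‖μ x i j‖ ≤ C)
    (hm : ∀ᵐ x ∂(volume.restrict Ω), m₀ ≤ m x ∧ CoerciveWith (μ x) (m x))
    (hIm : ¬ ∀ᵐ x ∂(volume.restrict Ω), (μ x).map Complex.im = 0) {p η : ℝ}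
    (hη : ∀ᵐ x ∂(volume.restrict Ω), normIm (μ x) ≤ η * m x) (hp : |sigma p| * η < 1) :
    ∃ κ : ℝ, 0 ≤ κ ∧ (κ : EReal) = kappa Ω μ m p ∧ ∀ᵐ x ∂(volume.restrict Ω),
      |sigma p| * normIm (μ x) < m x ∧ Real.tan (omega (μ x)) ≤ κ ∧
      (Real.tan (omega (μ x)) * m x + |sigma p| * normRe (μ x)) /
        (m x - |sigma p| * normIm (μ x)) ≤ κ := by
  obtain ⟨C, hC0, hC⟩ := exists_norm_bound hμ_bdd
  have hae : ∀ᵐ x ∂(volume.restrict Ω), (((Real.tan (omega (μ x)) * m x + |sigma p| * normRe (μ x)) /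
    (m x - |sigma p| * normIm (μ x)) : ℝ) : EReal) ≤ kappa Ω μ m p := ae_le_essSup
  have hbasic : ∀ᵐ x ∂(volume.restrict Ω), m₀ ≤ m x ∧
      m₀ * (1 - |sigma p| * η) ≤ m x - |sigma p| * normIm (μ x) ∧
      |sigma p| * normIm (μ x) < m x ∧ 0 ≤ Real.tan (omega (μ x)) ∧
      Real.tan (omega (μ x)) * m x ≤ C := by
    filter_upwards [hC, hm, hη] with x hx hmx hηx
    have h2 : 0 < m x := hm₀.trans_le hmx.1
    obtain ⟨ho, ho', ht, -⟩ := im_inner_le_of_coercive h2 hmx.2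
    have h3 : |sigma p| * normIm (μ x) ≤ |sigma p| * (η * m x) := by gcongr
    refine ⟨hmx.1, ?_, ?_, Real.tan_nonneg_of_nonneg_of_le_pi_div_two ho ho'.le, ht.trans hx.1⟩
    · nlinarith [hmx.1]
    · nlinarith
  have hle : kappa Ω μ m p ≤ (((C + |sigma p| * C) / (m₀ * (1 - |sigma p| * η)) : ℝ) : EReal) := by
    refine essSup_le_of_ae_le _ ?_
    filter_upwards [hC, hbasic] with x hx hb
    rw [EReal.coe_le_coe_iff]
    have : 0 < m₀ * (1 - |sigma p| * η) := mul_pos hm₀ (by linarith)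
    gcongr
    · exact hb.2.2.2.2
    · exact hx.2.1
    · exact hb.2.1
  -- On a null set Ω the imaginary part would vanish a.e.; a point is needed to see that the
  -- essential supremum is not ⊥.
  have hne : (ae (volume.restrict Ω)).NeBot := by
    rw [neBot_iff]
    intro h
    exact hIm (by rw [Filter.Eventually, h]; trivial)
  have hpos : 0 ≤ kappa Ω μ m p := by
    obtain ⟨x, hx, hb⟩ := (hae.and hbasic).exists
    refine le_trans ?_ hx
    have : (0 : ℝ) ≤ (Real.tan (omega (μ x)) * m x + |sigma p| * normRe (μ x)) /
        (m x - |sigma p| * normIm (μ x)) := by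
      refine div_nonneg (add_nonneg (mul_nonneg hb.2.2.2.1 (by linarith))
        (mul_nonneg (abs_nonneg _) (norm_nonneg _))) (by linarith)
    exact_mod_cast this
  have hcoe : ((kappa Ω μ m p).toReal : EReal) = kappa Ω μ m p :=
    EReal.coe_toReal (ne_top_of_le_ne_top (EReal.coe_ne_top _) hle)
      (ne_bot_of_le_ne_bot (by simp) hpos)
  refine ⟨(kappa Ω μ m p).toReal, ?_, hcoe, ?_⟩
  · rw [← hcoe] at hpos; exact_mod_cast hpos
  · filter_upwards [hae, hbasic] with x hx hb
    rw [← hcoe, EReal.coe_le_coe_iff] at hx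
    refine ⟨hb.2.2.1, le_trans ?_ hx, hx⟩
    rw [le_div_iff₀ (by linarith)]
    have h1 : 0 ≤ |sigma p| * normRe (μ x) := mul_nonneg (abs_nonneg _) (norm_nonneg _)
    have h2 : 0 ≤ |sigma p| * normIm (μ x) := mul_nonneg (abs_nonneg _) (norm_nonneg _)
    nlinarith [hb.2.2.2.1]

end EssSup

/-! ### Convergence in `L^p` and extrapolation of operators -/

section Lp

variable {α : Type*} [MeasurableSpace α] {ν : Measure α}

/-- A sequence that converges almost everywhere, with `L^p`-norms not exceeding that of the limit,
converges in `L^p`. -/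
lemma tendsto_eLpNorm_sub_of_ae {E : Type*} [NormedAddCommGroup E] {p : ℝ≥0∞} (hp1 : 1 ≤ p)
    (hp : p ≠ ⊤) {f : ℕ → α → E} {g : α → E} (hf : ∀ n, AEStronglyMeasurable (f n) ν)
    (hg : MemLp g p ν) (hle : ∀ n, eLpNorm (f n) p ν ≤ eLpNorm g p ν)
    (hae : ∀ᵐ x ∂ν, Tendsto (fun n => f n x) atTop (𝓝 (g x))) :
    Tendsto (fun n => eLpNorm (f n - g) p ν) atTop (𝓝 0) := by
  have hp0 : p ≠ 0 := (zero_lt_one.trans_le hp1).ne'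
  set r := p.toReal
  have hr1 : 1 ≤ r := by
    rw [← ENNReal.toReal_one]; exact ENNReal.toReal_mono hp hp1
  have hr : 0 < r := by linarith
  set C : ℝ≥0∞ := 2 ^ (r - 1)
  have hC : C ≠ ⊤ := ENNReal.rpow_ne_top_of_nonneg (by linarith) (by simp)
  set I : ℝ≥0∞ := ∫⁻ x, ‖g x‖ₑ ^ r ∂ν
  have hI : I ≠ ⊤ := by
    have := (eLpNorm_lt_top_iff_lintegral_rpow_enorm_lt_top hp0 hp).1 hg.2
    exact this.ne
  have hIf : ∀ n, ∫⁻ x, ‖f n x‖ₑ ^ r ∂ν ≤ I := fun n => by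
    have := hle n
    rw [eLpNorm_eq_lintegral_rpow_enorm_toReal hp0 hp, eLpNorm_eq_lintegral_rpow_enorm_toReal hp0 hp,
      ENNReal.rpow_le_rpow_iff (by positivity)] at this
    exact this
  -- Convexity gives |f - g|^r ≤ 2^{r-1}(|f|^r + |g|^r), that is D ≤ B. Fatou's lemma applied to B -
  -- D forces the integrals of D to 0.
  let D : ℕ → α → ℝ≥0∞ := fun n x => ‖f n x - g x‖ₑ ^ r
  let B : ℕ → α → ℝ≥0∞ := fun n x => C * (‖f n x‖ₑ ^ r + ‖g x‖ₑ ^ r)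
  have hDm : ∀ n, AEMeasurable (D n) ν := fun n => ((hf n).sub hg.1).enorm.pow_const r
  have hBm : ∀ n, AEMeasurable (B n) ν := fun n =>
    (((hf n).enorm.pow_const r).add (hg.1.enorm.pow_const r)).const_mul C
  have hDB : ∀ n x, D n x ≤ B n x := fun n x => by
    refine le_trans ?_ (ENNReal.rpow_add_le_mul_rpow_add_rpow _ _ hr1)
    exact ENNReal.rpow_le_rpow (enorm_sub_le) hr.le
  have hsum : ∀ n, ∫⁻ x, (B n x - D n x) ∂ν + ∫⁻ x, D n x ∂ν ≤ C * (I + I) := fun n => by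
    rw [← lintegral_add_right' _ (hDm n)]
    have : ∀ x, B n x - D n x + D n x = B n x := fun x => tsub_add_cancel_of_le (hDB n x)
    simp_rw [this, B]
    rw [lintegral_const_mul' _ _ hC,
      lintegral_add_left' ((hf n).enorm.pow_const r)]
    gcongr
    exact hIf n
  have hfatou : C * (I + I) ≤ liminf (fun n => ∫⁻ x, (B n x - D n x) ∂ν) atTop := by
    refine le_trans (le_of_eq ?_) (lintegral_liminf_le' fun n => (hBm n).sub (hDm n))
    have h1 : ∫⁻ x, C * (‖g x‖ₑ ^ r + ‖g x‖ₑ ^ r) ∂ν = C * (I + I) := by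
      rw [lintegral_const_mul' _ _ hC,
        lintegral_add_left' (hg.1.enorm.pow_const r)]
    rw [← h1]
    refine lintegral_congr_ae ?_
    filter_upwards [hae] with x hx
    symm
    refine Tendsto.liminf_eq ?_
    have e1 : Tendsto (fun n => ‖f n x‖ₑ ^ r) atTop (𝓝 (‖g x‖ₑ ^ r)) :=
      (ENNReal.continuous_rpow_const.tendsto _).comp hx.enorm
    have e2 : Tendsto (fun n => D n x) atTop (𝓝 0) := by
      have e3 : Tendsto (fun n => ‖f n x - g x‖ₑ) atTop (𝓝 0) := by
        simpa using (hx.sub_const (g x)).enorm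
      have := (ENNReal.continuous_rpow_const (y := r)).tendsto 0 |>.comp e3
      rwa [ENNReal.zero_rpow_of_pos hr] at this
    have e4 : Tendsto (fun n => B n x) atTop (𝓝 (C * (‖g x‖ₑ ^ r + ‖g x‖ₑ ^ r))) :=
      ENNReal.Tendsto.const_mul (e1.add_const _) (Or.inr hC)
    simpa using ENNReal.Tendsto.sub e4 e2 (Or.inr (by simp))
  have hS : C * (I + I) ≠ ⊤ := ENNReal.mul_ne_top hC (by simp [hI])
  have hD : Tendsto (fun n => ∫⁻ x, D n x ∂ν) atTop (𝓝 0) := by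
    refine tendsto_of_le_liminf_of_limsup_le zero_le ?_
    calc limsup (fun n => ∫⁻ x, D n x ∂ν) atTop
        ≤ limsup (fun n => C * (I + I) - ∫⁻ x, (B n x - D n x) ∂ν) atTop := by
          refine limsup_le_limsup (.of_forall fun n => ?_)
          have hfin : ∫⁻ x, (B n x - D n x) ∂ν ≠ ⊤ :=
            ne_top_of_le_ne_top hS (le_self_add.trans (hsum n))
          exact ENNReal.le_sub_of_add_le_left hfin (hsum n)
      _ = C * (I + I) - liminf (fun n => ∫⁻ x, (B n x - D n x) ∂ν) atTop :=
          ENNReal.limsup_const_sub _ _ hS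
      _ ≤ 0 := (tsub_eq_zero_of_le hfatou).le
  have := (ENNReal.continuous_rpow_const (y := 1 / r)).tendsto 0 |>.comp hD
  rw [ENNReal.zero_rpow_of_pos (by positivity)] at this
  refine this.congr fun n => ?_
  rw [eLpNorm_eq_lintegral_rpow_enorm_toReal hp0 hp]
  rfl

variable {p : ℝ≥0∞} [Fact (1 ≤ p)]

/-- Every sequence has a subsequence converging a.e. by L² convergence, and along it the norm bound
upgrades this to convergence in L^p. -/
lemma tendsto_eLpNorm_sub_of_tendsto_Lp {ι : Type*} {l : Filter ι} [l.IsCountablyGenerated]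
    (hp : p ≠ ⊤) {f : ι → Lp ℂ 2 ν} {g : Lp ℂ 2 ν} (h : Tendsto f l (𝓝 g))
    (hg : MemLp g p ν) (hle : ∀ᶠ i in l, eLpNorm (f i) p ν ≤ eLpNorm g p ν) :
    Tendsto (fun i => eLpNorm (f i - g : α → ℂ) p ν) l (𝓝 0) := by
  refine tendsto_of_subseq_tendsto fun ns hns => ?_
  obtain ⟨N, hN⟩ := eventually_atTop.1 (hns.eventually hle)
  have h1 : Tendsto (fun n => f (ns (n + N))) atTop (𝓝 g) :=
    h.comp (hns.comp (tendsto_add_atTop_nat N))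
  obtain ⟨ms, -, hms⟩ := (tendstoInMeasure_of_tendsto_Lp h1).exists_seq_tendsto_ae
  refine ⟨fun n => ms n + N, ?_⟩
  exact tendsto_eLpNorm_sub_of_ae Fact.out hp (fun n => Lp.aestronglyMeasurable _) hg
    (fun n => hN _ (Nat.le_add_left _ _)) hms

/-- `J` is contractive with respect to the norm of `L^p`. -/
def LpContractive (p : ℝ≥0∞) (J : Lp ℂ 2 ν →L[ℂ] Lp ℂ 2 ν) : Prop :=
  ∀ f : Lp ℂ 2 ν, MemLp f p ν → eLpNorm (J f) p ν ≤ eLpNorm f p ν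

/-- `J` and `K` coincide on `L² ∩ L^p`. -/
def Consistent (J : Lp ℂ 2 ν →L[ℂ] Lp ℂ 2 ν) (K : Lp ℂ p ν →L[ℂ] Lp ℂ p ν) : Prop :=
  ∀ (f : Lp ℂ 2 ν) (g : Lp ℂ p ν), f =ᵐ[ν] g → J f =ᵐ[ν] K g

lemma dense_setOf_memLp_two (hp : p ≠ ⊤) :
    Dense {g : Lp ℂ p ν | ∃ f : Lp ℂ 2 ν, f =ᵐ[ν] g} := by
  refine (Lp.simpleFunc.denseRange (E := ℂ) (μ := ν) hp).mono ?_
  rintro _ ⟨s, rfl⟩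
  have hp0 : p ≠ 0 := (zero_lt_one.trans_le (Fact.out : 1 ≤ p)).ne'
  have h1 := Lp.simpleFunc.memLp s
  have h2 : MemLp (Lp.simpleFunc.toSimpleFunc s) 2 ν := by
    rw [SimpleFunc.memLp_iff (by simp) (by simp)]
    exact (SimpleFunc.memLp_iff hp0 hp).1 h1
  exact ⟨h2.toLp _, h2.coeFn_toLp.trans (Lp.simpleFunc.toSimpleFunc_eq_toFun s)⟩

lemma clm_ext_of_memLp_two (hp : p ≠ ⊤) {K K' : Lp ℂ p ν →L[ℂ] Lp ℂ p ν}
    (h : ∀ (f : Lp ℂ 2 ν) (g : Lp ℂ p ν), f =ᵐ[ν] g → K g = K' g) : K = K' := by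
  refine ContinuousLinearMap.ext_on (s := {g : Lp ℂ p ν | ∃ f : Lp ℂ 2 ν, f =ᵐ[ν] g})
    ((dense_setOf_memLp_two hp).mono Submodule.subset_span) ?_
  rintro g ⟨f, hf⟩
  exact h f g hf

lemma Consistent.eq (hp : p ≠ ⊤) {J : Lp ℂ 2 ν →L[ℂ] Lp ℂ 2 ν} {K K' : Lp ℂ p ν →L[ℂ] Lp ℂ p ν}
    (h : Consistent J K) (h' : Consistent J K') : K = K' :=
  clm_ext_of_memLp_two hp fun f g hfg => Lp.ext ((h f g hfg).symm.trans (h' f g hfg))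

/-- The elements of `L² ∩ L^p`, as a subspace of `L²`. -/
def interLp (ν : Measure α) (p : ℝ≥0∞) : Submodule ℂ (Lp ℂ 2 ν) where
  carrier := {f | MemLp f p ν}
  add_mem' hf hg := (hf.add hg).ae_eq (Lp.coeFn_add _ _).symm
  zero_mem' := (MemLp.zero (ε := ℂ)).ae_eq (Lp.coeFn_zero ℂ 2 ν).symm
  smul_mem' c _ hf := (hf.const_smul c).ae_eq (Lp.coeFn_smul _ _).symm

lemma mem_interLp {f : Lp ℂ 2 ν} : f ∈ interLp ν p ↔ MemLp f p ν := Iff.rfl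

/-- The class of Jf depends contractively on the L^p class of f in L² ∩ L^p, which is dense in L^p;
the extension by continuity is the operator sought. -/
lemma exists_consistent (hp : p ≠ ⊤) {J : Lp ℂ 2 ν →L[ℂ] Lp ℂ 2 ν} (hJ : LpContractive p J) :
    ∃ K : Lp ℂ p ν →L[ℂ] Lp ℂ p ν, ‖K‖ ≤ 1 ∧ Consistent J K := by
  have hJm : ∀ f : interLp ν p, MemLp (J f) p ν := fun f =>
    ⟨Lp.aestronglyMeasurable _, (hJ f (mem_interLp.1 f.2)).trans_lt (mem_interLp.1 f.2).2⟩
  let e : interLp ν p →ₗ[ℂ] Lp ℂ p ν :=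
    { toFun := fun f => MemLp.toLp (f : Lp ℂ 2 ν) (mem_interLp.1 f.2)
      map_add' := fun f g => by
        rw [← MemLp.toLp_add]
        exact MemLp.toLp_congr _ _ (Lp.coeFn_add _ _)
      map_smul' := fun c f => by
        rw [RingHom.id_apply, ← MemLp.toLp_const_smul]
        exact MemLp.toLp_congr _ _ (Lp.coeFn_smul _ _) }
  let F : interLp ν p →ₗ[ℂ] Lp ℂ p ν :=
    { toFun := fun f => MemLp.toLp (J f) (hJm f)
      map_add' := fun f g => by
        rw [← MemLp.toLp_add]
        refine MemLp.toLp_congr _ _ ?_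
        rw [Submodule.coe_add, map_add]
        exact Lp.coeFn_add _ _
      map_smul' := fun c f => by
        rw [RingHom.id_apply, ← MemLp.toLp_const_smul]
        refine MemLp.toLp_congr _ _ ?_
        rw [Submodule.coe_smul, map_smul]
        exact Lp.coeFn_smul _ _ }
  have hd : DenseRange e := by
    refine (dense_setOf_memLp_two (ν := ν) hp).mono ?_
    rintro g ⟨f, hf⟩
    have hfp : MemLp f p ν := (Lp.memLp g).ae_eq hf.symm
    exact ⟨⟨f, hfp⟩, Lp.ext ((MemLp.coeFn_toLp hfp).trans hf)⟩
  have hle : ∀ f, ‖F f‖ ≤ 1 * ‖e f‖ := fun f => by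
    rw [one_mul]
    change ‖MemLp.toLp (J f) (hJm f)‖ ≤ ‖MemLp.toLp (f : Lp ℂ 2 ν) (mem_interLp.1 f.2)‖
    rw [Lp.norm_toLp, Lp.norm_toLp]
    exact ENNReal.toReal_mono (mem_interLp.1 f.2).2.ne (hJ f (mem_interLp.1 f.2))
  refine ⟨F.extendOfNorm e, LinearMap.opNorm_extendOfNorm_le hd zero_le_one hle, fun f g hfg => ?_⟩
  have hf : MemLp f p ν := (Lp.memLp g).ae_eq hfg.symm
  have h1 : e ⟨f, hf⟩ = g := Lp.ext ((MemLp.coeFn_toLp hf).trans hfg)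
  rw [← h1, LinearMap.extendOfNorm_eq hd ⟨1, hle⟩]
  exact (MemLp.coeFn_toLp (hJm ⟨f, hf⟩)).symm

/-- Algebraic identities pass from L² to L^p by density. Strong continuity at 0 does so as well:
contractivity says that the L^p norms of the approximants do not exceed that of the limit, so L²
convergence suffices. -/
lemma Consistent.isResolventFamily (hp : p ≠ ⊤) {J : ℝ → Lp ℂ 2 ν →L[ℂ] Lp ℂ 2 ν}
    {K : ℝ → Lp ℂ p ν →L[ℂ] Lp ℂ p ν} (hJ : IsResolventFamily J) (hK : ∀ t, 0 < t → ‖K t‖ ≤ 1)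
    (h : ∀ t, 0 < t → Consistent (J t) (K t)) : IsResolventFamily K where
  norm_le := hK
  identity s t hs ht x := by
    set a : ℂ := ((s / t : ℝ) : ℂ)
    set b : ℂ := ((1 - s / t : ℝ) : ℂ)
    have : K s ∘L (a • ContinuousLinearMap.id ℂ _ + b • K t) = K t := by
      refine clm_ext_of_memLp_two hp fun f g hfg => Lp.ext ?_
      have h1 := h t ht f g hfg
      have h2 : (a • f + b • J t f : Lp ℂ 2 ν) =ᵐ[ν] (a • g + b • K t g : Lp ℂ p ν) := by
        filter_upwards [h1, hfg, Lp.coeFn_add (a • f) (b • J t f), Lp.coeFn_add (a • g) (b • K t g),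
          Lp.coeFn_smul a f, Lp.coeFn_smul a g, Lp.coeFn_smul b (J t f),
          Lp.coeFn_smul b (K t g)] with x e1 e2 e3 e4 e5 e6 e7 e8
        rw [e3, e4, Pi.add_apply, Pi.add_apply, e5, e6, e7, e8, Pi.smul_apply, Pi.smul_apply,
          Pi.smul_apply, Pi.smul_apply, e1, e2]
      have h3 := h s hs _ _ h2
      rw [hJ.identity s t hs ht f] at h3
      exact h3.symm.trans h1
    exact DFunLike.congr_fun this x
  tendsto x := by
    have hbase : ∀ (f : Lp ℂ 2 ν) (g : Lp ℂ p ν), f =ᵐ[ν] g →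
        Tendsto (fun t => K t g) (𝓝[>] 0) (𝓝 g) := fun f g hfg => by
      rw [Lp.tendsto_Lp_iff_tendsto_eLpNorm']
      have hf : MemLp f p ν := (Lp.memLp g).ae_eq hfg.symm
      have h1 := tendsto_eLpNorm_sub_of_tendsto_Lp (p := p) hp (hJ.tendsto f) hf (by
        filter_upwards [self_mem_nhdsWithin] with t ht
        rw [eLpNorm_congr_ae (h t ht f g hfg), eLpNorm_congr_ae hfg]
        have h2 := (K t).le_of_opNorm_le (hK t ht) g
        rw [one_mul, Lp.norm_def, Lp.norm_def] at h2
        exact (ENNReal.toReal_le_toReal (Lp.memLp _).2.ne (Lp.memLp _).2.ne).1 h2)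
      refine h1.congr' ?_
      filter_upwards [self_mem_nhdsWithin] with t ht
      exact eLpNorm_congr_ae ((h t ht f g hfg).sub hfg)
    rw [Metric.tendsto_nhds]
    intro ε hε
    obtain ⟨g, hg, ⟨f, hf⟩⟩ := Metric.dense_iff.1 (dense_setOf_memLp_two (ν := ν) hp) x (ε / 3)
      (by positivity)
    filter_upwards [self_mem_nhdsWithin, Metric.tendsto_nhds.1 (hbase f g hf) (ε / 3)
      (by positivity)] with t ht h1
    have h2 : dist (K t x) (K t g) < ε / 3 := by
      rw [dist_eq_norm, ← map_sub]
      refine ((K t).le_of_opNorm_le (hK t ht) _).trans_lt ?_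
      rwa [one_mul, ← dist_eq_norm, ← Metric.mem_ball']
    calc dist (K t x) x ≤ dist (K t x) (K t g) + dist (K t g) g + dist g x :=
          dist_triangle4 _ _ _ _
      _ < ε := by rw [Metric.mem_ball] at hg; linarith

/-- The graph of the identification of `L² ∩ L^p` as a part of `L²` and of `L^p`. -/
def diagLp (ν : Measure α) (p : ℝ≥0∞) [Fact (1 ≤ p)] : Submodule ℂ (Lp ℂ 2 ν × Lp ℂ p ν) where
  carrier := {w | w.1 =ᵐ[ν] w.2}
  add_mem' {v w} hv hw := (Lp.coeFn_add v.1 w.1).trans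
    ((EventuallyEq.add (show v.1 =ᵐ[ν] v.2 from hv) (show w.1 =ᵐ[ν] w.2 from hw)).trans (Lp.coeFn_add v.2 w.2).symm)
  zero_mem' := (Lp.coeFn_zero ℂ 2 ν).trans (Lp.coeFn_zero ℂ p ν).symm
  smul_mem' c w hw := (Lp.coeFn_smul c w.1).trans
    ((EventuallyEq.const_smul (show w.1 =ᵐ[ν] w.2 from hw) c).trans (Lp.coeFn_smul c w.2).symm)

/-- Convergence in either space implies convergence in measure, whose limits are unique a.e. -/
lemma isClosed_diagLp : IsClosed (diagLp ν p : Set (Lp ℂ 2 ν × Lp ℂ p ν)) := by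
  refine IsSeqClosed.isClosed fun w v hw hv => ?_
  have h1 := tendstoInMeasure_of_tendsto_Lp ((continuous_fst.tendsto v).comp hv)
  have h2 := tendstoInMeasure_of_tendsto_Lp ((continuous_snd.tendsto v).comp hv)
  exact tendstoInMeasure_ae_unique (h1.congr_left fun n => hw n) h2

end Lp

/-! ### The chain rule for weak derivatives -/

section ChainRule

variable {E : Type*} [NormedAddCommGroup E] [InnerProductSpace ℝ E] [FiniteDimensional ℝ E]
  [MeasurableSpace E] [BorelSpace E]

/-- Convolution with a normed bump function. -/
def mollify (ρ : ContDiffBump (0 : E)) (g : E → ℂ) : E → ℂ :=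
  convolution (ρ.normed volume) g (ContinuousLinearMap.lsmul ℝ ℝ) volume

lemma integrable_normed (ρ : ContDiffBump (0 : E)) : Integrable (ρ.normed volume) volume :=
  ρ.continuous_normed.integrable_of_hasCompactSupport ρ.hasCompactSupport_normed

lemma integrable_mollify (ρ : ContDiffBump (0 : E)) {g : E → ℂ} (hg : Integrable g) :
    Integrable (mollify ρ g) :=
  (integrable_normed ρ).integrable_convolution _ hg

lemma contDiff_mollify (ρ : ContDiffBump (0 : E)) {g : E → ℂ} (hg : Integrable g) :
    ContDiff ℝ ∞ (mollify ρ g) :=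
  ρ.hasCompactSupport_normed.contDiff_convolution_left _ ρ.contDiff_normed hg.locallyIntegrable

lemma integral_norm_mollify_le (ρ : ContDiffBump (0 : E)) {g : E → ℂ} (hg : Integrable g) :
    ∫ x, ‖mollify ρ g x‖ ≤ ∫ x, ‖g x‖ := by
  have h1 : ∀ x, ‖mollify ρ g x‖ ≤ convolution (ρ.normed volume) (fun x => ‖g x‖)
      (ContinuousLinearMap.lsmul ℝ ℝ) volume x := fun x => by
    refine (norm_integral_le_integral_norm _).trans (le_of_eq ?_)
    rw [convolution_def]
    refine integral_congr_ae (.of_forall fun t => ?_)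
    simp [abs_of_nonneg (ρ.nonneg_normed t)]
  have h2 := integral_convolution (μ := volume) (ν := volume) (ContinuousLinearMap.lsmul ℝ ℝ)
    (integrable_normed ρ) hg.norm
  rw [ρ.integral_normed] at h2
  calc ∫ x, ‖mollify ρ g x‖ ≤ _ := integral_mono (integrable_mollify ρ hg).norm
        ((integrable_normed ρ).integrable_convolution _ hg.norm) h1
    _ = ∫ x, ‖g x‖ := by rw [h2]; simp

/-- The bounded ratio of the radii gives convergence at almost every point by Lebesgue
differentiation. Mollification does not increase the L¹ norm, so convergence in L¹ follows. -/
lemma tendsto_mollify {ρ : ℕ → ContDiffBump (0 : E)}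
    (h0 : Tendsto (fun n => (ρ n).rOut) atTop (𝓝 0)) (h2 : ∀ n, (ρ n).rOut ≤ 2 * (ρ n).rIn)
    {g : E → ℂ} (hg : Integrable g) :
    (∀ᵐ x, Tendsto (fun n => mollify (ρ n) g x) atTop (𝓝 (g x))) ∧
    Tendsto (fun n => ∫ x, ‖mollify (ρ n) g x - g x‖) atTop (𝓝 0) := by
  have hae := ContDiffBump.ae_convolution_tendsto_right_of_locallyIntegrable (μ := volume)
    (K := 2) h0 (.of_forall h2) hg.locallyIntegrable
  refine ⟨hae, ?_⟩
  have key := tendsto_eLpNorm_sub_of_ae (p := 1) le_rfl (by simp)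
    (fun n => (integrable_mollify (ρ n) hg).1) (memLp_one_iff_integrable.2 hg) (fun n => ?_) hae
  · have h3 := (ENNReal.tendsto_toReal ENNReal.zero_ne_top).comp key
    refine h3.congr fun n => ?_
    rw [Function.comp_apply, eLpNorm_one_eq_lintegral_enorm,
      ← integral_norm_eq_lintegral_enorm ((integrable_mollify (ρ n) hg).1.sub hg.1)]
    rfl
  · rw [eLpNorm_one_eq_lintegral_enorm, eLpNorm_one_eq_lintegral_enorm,
      ← ofReal_integral_norm_eq_lintegral_enorm (integrable_mollify (ρ n) hg),
      ← ofReal_integral_norm_eq_lintegral_enorm hg]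
    exact ENNReal.ofReal_le_ofReal (integral_norm_mollify_le (ρ n) hg)

lemma integral_fderiv_mul_eq_neg {φ : E → ℝ} (hφ : ContDiff ℝ ∞ φ) (hφc : HasCompactSupport φ)
    {ψ : E → ℂ} (hψ : ContDiff ℝ 1 ψ) (v : E) :
    ∫ x, ((fderiv ℝ φ x v : ℝ) : ℂ) * ψ x = -∫ x, (φ x : ℂ) * fderiv ℝ ψ x v := by
  have hφ' : Continuous fun x => fderiv ℝ φ x v :=
    (hφ.continuous_fderiv (by simp)).clm_apply continuous_const
  have hψ' : Continuous fun x => fderiv ℝ ψ x v :=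
    (hψ.continuous_fderiv one_ne_zero).clm_apply continuous_const
  have hc' : HasCompactSupport fun x => fderiv ℝ φ x v := (hφc.fderiv ℝ).comp_left
    (g := fun L : E →L[ℝ] ℝ => L v) (by simp)
  have key := integral_bilinear_hasLineDerivAt_right_eq_neg_left_of_integrable (μ := volume)
    (f := φ) (f' := fun x => fderiv ℝ φ x v) (g := ψ) (g' := fun x => fderiv ℝ ψ x v) (v := v)
    (B := ContinuousLinearMap.lsmul ℝ ℝ)
    (((hφ'.smul hψ.continuous)).integrable_of_hasCompactSupport hc'.smul_right)
    ((hφ.continuous.smul hψ').integrable_of_hasCompactSupport hφc.smul_right)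
    ((hφ.continuous.smul hψ.continuous).integrable_of_hasCompactSupport hφc.smul_right)
    (fun x _ => ((hφ.differentiable (by simp)) x).hasFDerivAt.hasLineDerivAt v)
    (fun x _ => ((hψ.differentiable (by simp)) x).hasFDerivAt.hasLineDerivAt v)
  simp only [ContinuousLinearMap.lsmul_apply, Complex.real_smul] at key
  rw [key, neg_neg]

/-- `f` is the weak derivative of `u` in the direction `v` on `Ω`. -/
def IsWeakDeriv (Ω : Set E) (v : E) (u f : E → ℂ) : Prop :=
  ∀ φ : E → ℝ, ContDiff ℝ ∞ φ → HasCompactSupport φ → tsupport φ ⊆ Ω →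
    ∫ x in Ω, ((fderiv ℝ φ x v : ℝ) : ℂ) * u x = -∫ x in Ω, (φ x : ℂ) * f x

/-- The translated kernel t ↦ η(x - t) is itself a test function supported in K ⊆ Ω, and
differentiating it in t costs a sign. -/
lemma fderiv_mollify {Ω K : Set E} {v x : E} {u f : E → ℂ} (h : IsWeakDeriv Ω v u f)
    (hKΩ : K ⊆ Ω) (hu : Integrable (K.indicator u))
    (ρ : ContDiffBump (0 : E)) (hx : Metric.closedBall x ρ.rOut ⊆ K) :
    fderiv ℝ (mollify ρ (K.indicator u)) x v = mollify ρ (K.indicator f) x := by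
  set η := ρ.normed volume
  have hη : ContDiff ℝ ∞ η := ρ.contDiff_normed
  have h1 : HasFDerivAt (mollify ρ (K.indicator u)) _ x :=
    ρ.hasCompactSupport_normed.hasFDerivAt_convolution_left (ContinuousLinearMap.lsmul ℝ ℝ)
      (hη.of_le (by simp)) hu.locallyIntegrable x
  have h2 : fderiv ℝ (mollify ρ (K.indicator u)) x v =
      ∫ t, ((fderiv ℝ η (x - t) v : ℝ) : ℂ) * K.indicator u t := by
    rw [h1.fderiv]
    have hflip := convolution_flip (μ := volume) (f := fderiv ℝ η) (g := K.indicator u)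
      (ContinuousLinearMap.precompL E (ContinuousLinearMap.lsmul ℝ ℝ (E := ℂ)))
    rw [← hflip]
    have := convolution_precompR_apply (μ := volume) (f := K.indicator u) (g := fderiv ℝ η)
      (ContinuousLinearMap.lsmul ℝ ℝ (E := ℂ)).flip hu.locallyIntegrable
      (ρ.hasCompactSupport_normed.fderiv ℝ) (hη.continuous_fderiv (by simp)) x v
    refine this.trans ?_
    rw [convolution_def]
    simp
  have hzero : ∀ t, t ∉ K → η (x - t) = 0 ∧ fderiv ℝ η (x - t) v = 0 := fun t ht => by
    have hnot : x - t ∉ tsupport η := by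
      rw [ρ.tsupport_normed_eq, mem_closedBall_zero_iff]
      intro hle
      refine ht (hx ?_)
      rwa [Metric.mem_closedBall, dist_comm, dist_eq_norm]
    refine ⟨image_eq_zero_of_notMem_tsupport hnot, ?_⟩
    rw [show fderiv ℝ η (x - t) = 0 from
      image_eq_zero_of_notMem_tsupport fun h' => hnot (tsupport_fderiv_subset ℝ h')]
    rfl
  have h3 : mollify ρ (K.indicator f) x = ∫ t, (η (x - t) : ℂ) * K.indicator f t := by
    unfold mollify
    rw [convolution_eq_swap]
    simp [η]
  let φ : E → ℝ := fun t => η (x - t)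
  have hφ : ContDiff ℝ ∞ φ := hη.comp (contDiff_const.sub contDiff_id)
  have hφs : tsupport φ ⊆ K := by
    have : tsupport φ ⊆ Metric.closedBall x ρ.rOut := by
      refine closure_minimal (fun t ht => ?_) Metric.isClosed_closedBall
      have : x - t ∈ tsupport η := subset_tsupport _ ht
      rw [ρ.tsupport_normed_eq, mem_closedBall_zero_iff] at this
      rwa [Metric.mem_closedBall, dist_comm, dist_eq_norm]
    exact this.trans hx
  have hφc : HasCompactSupport φ := by
    have : tsupport φ ⊆ Metric.closedBall x ρ.rOut := by
      refine closure_minimal (fun t ht => ?_) Metric.isClosed_closedBall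
      have : x - t ∈ tsupport η := subset_tsupport _ ht
      rw [ρ.tsupport_normed_eq, mem_closedBall_zero_iff] at this
      rwa [Metric.mem_closedBall, dist_comm, dist_eq_norm]
    exact (isCompact_closedBall x ρ.rOut).of_isClosed_subset (isClosed_tsupport _) this
  have hφd : ∀ t, fderiv ℝ φ t v = -fderiv ℝ η (x - t) v := fun t => by
    have e1 : HasFDerivAt φ ((fderiv ℝ η (x - t)).comp (-ContinuousLinearMap.id ℝ E)) t := by
      have hs : HasFDerivAt (fun t : E => x - t) (-ContinuousLinearMap.id ℝ E) t :=
        (hasFDerivAt_id t).const_sub x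
      exact ((hη.differentiable (by simp)) (x - t)).hasFDerivAt.comp t hs
    rw [e1.fderiv]
    simp
  have key := h φ hφ hφc (hφs.trans hKΩ)
  have e2 : ∫ t in Ω, ((fderiv ℝ φ t v : ℝ) : ℂ) * u t =
      -∫ t, ((fderiv ℝ η (x - t) v : ℝ) : ℂ) * K.indicator u t := by
    rw [← integral_neg]
    refine Eq.trans ?_ (setIntegral_eq_integral_of_forall_compl_eq_zero (s := Ω) ?_)
    · refine integral_congr_ae (.of_forall fun t => ?_)
      by_cases ht : t ∈ K
      · simp [hφd, ht]
      · simp [hφd, hzero t ht, ht]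
    · intro t ht
      rw [indicator_of_notMem fun h' => ht (hKΩ h')]
      simp
  have e3 : ∫ t in Ω, (φ t : ℂ) * f t = ∫ t, (η (x - t) : ℂ) * K.indicator f t := by
    refine Eq.trans ?_ (setIntegral_eq_integral_of_forall_compl_eq_zero (s := Ω) ?_)
    · refine integral_congr_ae (.of_forall fun t => ?_)
      by_cases ht : t ∈ K
      · simp [φ, ht]
      · simp [φ, hzero t ht, ht]
    · intro t ht
      rw [indicator_of_notMem fun h' => ht (hKΩ h')]
      simp
  rw [e2, e3, neg_inj] at key
  rw [h2, h3, key]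

/-- Smooth maps of the plane that fix the origin and have a bounded derivative. -/
structure IsNormalMap (G : ℂ → ℂ) (C : ℝ) : Prop where
  smooth : ContDiff ℝ ∞ G
  zero : G 0 = 0
  bound : ∀ z, ‖fderiv ℝ G z‖ ≤ C

namespace IsNormalMap

variable {G : ℂ → ℂ} {C : ℝ}

lemma norm_sub_le (hG : IsNormalMap G C) (z w : ℂ) : ‖G z - G w‖ ≤ C * ‖z - w‖ :=
  convex_univ.norm_image_sub_le_of_norm_fderiv_le
    (fun x _ => (hG.smooth.differentiable (by simp)) x) (fun x _ => hG.bound x) (mem_univ _)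
    (mem_univ _)

lemma norm_le (hG : IsNormalMap G C) (z : ℂ) : ‖G z‖ ≤ C * ‖z‖ := by
  simpa [hG.zero] using hG.norm_sub_le z 0

lemma nonneg (hG : IsNormalMap G C) : 0 ≤ C := (norm_nonneg _).trans (hG.bound 0)

lemma continuous_fderiv (hG : IsNormalMap G C) : Continuous (fderiv ℝ G) :=
  hG.smooth.continuous_fderiv (by simp)

lemma norm_fderiv_apply_le (hG : IsNormalMap G C) (z w : ℂ) : ‖fderiv ℝ G z w‖ ≤ C * ‖w‖ :=
  (fderiv ℝ G z).le_of_opNorm_le (hG.bound z) w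

end IsNormalMap

lemma memLp_indicator_integrable {Ω K : Set E} (hK : IsCompact K) (hKΩ : K ⊆ Ω) {u : E → ℂ}
    (hu : MemLp u 2 (volume.restrict Ω)) : Integrable (K.indicator u) := by
  rw [integrable_indicator_iff hK.measurableSet]
  have h1 : MemLp u 2 (volume.restrict K) := hu.mono_measure (Measure.restrict_mono hKΩ le_rfl)
  have : IsFiniteMeasure (volume.restrict K) := ⟨by simpa using hK.measure_lt_top⟩
  exact h1.integrable (by norm_num)

/-- Near the support of φ, u is mollified, the classical chain rule is integrated by parts, and the
mollification is removed. Smoothness of G is real smoothness of the plane, as |u|^{p-2}u is not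
holomorphic in u. -/
lemma IsWeakDeriv.comp {Ω : Set E} (hΩ : IsOpen Ω) {v : E} {u f : E → ℂ}
    (h : IsWeakDeriv Ω v u f) (hu : MemLp u 2 (volume.restrict Ω))
    (hf : MemLp f 2 (volume.restrict Ω)) {G : ℂ → ℂ} {C : ℝ} (hG : IsNormalMap G C) :
    IsWeakDeriv Ω v (fun x => G (u x)) (fun x => fderiv ℝ G (u x) (f x)) := by
  intro φ hφ hφc hφΩ
  -- A compact collar K of the support inside Ω: kernels of radius at most δ centred on the support
  -- see only values from K.
  obtain ⟨δ, hδ, hδΩ⟩ := hφc.isCompact.exists_cthickening_subset_open hΩ hφΩ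
  set K := Metric.cthickening δ (tsupport φ)
  have hK : IsCompact K := hφc.isCompact.cthickening
  have hφK : tsupport φ ⊆ K := Metric.self_subset_cthickening _
  set g := K.indicator u
  set k := K.indicator f
  have hg : Integrable g := memLp_indicator_integrable hK hδΩ hu
  have hk : Integrable k := memLp_indicator_integrable hK hδΩ hf
  let ρ : ℕ → ContDiffBump (0 : E) := fun n =>
    ⟨δ / (2 * (n + 1)), δ / (n + 1), by positivity, by
      rw [div_lt_div_iff₀ (by positivity) (by positivity)]
      have : (0 : ℝ) ≤ n := n.cast_nonneg
      nlinarith⟩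
  have hρ0 : Tendsto (fun n => (ρ n).rOut) atTop (𝓝 0) := by
    have := (tendsto_one_div_add_atTop_nhds_zero_nat (𝕜 := ℝ)).const_mul δ
    simpa [ρ, div_eq_mul_inv] using this
  have hρ2 : ∀ n, (ρ n).rOut ≤ 2 * (ρ n).rIn := fun n => le_of_eq (by
    simp only [ρ]; field_simp)
  have hρδ : ∀ n, (ρ n).rOut ≤ δ := fun n => by
    simp only [ρ]
    rw [div_le_iff₀ (by positivity)]
    have : (0 : ℝ) ≤ n := n.cast_nonneg
    nlinarith
  obtain ⟨hgae, hgL⟩ := tendsto_mollify hρ0 hρ2 hg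
  obtain ⟨-, hkL⟩ := tendsto_mollify hρ0 hρ2 hk
  let φ' : E → ℝ := fun x => fderiv ℝ φ x v
  have hφ' : Continuous φ' := (hφ.continuous_fderiv (by simp)).clm_apply continuous_const
  have hφc' : HasCompactSupport φ' := (hφc.fderiv ℝ).comp_left
    (g := fun L : E →L[ℝ] ℝ => L v) (by simp)
  obtain ⟨M, hM⟩ := hφc.exists_bound_of_continuous hφ.continuous
  obtain ⟨M', hM'⟩ := hφc'.exists_bound_of_continuous hφ'
  have hM0 : 0 ≤ M := (norm_nonneg _).trans (hM 0)
  have hM0' : 0 ≤ M' := (norm_nonneg _).trans (hM' 0)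
  have hC := hG.nonneg
  have hGc : Continuous G := hG.smooth.continuous
  have hkm := hk.1
  have hgm := hg.1
  have hψm : ∀ n, AEStronglyMeasurable (mollify (ρ n) g) volume :=
    fun n => (integrable_mollify (ρ n) hg).1
  have hDm : ∀ {ψ : E → ℂ} {w : E → ℂ}, AEStronglyMeasurable ψ volume →
      AEStronglyMeasurable w volume →
      AEStronglyMeasurable (fun x => (φ x : ℂ) * fderiv ℝ G (ψ x) (w x)) volume := by
    intro ψ w hψ hw
    refine (Complex.continuous_ofReal.comp hφ.continuous).aestronglyMeasurable.mul ?_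
    have hc : Continuous fun q : (ℂ →L[ℝ] ℂ) × ℂ => q.1 q.2 := by fun_prop
    exact hc.comp_aestronglyMeasurable
      ((hG.continuous_fderiv.comp_aestronglyMeasurable hψ).prodMk hw)
  have hDb : ∀ (x : E) (z w : ℂ), ‖(φ x : ℂ) * fderiv ℝ G z w‖ ≤ M * C * ‖w‖ := fun x z w => by
    rw [norm_mul, Complex.norm_real, mul_assoc]
    exact mul_le_mul (hM x) (hG.norm_fderiv_apply_le z w) (norm_nonneg _) hM0
  have hDi : ∀ {ψ w : E → ℂ}, AEStronglyMeasurable ψ volume → Integrable w →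
      Integrable (fun x => (φ x : ℂ) * fderiv ℝ G (ψ x) (w x)) volume := by
    intro ψ w hψ hw
    exact (hw.norm.const_mul (M * C)).mono' (hDm hψ hw.1) (.of_forall fun x => hDb x _ _)
  have hLi : ∀ {ψ : E → ℂ}, Integrable ψ → Integrable (fun x => (φ' x : ℂ) * G (ψ x)) := by
    intro ψ hψ
    refine (hψ.norm.const_mul (M' * C)).mono' ((Complex.continuous_ofReal.comp
      hφ').aestronglyMeasurable.mul (hGc.comp_aestronglyMeasurable hψ.1)) (.of_forall fun x => ?_)
    rw [norm_mul, Complex.norm_real, mul_assoc]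
    exact mul_le_mul (hM' x) (hG.norm_le _) (norm_nonneg _) hM0'
  have hparts : ∀ n, ∫ x, (φ' x : ℂ) * G (mollify (ρ n) g x) =
      -∫ x, (φ x : ℂ) * fderiv ℝ G (mollify (ρ n) g x) (mollify (ρ n) k x) := fun n => by
    have hψ := contDiff_mollify (ρ n) hg
    rw [integral_fderiv_mul_eq_neg hφ hφc (ψ := fun x => G (mollify (ρ n) g x))
      ((hG.smooth.comp hψ).of_le (by simp)) v, neg_inj]
    refine integral_congr_ae (.of_forall fun x => ?_)
    by_cases hx : x ∈ tsupport φ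
    · have e1 : fderiv ℝ (fun x => G (mollify (ρ n) g x)) x =
          (fderiv ℝ G (mollify (ρ n) g x)).comp (fderiv ℝ (mollify (ρ n) g) x) :=
        fderiv_comp x ((hG.smooth.differentiable (by simp)) _) ((hψ.differentiable (by simp)) x)
      have hball : Metric.closedBall x (ρ n).rOut ⊆ K :=
        (Metric.closedBall_subset_closedBall (hρδ n)).trans
          (Metric.closedBall_subset_cthickening hx δ)
      have e2 := fderiv_mollify h hδΩ hg (ρ n) hball
      simp only [e1, ContinuousLinearMap.comp_apply]
      rw [e2]
    · simp [image_eq_zero_of_notMem_tsupport hx]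
  have hlim1 : Tendsto (fun n => ∫ x, (φ' x : ℂ) * G (mollify (ρ n) g x)) atTop
      (𝓝 (∫ x, (φ' x : ℂ) * G (g x))) := by
    rw [tendsto_iff_norm_sub_tendsto_zero]
    refine squeeze_zero (fun _ => norm_nonneg _) (fun n => ?_)
      (by simpa using hgL.const_mul (M' * C))
    rw [← integral_sub (hLi (integrable_mollify (ρ n) hg)) (hLi hg), ← integral_const_mul]
    refine norm_integral_le_of_norm_le
      (((integrable_mollify (ρ n) hg).sub hg).norm.const_mul _) (.of_forall fun x => ?_)
    rw [← mul_sub, norm_mul, Complex.norm_real, mul_assoc]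
    exact mul_le_mul (hM' x) (hG.norm_sub_le _ _) (norm_nonneg _) hM0'
  -- The mollified derivative is first exchanged for k, an L¹ error against the bounded factor φ·DG;
  -- only then does dominated convergence act on DG with k fixed.
  have hlim2 : Tendsto (fun n => ∫ x, (φ x : ℂ) * fderiv ℝ G (mollify (ρ n) g x)
      (mollify (ρ n) k x - k x)) atTop (𝓝 0) := by
    rw [tendsto_zero_iff_norm_tendsto_zero]
    refine squeeze_zero (fun _ => norm_nonneg _) (fun n => ?_)
      (by simpa using hkL.const_mul (M * C))
    rw [← integral_const_mul]
    exact norm_integral_le_of_norm_le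
      (((integrable_mollify (ρ n) hk).sub hk).norm.const_mul _) (.of_forall fun x => hDb x _ _)
  have hlim3 : Tendsto (fun n => ∫ x, (φ x : ℂ) * fderiv ℝ G (mollify (ρ n) g x) (k x)) atTop
      (𝓝 (∫ x, (φ x : ℂ) * fderiv ℝ G (g x) (k x))) := by
    refine tendsto_integral_of_dominated_convergence (fun x => M * C * ‖k x‖)
      (fun n => hDm (hψm n) hkm) (hk.norm.const_mul _)
      (fun n => .of_forall fun x => hDb x _ _) ?_
    filter_upwards [hgae] with x hx
    exact (((hG.continuous_fderiv.clm_apply continuous_const).tendsto _).comp hx).const_mul _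
  have hlim4 : Tendsto (fun n => ∫ x, (φ x : ℂ) * fderiv ℝ G (mollify (ρ n) g x)
      (mollify (ρ n) k x)) atTop (𝓝 (∫ x, (φ x : ℂ) * fderiv ℝ G (g x) (k x))) := by
    have := hlim2.add hlim3
    rw [zero_add] at this
    refine this.congr fun n => ?_
    rw [← integral_add (hDi (w := fun x => mollify (ρ n) k x - k x) (hψm n)
      ((integrable_mollify (ρ n) hk).sub hk)) (hDi (hψm n) hk)]
    refine integral_congr_ae (.of_forall fun x => ?_)
    simp only [map_sub]
    ring
  have hfin : ∫ x, (φ' x : ℂ) * G (g x) = -∫ x, (φ x : ℂ) * fderiv ℝ G (g x) (k x) := by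
    refine tendsto_nhds_unique hlim1 ?_
    simp_rw [hparts]
    exact hlim4.neg
  have hz : ∀ x, x ∉ K → φ x = 0 ∧ φ' x = 0 := fun x hx => by
    have hnot : x ∉ tsupport φ := fun h' => hx (hφK h')
    refine ⟨image_eq_zero_of_notMem_tsupport hnot, ?_⟩
    simp only [φ']
    rw [show fderiv ℝ φ x = 0 from
      image_eq_zero_of_notMem_tsupport fun h' => hnot (tsupport_fderiv_subset ℝ h')]
    rfl
  have e1 : ∫ x in Ω, (φ' x : ℂ) * G (u x) = ∫ x, (φ' x : ℂ) * G (g x) := by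
    refine Eq.trans ?_ (setIntegral_eq_integral_of_forall_compl_eq_zero (s := Ω) ?_)
    · refine integral_congr_ae (.of_forall fun x => ?_)
      by_cases hx : x ∈ K
      · simp [g, hx]
      · simp [hz x hx]
    · intro x hx
      simp [hz x fun h' => hx (hδΩ h')]
  have e2 : ∫ x in Ω, (φ x : ℂ) * fderiv ℝ G (u x) (f x) =
      ∫ x, (φ x : ℂ) * fderiv ℝ G (g x) (k x) := by
    refine Eq.trans ?_ (setIntegral_eq_integral_of_forall_compl_eq_zero (s := Ω) ?_)
    · refine integral_congr_ae (.of_forall fun x => ?_)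
      by_cases hx : x ∈ K
      · simp [g, k, hx]
      · simp [hz x hx]
    · intro x hx
      simp [hz x fun h' => hx (hδΩ h')]
  rw [e2, ← hfin, ← e1]

end ChainRule

/-! ### The form domains -/

section Domains

variable {d : ℕ} {Ω D : Set (EuclideanSpace ℝ (Fin d))}

local notation "𝔼" => EuclideanSpace ℝ (Fin d)

lemma memLp_restrict_of_hasCompactSupport {F : Type*} [NormedAddCommGroup F] {h : 𝔼 → F}
    (hc : Continuous h) (hs : HasCompactSupport h) : MemLp h 2 (volume.restrict Ω) :=
  (hc.memLp_of_hasCompactSupport hs).restrict Ω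

lemma inner_toLp_ofReal {h : 𝔼 → ℝ} (hh : MemLp (fun x => (h x : ℂ)) 2 (volume.restrict Ω))
    (u : LpC Ω 2) : inner ℂ (hh.toLp _) u = ∫ x in Ω, (h x : ℂ) * u x := by
  rw [L2.inner_def]
  refine integral_congr_ae ?_
  filter_upwards [hh.coeFn_toLp] with x hx
  rw [hx, RCLike.inner_apply, Complex.conj_ofReal, mul_comm]

lemma inner_toLp_single {h : 𝔼 → ℝ} {i : Fin d} (hh : MemLp
      (fun x => EuclideanSpace.single i (h x : ℂ)) 2 (volume.restrict Ω))
    (G : L2Vec Ω) : inner ℂ (hh.toLp _) G = ∫ x in Ω, (h x : ℂ) * G x i := by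
  rw [L2.inner_def]
  refine integral_congr_ae ?_
  filter_upwards [hh.coeFn_toLp] with x hx
  rw [hx, EuclideanSpace.inner_single_left, Complex.conj_ofReal]

lemma continuous_euclideanSingle (i : Fin d) :
    Continuous fun z : ℂ => (EuclideanSpace.single i z : EuclideanSpace ℂ (Fin d)) := by
  refine (PiLp.continuous_toLp 2 _).comp ?_
  exact continuous_single (A := fun _ : Fin d => ℂ) i

lemma memLp_test {φ : 𝔼 → ℝ} (hφ : ContDiff ℝ ∞ φ) (hφc : HasCompactSupport φ) (i : Fin d) :
    MemLp (fun x => ((fderiv ℝ φ x (EuclideanSpace.single i 1) : ℝ) : ℂ)) 2 (volume.restrict Ω) ∧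
    MemLp (fun x => EuclideanSpace.single i ((φ x : ℝ) : ℂ)) 2 (volume.restrict Ω) := by
  constructor
  · refine memLp_restrict_of_hasCompactSupport (Complex.continuous_ofReal.comp
      ((hφ.continuous_fderiv (by simp)).clm_apply continuous_const)) ?_
    exact (hφc.fderiv ℝ).comp_left
      (g := fun L : 𝔼 →L[ℝ] ℝ => ((L (EuclideanSpace.single i 1) : ℝ) : ℂ)) (by simp)
  · refine memLp_restrict_of_hasCompactSupport ((continuous_euclideanSingle i).comp
      (Complex.continuous_ofReal.comp hφ.continuous)) ?_
    exact hφc.comp_left (g := fun t : ℝ => EuclideanSpace.single i (t : ℂ)) (by simp)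

/-- Weak differentiability as a family of orthogonality relations in L² × L²: linearity and
closedness of the Sobolev space become visible. -/
lemma isWeakGradient_iff {w : LpC Ω 2 × L2Vec Ω} : IsWeakGradient Ω w.1 w.2 ↔
    ∀ (φ : 𝔼 → ℝ) (hφ : ContDiff ℝ ∞ φ) (hφc : HasCompactSupport φ), tsupport φ ⊆ Ω → ∀ i,
      inner ℂ ((memLp_test (Ω := Ω) hφ hφc i).1.toLp _) w.1 +
        inner ℂ ((memLp_test (Ω := Ω) hφ hφc i).2.toLp _) w.2 = 0 := by
  simp only [inner_toLp_ofReal, inner_toLp_single, ← eq_neg_iff_add_eq_zero]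
  rfl

/-- The Sobolev space as a subspace of `L²(Ω) × L²(Ω; ℂ^d)`. -/
def sobolevSubmodule (Ω : Set 𝔼) : Submodule ℂ (LpC Ω 2 × L2Vec Ω) where
  carrier := W12 Ω
  add_mem' {v w} hv hw := isWeakGradient_iff.2 fun φ hφ hφc hφΩ i => by
    have h1 := isWeakGradient_iff.1 hv φ hφ hφc hφΩ i
    have h2 := isWeakGradient_iff.1 hw φ hφ hφc hφΩ i
    rw [Prod.fst_add, Prod.snd_add, inner_add_right, inner_add_right, add_add_add_comm, h1, h2,
      add_zero]
  zero_mem' := isWeakGradient_iff.2 fun φ hφ hφc hφΩ i => by simp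
  smul_mem' c w hw := isWeakGradient_iff.2 fun φ hφ hφc hφΩ i => by
    have h1 := isWeakGradient_iff.1 hw φ hφ hφc hφΩ i
    rw [Prod.smul_fst, Prod.smul_snd, inner_smul_right, inner_smul_right, ← mul_add, h1, mul_zero]

lemma isClosed_W12 : IsClosed (W12 Ω) := by
  have : W12 Ω = ⋂ (φ : 𝔼 → ℝ) (hφ : ContDiff ℝ ∞ φ) (hφc : HasCompactSupport φ)
      (_ : tsupport φ ⊆ Ω) (i : Fin d), {w : LpC Ω 2 × L2Vec Ω |
      inner ℂ ((memLp_test (Ω := Ω) hφ hφc i).1.toLp _) w.1 +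
        inner ℂ ((memLp_test (Ω := Ω) hφ hφc i).2.toLp _) w.2 = 0} := by
    ext w
    simp only [mem_iInter]
    exact isWeakGradient_iff
  rw [this]
  refine isClosed_iInter fun φ => isClosed_iInter fun hφ => isClosed_iInter fun hφc =>
    isClosed_iInter fun _ => isClosed_iInter fun i => isClosed_eq ?_ continuous_const
  exact (continuous_const.inner continuous_fst).add (continuous_const.inner continuous_snd)

lemma PosDist.mono {S T : Set 𝔼} (h : PosDist T D) (hST : S ⊆ T) : PosDist S D := by
  obtain ⟨δ, hδ, h⟩ := h
  exact ⟨δ, hδ, fun x hx => h x (hST hx)⟩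

lemma PosDist.union {S T : Set 𝔼} (h : PosDist S D) (h' : PosDist T D) : PosDist (S ∪ T) D := by
  obtain ⟨δ, hδ, h⟩ := h
  obtain ⟨δ', hδ', h'⟩ := h'
  refine ⟨min δ δ', lt_min hδ hδ', ?_⟩
  rintro x (hx | hx) y hy
  · exact (min_le_left _ _).trans (h x hx y hy)
  · exact (min_le_right _ _).trans (h' x hx y hy)

lemma posDist_empty : PosDist ∅ D := ⟨1, one_pos, fun _ h => h.elim⟩

lemma essSupport_subset_of_imp {u v : LpC Ω 2} (h : ∀ᵐ x ∂(volume.restrict Ω), u x = 0 → v x = 0) :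
    essSupport Ω v ⊆ essSupport Ω u := by
  intro x hx U hU hu
  refine hx U hU ?_
  filter_upwards [hu, h] with y hy h' hyU using h' (hy hyU)

lemma essSupport_add_subset (u v : LpC Ω 2) :
    essSupport Ω (u + v) ⊆ essSupport Ω u ∪ essSupport Ω v := by
  intro x hx
  by_contra hcon
  simp only [mem_union, not_or, essSupport, mem_ofPred_eq, not_forall, not_not] at hcon
  obtain ⟨⟨U, hU, hu⟩, ⟨W, hW, hw⟩⟩ := hcon
  refine hx (U ∩ W) (inter_mem hU hW) ?_
  filter_upwards [hu, hw, Lp.coeFn_add u v] with y h1 h2 h3 hy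
  rw [h3, Pi.add_apply, h1 hy.1, h2 hy.2, add_zero]

lemma essSupport_subset_tsupport {u : LpC Ω 2} {φ : 𝔼 → ℂ}
    (h : ∀ᵐ x ∂(volume.restrict Ω), u x = φ x) : essSupport Ω u ⊆ tsupport φ := by
  intro x hx
  by_contra hcon
  refine hx _ ((isClosed_tsupport φ).isOpen_compl.mem_nhds hcon) ?_
  filter_upwards [h] with y hy hyc
  rw [hy, image_eq_zero_of_notMem_tsupport hyc]

/-- `smoothD` as a subspace. -/
def smoothSubmodule (Ω D : Set 𝔼) : Submodule ℂ (LpC Ω 2 × L2Vec Ω) where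
  carrier := smoothD Ω D
  add_mem' := by
    rintro v w ⟨hv, φ, hφ, hφc, hφD, hφe⟩ ⟨hw, ψ, hψ, hψc, hψD, hψe⟩
    refine ⟨(sobolevSubmodule Ω).add_mem hv hw, φ + ψ, hφ.add hψ, hφc.add hψc,
      (hφD.union hψD).mono (tsupport_add φ ψ), ?_⟩
    filter_upwards [hφe, hψe, Lp.coeFn_add v.1 w.1] with x h1 h2 h3
    rw [Prod.fst_add, h3, Pi.add_apply, h1, h2, Pi.add_apply]
  zero_mem' := by
    refine ⟨(sobolevSubmodule Ω).zero_mem, 0, contDiff_const, HasCompactSupport.zero, ?_, ?_⟩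
    · simpa [tsupport] using posDist_empty
    · exact Lp.coeFn_zero ℂ 2 _
  smul_mem' := by
    rintro c w ⟨hw, φ, hφ, hφc, hφD, hφe⟩
    refine ⟨(sobolevSubmodule Ω).smul_mem c hw, fun x => c * φ x, contDiff_const.mul hφ,
      hφc.mul_left, hφD.mono (closure_mono fun x hx h0 => hx (by simp [h0])), ?_⟩
    filter_upwards [hφe, Lp.coeFn_smul c w.1] with x h1 h2
    rw [Prod.smul_fst, h2, Pi.smul_apply, h1, smul_eq_mul]

/-- `sobolevD` as a subspace. -/
def sobolevDSubmodule (Ω D : Set 𝔼) : Submodule ℂ (LpC Ω 2 × L2Vec Ω) where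
  carrier := sobolevD Ω D
  add_mem' := by
    rintro v w ⟨hv, hvD⟩ ⟨hw, hwD⟩
    exact ⟨(sobolevSubmodule Ω).add_mem hv hw, (hvD.union hwD).mono (essSupport_add_subset _ _)⟩
  zero_mem' := by
    refine ⟨(sobolevSubmodule Ω).zero_mem, posDist_empty.mono fun x hx => ?_⟩
    refine hx univ univ_mem ?_
    filter_upwards [Lp.coeFn_zero ℂ 2 (volume.restrict Ω)] with y hy _ using hy
  smul_mem' := by
    rintro c w ⟨hw, hwD⟩
    refine ⟨(sobolevSubmodule Ω).smul_mem c hw, hwD.mono (essSupport_subset_of_imp ?_)⟩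
    filter_upwards [Lp.coeFn_smul c w.1] with x h1 h2
    rw [Prod.smul_fst, h1, Pi.smul_apply, h2, smul_zero]

lemma smoothD_subset_sobolevD : smoothD Ω D ⊆ sobolevD Ω D := by
  rintro w ⟨hw, φ, -, -, hφD, hφe⟩
  exact ⟨hw, hφD.mono (essSupport_subset_tsupport hφe)⟩

/-- An open set misses its frontier, so the compact support of φ is disjoint from the closed set D
and has positive distance to it. -/
lemma exists_mem_smoothD (hΩ : IsOpen Ω) (hD : IsClosed D) (hDΩ : D ⊆ frontier Ω) {φ : 𝔼 → ℝ}
    (hφ : ContDiff ℝ ∞ φ) (hφc : HasCompactSupport φ) (hφΩ : tsupport φ ⊆ Ω) :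
    ∃ w ∈ smoothD Ω D, w.1 =ᵐ[volume.restrict Ω] fun x => (φ x : ℂ) := by
  set ψ : 𝔼 → ℂ := fun x => (φ x : ℂ)
  have hψ : ContDiff ℝ ∞ ψ := Complex.ofRealCLM.contDiff.comp hφ
  have hψc : HasCompactSupport ψ := hφc.comp_left (g := fun t : ℝ => (t : ℂ)) (by simp)
  have hψt : tsupport ψ ⊆ tsupport φ := closure_mono fun x hx h0 => hx (by simp [ψ, h0])
  let g : 𝔼 → EuclideanSpace ℂ (Fin d) := fun x =>
    WithLp.toLp 2 fun i => fderiv ℝ ψ x (EuclideanSpace.single i 1)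
  have hgc : Continuous g := (PiLp.continuous_toLp 2 _).comp (continuous_pi fun i =>
    (hψ.continuous_fderiv (by simp)).clm_apply continuous_const)
  have hgs : HasCompactSupport g := (hψc.fderiv ℝ).comp_left
    (g := fun L : 𝔼 →L[ℝ] ℂ => (WithLp.toLp 2 fun i => L (EuclideanSpace.single i 1) :
      EuclideanSpace ℂ (Fin d))) (by ext; simp)
  have h1 : MemLp ψ 2 (volume.restrict Ω) := memLp_restrict_of_hasCompactSupport hψ.continuous hψc
  have h2 : MemLp g 2 (volume.restrict Ω) := memLp_restrict_of_hasCompactSupport hgc hgs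
  refine ⟨(h1.toLp ψ, h2.toLp g), ⟨?_, ψ, hψ, hψc, ?_, h1.coeFn_toLp⟩, h1.coeFn_toLp⟩
  · intro χ hχ hχc hχΩ i
    have hz : ∀ x ∉ Ω, χ x = 0 ∧ fderiv ℝ χ x = 0 := fun x hx =>
      ⟨image_eq_zero_of_notMem_tsupport fun h' => hx (hχΩ h'),
        image_eq_zero_of_notMem_tsupport fun h' => hx (hχΩ (tsupport_fderiv_subset ℝ h'))⟩
    have e1 : ∫ x in Ω, ((fderiv ℝ χ x (EuclideanSpace.single i 1) : ℝ) : ℂ) * h1.toLp ψ x =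
        ∫ x, ((fderiv ℝ χ x (EuclideanSpace.single i 1) : ℝ) : ℂ) * ψ x := by
      refine Eq.trans ?_ (setIntegral_eq_integral_of_forall_compl_eq_zero (s := Ω) ?_)
      · refine integral_congr_ae ?_
        filter_upwards [h1.coeFn_toLp] with x hx
        rw [hx]
      · intro x hx
        simp [(hz x hx).2]
    have e2 : ∫ x in Ω, (χ x : ℂ) * h2.toLp g x i =
        ∫ x, (χ x : ℂ) * fderiv ℝ ψ x (EuclideanSpace.single i 1) := by
      refine Eq.trans ?_ (setIntegral_eq_integral_of_forall_compl_eq_zero (s := Ω) ?_)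
      · refine integral_congr_ae ?_
        filter_upwards [h2.coeFn_toLp] with x hx
        rw [hx]
      · intro x hx
        simp [(hz x hx).1]
    simp only [e1, e2]
    exact integral_fderiv_mul_eq_neg hχ hχc (hψ.of_le (by simp)) _
  · have hdisj : Disjoint (tsupport φ) D := by
      refine Set.disjoint_left.2 fun x hx hxD => ?_
      exact (hΩ.inter_frontier_eq ▸ (⟨hφΩ hx, hDΩ hxD⟩ : x ∈ Ω ∩ frontier Ω) : x ∈ (∅ : Set 𝔼))
    obtain ⟨r, hr, h⟩ := Metric.exists_pos_forall_lt_edist hφc.isCompact hD hdisj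
    refine PosDist.mono ⟨r, hr, fun x hx y hy => ?_⟩ hψt
    have := h x hx y hy
    rw [edist_nndist, ENNReal.coe_lt_coe] at this
    exact_mod_cast this.le

/-- A function orthogonal to the projection of V annihilates all test functions on Ω, and so
vanishes a.e. on Ω. -/
lemma dense_fst_of_smoothD_subset (hΩ : IsOpen Ω) (hD : IsClosed D) (hDΩ : D ⊆ frontier Ω)
    {V : Submodule ℂ (LpC Ω 2 × L2Vec Ω)} (hV : smoothD Ω D ⊆ V) :
    Dense (Prod.fst '' (V : Set (LpC Ω 2 × L2Vec Ω))) := by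
  have h1 : (V.map (LinearMap.fst ℂ (LpC Ω 2) (L2Vec Ω))).topologicalClosure = ⊤ := by
    rw [Submodule.topologicalClosure_eq_top_iff, Submodule.eq_bot_iff]
    intro f hf
    have h2 : ∀ᵐ x, x ∈ Ω → f x = 0 := by
      refine hΩ.ae_eq_zero_of_integral_contDiff_smul_eq_zero ?_ fun φ hφ hφc hφΩ => ?_
      · exact locallyIntegrableOn_of_locallyIntegrable_restrict
          ((Lp.memLp f).locallyIntegrable (by norm_num))
      · obtain ⟨w, hw, hwφ⟩ := exists_mem_smoothD hΩ hD hDΩ hφ hφc hφΩ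
        have h3 : inner ℂ w.1 f = 0 :=
          (Submodule.mem_orthogonal _ _).1 hf w.1 ⟨w, hV hw, rfl⟩
        rw [L2.inner_def] at h3
        rw [← h3]
        refine Eq.trans (setIntegral_eq_integral_of_forall_compl_eq_zero (s := Ω) ?_).symm ?_
        · intro x hx
          rw [image_eq_zero_of_notMem_tsupport fun h' => hx (hφΩ h'), zero_smul]
        · refine integral_congr_ae ?_
          filter_upwards [hwφ] with x hx
          rw [hx, RCLike.inner_apply, Complex.conj_ofReal, mul_comm, Complex.real_smul]
    refine Lp.ext ?_
    filter_upwards [(ae_restrict_iff' hΩ.measurableSet).2 h2,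
      Lp.coeFn_zero ℂ 2 (volume.restrict Ω)] with x hx h0
    rw [hx, h0]
    rfl
  have h2 := (Submodule.dense_iff_topologicalClosure_eq_top).2 h1
  simpa using h2

end Domains

/-! ### Invariance of the form domains under normal maps -/

section Invariance

variable {d : ℕ} {Ω D : Set (EuclideanSpace ℝ (Fin d))}

local notation "𝔼" => EuclideanSpace ℝ (Fin d)
local notation "ℂd" => EuclideanSpace ℂ (Fin d)

/-- A real-linear map of the plane, applied to the coordinates of a vector. -/
def vecApply (L : ℂ →L[ℝ] ℂ) (F : ℂd) : ℂd := WithLp.toLp 2 fun i => L (F i)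

lemma vecApply_apply (L : ℂ →L[ℝ] ℂ) (F : ℂd) (i : Fin d) : vecApply L F i = L (F i) := rfl

lemma norm_vecApply_le {L : ℂ →L[ℝ] ℂ} {C : ℝ} (hL : ‖L‖ ≤ C) (F : ℂd) :
    ‖vecApply L F‖ ≤ C * ‖F‖ := by
  have hC : 0 ≤ C := (norm_nonneg _).trans hL
  refine le_of_sq_le_sq ?_ (by positivity)
  rw [mul_pow, EuclideanSpace.norm_sq_eq, EuclideanSpace.norm_sq_eq, Finset.mul_sum]
  refine Finset.sum_le_sum fun i _ => ?_
  rw [← mul_pow]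
  exact pow_le_pow_left₀ (norm_nonneg _) (L.le_of_opNorm_le hL _) 2

lemma continuous_vecApply : Continuous fun q : (ℂ →L[ℝ] ℂ) × ℂd => vecApply q.1 q.2 := by
  refine (PiLp.continuous_toLp 2 _).comp (continuous_pi fun i => ?_)
  exact continuous_fst.clm_apply ((EuclideanSpace.proj (𝕜 := ℂ) i).continuous.comp continuous_snd)

lemma L2_norm_sq_eq_integral (f : L2Vec Ω) : ‖f‖ ^ 2 = ∫ x in Ω, ‖f x‖ ^ 2 := by
  rw [← re_inner_self_eq, L2.inner_def]
  have : ∀ x, inner ℂ (f x) (f x) = ((‖f x‖ ^ 2 : ℝ) : ℂ) := fun x => by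
    rw [inner_self_eq_norm_sq_to_K]; norm_cast
  simp_rw [this]
  rw [integral_complex_ofReal, Complex.ofReal_re]

variable {G : ℂ → ℂ} {C : ℝ}

lemma IsNormalMap.memLp_comp (hG : IsNormalMap G C) (u : LpC Ω 2) :
    MemLp (fun x => G (u x)) 2 (volume.restrict Ω) :=
  (Lp.memLp u).of_le_mul (hG.smooth.continuous.comp_aestronglyMeasurable
    (Lp.aestronglyMeasurable u)) (.of_forall fun _ => hG.norm_le _)

lemma IsNormalMap.aestronglyMeasurable_vecApply (hG : IsNormalMap G C) (u : LpC Ω 2)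
    (F : L2Vec Ω) :
    AEStronglyMeasurable (fun x => vecApply (fderiv ℝ G (u x)) (F x)) (volume.restrict Ω) :=
  continuous_vecApply.comp_aestronglyMeasurable
    ((hG.continuous_fderiv.comp_aestronglyMeasurable (Lp.aestronglyMeasurable u)).prodMk
      (Lp.aestronglyMeasurable F))

lemma IsNormalMap.memLp_vecApply (hG : IsNormalMap G C) (u : LpC Ω 2) (F : L2Vec Ω) :
    MemLp (fun x => vecApply (fderiv ℝ G (u x)) (F x)) 2 (volume.restrict Ω) :=
  (Lp.memLp F).of_le_mul (hG.aestronglyMeasurable_vecApply u F)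
    (.of_forall fun _ => norm_vecApply_le (hG.bound _) _)

/-- The pair `(G ∘ u, ∇(G ∘ u))`. -/
def IsNormalMap.pair (hG : IsNormalMap G C) (w : LpC Ω 2 × L2Vec Ω) : LpC Ω 2 × L2Vec Ω :=
  ((hG.memLp_comp w.1).toLp _, (hG.memLp_vecApply w.1 w.2).toLp _)

lemma IsNormalMap.fst_pair (hG : IsNormalMap G C) (w : LpC Ω 2 × L2Vec Ω) :
    (hG.pair w).1 =ᵐ[volume.restrict Ω] fun x => G (w.1 x) := (hG.memLp_comp w.1).coeFn_toLp

lemma IsNormalMap.snd_pair (hG : IsNormalMap G C) (w : LpC Ω 2 × L2Vec Ω) :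
    (hG.pair w).2 =ᵐ[volume.restrict Ω] fun x => vecApply (fderiv ℝ G (w.1 x)) (w.2 x) :=
  (hG.memLp_vecApply w.1 w.2).coeFn_toLp

lemma IsNormalMap.pair_mem_W12 (hΩ : IsOpen Ω) (hG : IsNormalMap G C) {w : LpC Ω 2 × L2Vec Ω}
    (hw : w ∈ W12 Ω) : hG.pair w ∈ W12 Ω := by
  intro φ hφ hφc hφΩ i
  have h1 : IsWeakDeriv Ω (EuclideanSpace.single i 1) w.1 (fun x => w.2 x i) :=
    fun φ hφ hφc hφΩ => hw φ hφ hφc hφΩ i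
  have h2 : MemLp (fun x => w.2 x i) 2 (volume.restrict Ω) := (Lp.memLp w.2).of_le
    ((EuclideanSpace.proj (𝕜 := ℂ) i).continuous.comp_aestronglyMeasurable
      (Lp.aestronglyMeasurable w.2)) (.of_forall fun x => PiLp.norm_apply_le _ _)
  have h3 := h1.comp hΩ (Lp.memLp w.1) h2 hG φ hφ hφc hφΩ
  refine Eq.trans (integral_congr_ae ?_) (h3.trans (congrArg _ (integral_congr_ae ?_)))
  · filter_upwards [hG.fst_pair w] with x hx
    rw [hx]
  · filter_upwards [hG.snd_pair w] with x hx
    rw [hx, vecApply_apply]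

lemma IsNormalMap.pair_mem_smoothD (hΩ : IsOpen Ω) (hG : IsNormalMap G C)
    {w : LpC Ω 2 × L2Vec Ω} (hw : w ∈ smoothD Ω D) : hG.pair w ∈ smoothD Ω D := by
  obtain ⟨hw, φ, hφ, hφc, hφD, hφe⟩ := hw
  refine ⟨hG.pair_mem_W12 hΩ hw, fun x => G (φ x), hG.smooth.comp hφ, hφc.comp_left hG.zero,
    hφD.mono (closure_mono fun x hx h0 => hx (by simp [h0, hG.zero])), ?_⟩
  filter_upwards [hφe, hG.fst_pair w] with x h1 h2
  rw [h2, h1]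

lemma IsNormalMap.pair_mem_sobolevD (hΩ : IsOpen Ω) (hG : IsNormalMap G C)
    {w : LpC Ω 2 × L2Vec Ω} (hw : w ∈ sobolevD Ω D) : hG.pair w ∈ sobolevD Ω D := by
  refine ⟨hG.pair_mem_W12 hΩ hw.1, hw.2.mono (essSupport_subset_of_imp ?_)⟩
  filter_upwards [hG.fst_pair w] with x h1 h2
  rw [h1, h2, hG.zero]

/-- The derivative of G is only continuous and bounded, so the gradient part is split as DG(u_n)(F_n
- F) + (DG(u_n) - DG(u))F. The first term is bounded by C‖F_n - F‖; the second tends to 0 by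
dominated convergence along an a.e. convergent subsequence. -/
lemma IsNormalMap.continuous_pair (hG : IsNormalMap G C) :
    Continuous (hG.pair : LpC Ω 2 × L2Vec Ω → LpC Ω 2 × L2Vec Ω) := by
  have hC := hG.nonneg
  refine continuous_iff_continuousAt.2 fun w => tendsto_of_subseq_tendsto fun ns hns => ?_
  have h1 : Tendsto (fun n => (ns n).1) atTop (𝓝 w.1) := (continuous_fst.tendsto w).comp hns
  have h2 : Tendsto (fun n => (ns n).2) atTop (𝓝 w.2) := (continuous_snd.tendsto w).comp hns
  obtain ⟨ms, hms, hae⟩ := (tendstoInMeasure_of_tendsto_Lp h1).exists_seq_tendsto_ae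
  refine ⟨ms, ?_⟩
  have h1' := h1.comp hms.tendsto_atTop
  have h2' := h2.comp hms.tendsto_atTop
  refine Tendsto.prodMk_nhds (mx := fun n => (hG.pair (ns (ms n))).1)
    (my := fun n => (hG.pair (ns (ms n))).2) ?_ ?_
  · rw [tendsto_iff_norm_sub_tendsto_zero] at h1' ⊢
    refine squeeze_zero (fun _ => norm_nonneg _) (fun n => ?_)
      (by simpa using h1'.const_mul C)
    refine Lp.norm_le_mul_norm_of_ae_le_mul ?_
    filter_upwards [hG.fst_pair w, hG.fst_pair (ns (ms n)),
      Lp.coeFn_sub (hG.pair (ns (ms n))).1 (hG.pair w).1,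
      Lp.coeFn_sub (ns (ms n)).1 w.1] with x e1 e2 e3 e4
    change ‖((hG.pair (ns (ms n))).1 - (hG.pair w).1 : LpC Ω 2) x‖ ≤
      C * ‖((ns (ms n)).1 - w.1 : LpC Ω 2) x‖
    rw [e3, e4, Pi.sub_apply, Pi.sub_apply, e1, e2]
    exact hG.norm_sub_le _ _
  · let b : ℕ → L2Vec Ω := fun n => (hG.memLp_vecApply (ns (ms n)).1 w.2).toLp _ - (hG.pair w).2
    have hbe : ∀ n, b n =ᵐ[volume.restrict Ω] fun x =>
        vecApply (fderiv ℝ G ((ns (ms n)).1 x)) (w.2 x) - vecApply (fderiv ℝ G (w.1 x)) (w.2 x) :=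
      fun n => by
        filter_upwards [Lp.coeFn_sub ((hG.memLp_vecApply (ns (ms n)).1 w.2).toLp _) (hG.pair w).2,
          (hG.memLp_vecApply (ns (ms n)).1 w.2).coeFn_toLp, hG.snd_pair w] with x e1 e2 e3
        rw [e1, Pi.sub_apply, e2, e3]
    have hb : Tendsto (fun n => ‖b n‖) atTop (𝓝 0) := by
      have h3 : Tendsto (fun n => ‖b n‖ ^ 2) atTop (𝓝 0) := by
        simp_rw [L2_norm_sq_eq_integral]
        rw [← integral_zero (EuclideanSpace ℝ (Fin d)) ℝ (μ := volume.restrict Ω)]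
        refine tendsto_integral_of_dominated_convergence
          (fun x => (2 * C) ^ 2 * ‖w.2 x‖ ^ 2) (fun n => ?_) ?_ (fun n => ?_) ?_
        · exact (Lp.aestronglyMeasurable (b n)).norm.pow 2
        · exact ((Lp.memLp w.2).integrable_norm_pow (by norm_num)).const_mul _
        · filter_upwards [hbe n] with x hx
          rw [Real.norm_of_nonneg (by positivity), hx, ← mul_pow]
          refine pow_le_pow_left₀ (norm_nonneg _) ((_root_.norm_sub_le _ _).trans ?_) 2
          have := norm_vecApply_le (hG.bound ((ns (ms n)).1 x)) (w.2 x)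
          have := norm_vecApply_le (hG.bound (w.1 x)) (w.2 x)
          linarith
        · filter_upwards [hae, ae_all_iff.2 hbe] with x hx hx'
          simp_rw [hx']
          have h4 : Tendsto (fun n => vecApply (fderiv ℝ G ((ns (ms n)).1 x)) (w.2 x)) atTop
              (𝓝 (vecApply (fderiv ℝ G (w.1 x)) (w.2 x))) :=
            (continuous_vecApply.tendsto (fderiv ℝ G (w.1 x), w.2 x)).comp
              (((hG.continuous_fderiv.tendsto _).comp hx).prodMk_nhds tendsto_const_nhds)
          have h5 := (h4.sub_const (vecApply (fderiv ℝ G (w.1 x)) (w.2 x))).norm.pow 2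
          simpa using h5
      have h6 := h3.sqrt
      simpa [Real.sqrt_sq (norm_nonneg _)] using h6
    rw [tendsto_iff_norm_sub_tendsto_zero] at h2' ⊢
    refine squeeze_zero (fun _ => norm_nonneg _) (fun n => ?_)
      (by simpa using (h2'.const_mul C).add hb)
    have h7 : (hG.pair (ns (ms n))).2 - (hG.pair w).2 =
      ((hG.pair (ns (ms n))).2 - (hG.memLp_vecApply (ns (ms n)).1 w.2).toLp _) + b n := by
      simp [b]
    change ‖(hG.pair (ns (ms n))).2 - (hG.pair w).2‖ ≤ C * ‖(ns (ms n)).2 - w.2‖ + ‖b n‖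
    rw [h7]
    refine (norm_add_le _ _).trans (add_le_add_left ?_ _)
    refine Lp.norm_le_mul_norm_of_ae_le_mul ?_
    filter_upwards [hG.snd_pair (ns (ms n)), (hG.memLp_vecApply (ns (ms n)).1 w.2).coeFn_toLp,
      Lp.coeFn_sub (hG.pair (ns (ms n))).2 ((hG.memLp_vecApply (ns (ms n)).1 w.2).toLp _),
      Lp.coeFn_sub (ns (ms n)).2 w.2] with x e1 e2 e3 e4
    rw [e3, e4, Pi.sub_apply, Pi.sub_apply, e1, e2]
    refine le_trans (le_of_eq ?_) (norm_vecApply_le (hG.bound ((ns (ms n)).1 x))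
      ((ns (ms n)).2 x - w.2 x))
    congr 1
    ext i
    simp [vecApply_apply]

/-- The properties of the form domain that matter. -/
structure IsFormDomain (Ω : Set 𝔼) (V : Submodule ℂ (LpC Ω 2 × L2Vec Ω)) : Prop where
  isClosed : IsClosed (V : Set (LpC Ω 2 × L2Vec Ω))
  dense_fst : Dense (Prod.fst '' (V : Set (LpC Ω 2 × L2Vec Ω)))
  pair_mem : ∀ {G : ℂ → ℂ} {C : ℝ} (hG : IsNormalMap G C), ∀ w ∈ V, hG.pair w ∈ V

lemma closureW12_eq {S : Submodule ℂ (LpC Ω 2 × L2Vec Ω)}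
    (hS : (S : Set (LpC Ω 2 × L2Vec Ω)) ⊆ W12 Ω) :
    closureW12 Ω S = (S.topologicalClosure : Set (LpC Ω 2 × L2Vec Ω)) := by
  rw [Submodule.topologicalClosure_coe]
  exact inter_eq_right.2 (closure_minimal hS isClosed_W12)

/-- Invariance is checked on the generating subspace and passes to its closure because composition
with a normal map is continuous in W^{1,2}. No regularity of Ω enters. -/
lemma isFormDomain_topologicalClosure (hΩ : IsOpen Ω) (hD : IsClosed D) (hDΩ : D ⊆ frontier Ω)
    {S : Submodule ℂ (LpC Ω 2 × L2Vec Ω)} (h1 : smoothD Ω D ⊆ S)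
    (h2 : ∀ {G : ℂ → ℂ} {C : ℝ} (hG : IsNormalMap G C), ∀ w ∈ S, hG.pair w ∈ S) :
    IsFormDomain Ω S.topologicalClosure where
  isClosed := S.isClosed_topologicalClosure
  dense_fst := dense_fst_of_smoothD_subset hΩ hD hDΩ (h1.trans S.le_topologicalClosure)
  pair_mem hG _ hw := map_mem_closure hG.continuous_pair hw fun w hw => h2 hG w hw

theorem exists_isFormDomain (hΩ : IsOpen Ω) (hD : IsClosed D) (hDΩ : D ⊆ frontier Ω)
    {V : Set (LpC Ω 2 × L2Vec Ω)}
    (hV : V = closureW12 Ω (smoothD Ω D) ∨ V = closureW12 Ω (sobolevD Ω D)) :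
    ∃ V' : Submodule ℂ (LpC Ω 2 × L2Vec Ω), V = V' ∧ IsFormDomain Ω V' := by
  rcases hV with rfl | rfl
  · exact ⟨(smoothSubmodule Ω D).topologicalClosure,
      closureW12_eq (S := smoothSubmodule Ω D) fun w hw => hw.1,
      isFormDomain_topologicalClosure hΩ hD hDΩ subset_rfl fun hG w hw =>
        hG.pair_mem_smoothD hΩ hw⟩
  · exact ⟨(sobolevDSubmodule Ω D).topologicalClosure,
      closureW12_eq (S := sobolevDSubmodule Ω D) fun w hw => hw.1,
      isFormDomain_topologicalClosure hΩ hD hDΩ smoothD_subset_sobolevD fun hG w hw =>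
        hG.pair_mem_sobolevD hΩ hw⟩

end Invariance

/-! ### Multiplication operators -/

section MulOp

variable {d : ℕ} {Ω : Set (EuclideanSpace ℝ (Fin d))}
  {ν : EuclideanSpace ℝ (Fin d) → Matrix (Fin d) (Fin d) ℂ} {M M' : L2Vec Ω →L[ℂ] L2Vec Ω}

/-- `M` is multiplication by `ν` in `L²(Ω; ℂ^d)`. -/
def IsMulOp (Ω : Set (EuclideanSpace ℝ (Fin d)))
    (ν : EuclideanSpace ℝ (Fin d) → Matrix (Fin d) (Fin d) ℂ) (M : L2Vec Ω →L[ℂ] L2Vec Ω) : Prop :=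
  ∀ F, M F =ᵐ[volume.restrict Ω] fun x => Matrix.toEuclideanCLM (𝕜 := ℂ) (ν x) (F x)

lemma aestronglyMeasurable_mul (hν : ∀ i j, AEMeasurable (fun x => ν x i j) (volume.restrict Ω))
    (F : L2Vec Ω) : AEStronglyMeasurable
      (fun x => Matrix.toEuclideanCLM (𝕜 := ℂ) (ν x) (F x)) (volume.restrict Ω) := by
  have h1 : AEMeasurable (fun x => fun i => ∑ j, ν x i j * F x j) (volume.restrict Ω) := by
    refine aemeasurable_pi_lambda _ fun i => Finset.aemeasurable_fun_sum _ fun j _ => ?_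
    exact (hν i j).mul ((EuclideanSpace.proj (𝕜 := ℂ) j).continuous.comp_aestronglyMeasurable
      (Lp.aestronglyMeasurable F)).aemeasurable
  exact (PiLp.continuous_toLp 2 _).comp_aestronglyMeasurable h1.aestronglyMeasurable

lemma exists_isMulOp (hν : ∀ i j, AEMeasurable (fun x => ν x i j) (volume.restrict Ω)) {C : ℝ}
    (hC : ∀ᵐ x ∂(volume.restrict Ω), ‖Matrix.toEuclideanCLM (𝕜 := ℂ) (ν x)‖ ≤ C) :
    ∃ M, IsMulOp Ω ν M := by
  have hm : ∀ F : L2Vec Ω, MemLp (fun x => Matrix.toEuclideanCLM (𝕜 := ℂ) (ν x) (F x)) 2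
      (volume.restrict Ω) := fun F => (Lp.memLp F).of_le_mul (aestronglyMeasurable_mul hν F) (by
    filter_upwards [hC] with x hx
    exact ContinuousLinearMap.le_of_opNorm_le _ hx _)
  let L : L2Vec Ω →ₗ[ℂ] L2Vec Ω :=
    { toFun := fun F => (hm F).toLp _
      map_add' := fun F G => Lp.ext (by
        filter_upwards [(hm (F + G)).coeFn_toLp, (hm F).coeFn_toLp, (hm G).coeFn_toLp,
          Lp.coeFn_add ((hm F).toLp _) ((hm G).toLp _), Lp.coeFn_add F G] with x h1 h2 h3 h4 h5
        rw [h1, h4, Pi.add_apply, h2, h3, h5, Pi.add_apply, map_add])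
      map_smul' := fun c F => Lp.ext (by
        filter_upwards [(hm (c • F)).coeFn_toLp, (hm F).coeFn_toLp,
          Lp.coeFn_smul c ((hm F).toLp _), Lp.coeFn_smul c F] with x h1 h2 h3 h4
        rw [h1, RingHom.id_apply, h3, Pi.smul_apply, h2, h4, Pi.smul_apply, map_smul]) }
  refine ⟨L.mkContinuous C fun F => Lp.norm_le_mul_norm_of_ae_le_mul ?_, fun F =>
    (hm F).coeFn_toLp⟩
  filter_upwards [hC, (hm F).coeFn_toLp] with x hx h1
  change ‖(hm F).toLp _ x‖ ≤ _
  rw [h1]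
  exact ContinuousLinearMap.le_of_opNorm_le _ hx _

lemma IsMulOp.smul (hM : IsMulOp Ω ν M) (z : ℂ) : IsMulOp Ω (fun x => z • ν x) (z • M) := by
  intro F
  filter_upwards [hM F, Lp.coeFn_smul z (M F)] with x h1 h2
  rw [smul_apply, h2, Pi.smul_apply, h1, map_smul]
  rfl

lemma IsMulOp.inner_eq (hM : IsMulOp Ω ν M) (F G : L2Vec Ω) : inner ℂ G (M F) =
    ∫ x in Ω, inner ℂ (G x) (Matrix.toEuclideanCLM (𝕜 := ℂ) (ν x) (F x)) := by
  rw [L2.inner_def]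
  refine integral_congr_ae ?_
  filter_upwards [hM F] with x hx
  rw [hx]

lemma IsMulOp.integrable (hM : IsMulOp Ω ν M) (F G : L2Vec Ω) : Integrable
    (fun x => inner ℂ (G x) (Matrix.toEuclideanCLM (𝕜 := ℂ) (ν x) (F x))) (volume.restrict Ω) := by
  refine (L2.integrable_inner (𝕜 := ℂ) G (M F)).congr ?_
  filter_upwards [hM F] with x hx
  rw [hx]

lemma IsMulOp.re_inner_eq (hM : IsMulOp Ω ν M) (F G : L2Vec Ω) : (inner ℂ G (M F)).re =
    ∫ x in Ω, (inner ℂ (G x) (Matrix.toEuclideanCLM (𝕜 := ℂ) (ν x) (F x))).re := by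
  rw [hM.inner_eq]
  exact (integral_re (hM.integrable F G)).symm

lemma IsMulOp.coerciveOp (hM : IsMulOp Ω ν M) {c : ℝ}
    (hν : ∀ᵐ x ∂(volume.restrict Ω), CoerciveWith (ν x) c) : CoerciveOp M c := by
  intro F
  rw [hM.re_inner_eq, L2_norm_sq_eq_integral, ← integral_const_mul]
  refine integral_mono_ae (((Lp.memLp F).integrable_norm_pow (by norm_num)).const_mul _)
    (hM.integrable F F).re ?_
  filter_upwards [hν] with x hx using hx _

lemma IsMulOp.formOperator_eq (hM : IsMulOp Ω ν M) (V : Submodule ℂ (LpC Ω 2 × L2Vec Ω)) :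
    formOperator Ω ν V = formGraph V M := by
  ext w
  simp only [formOperator, formGraph, form, hM.inner_eq]
  rfl

lemma inner_toEuclideanCLM_conjTranspose (L : Matrix (Fin d) (Fin d) ℂ)
    (a b : EuclideanSpace ℂ (Fin d)) :
    inner ℂ a (Matrix.toEuclideanCLM (𝕜 := ℂ) L.conjTranspose b) =
      inner ℂ (Matrix.toEuclideanCLM (𝕜 := ℂ) L a) b := by
  rw [← Matrix.star_eq_conjTranspose, map_star, ContinuousLinearMap.star_eq_adjoint,
    ContinuousLinearMap.adjoint_inner_right]

lemma IsMulOp.inner_conjTranspose (hM : IsMulOp Ω ν M)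
    (hM' : IsMulOp Ω (fun x => (ν x).conjTranspose) M') (F G : L2Vec Ω) :
    inner ℂ F (M' G) = inner ℂ (M F) G := by
  rw [hM'.inner_eq, L2.inner_def]
  refine integral_congr_ae ?_
  filter_upwards [hM F] with x hx
  rw [hx, inner_toEuclideanCLM_conjTranspose]

lemma norm_toEuclideanCLM_conjTranspose (L : Matrix (Fin d) (Fin d) ℂ) :
    ‖Matrix.toEuclideanCLM (𝕜 := ℂ) L.conjTranspose‖ = ‖Matrix.toEuclideanCLM (𝕜 := ℂ) L‖ := by
  rw [← Matrix.star_eq_conjTranspose, map_star, ContinuousLinearMap.star_eq_adjoint,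
    LinearIsometryEquiv.norm_map]

lemma CoerciveWith.conjTranspose {L : Matrix (Fin d) (Fin d) ℂ} {c : ℝ} (h : CoerciveWith L c) :
    CoerciveWith L.conjTranspose c := fun ξ => by
  rw [inner_toEuclideanCLM_conjTranspose, ← inner_conj_symm, Complex.conj_re]
  exact h ξ

/-- Since (p - 1)(p' - 1) = 1, rescaling a moves the weight from one slot of the form to the other;
the adjoint exchanges the slots. -/
lemma pForm_conjTranspose_re (L : Matrix (Fin d) (Fin d) ℂ) {p : ℝ} (hp : 1 < p)
    (a b : EuclideanSpace ℝ (Fin d)) :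
    (pForm L.conjTranspose (p / (p - 1)) a b).re =
      (pForm L p ((p / (p - 1) - 1) • a) b).re := by
  have h1 : (p - 1) * (p / (p - 1) - 1) = 1 := by
    have : p - 1 ≠ 0 := by linarith
    field_simp
    ring
  unfold pForm
  rw [inner_toEuclideanCLM_conjTranspose, ← inner_conj_symm, Complex.conj_re, smul_smul, h1,
    one_smul]

end MulOp

/-! ### Contractivity on `L^p` by truncation and by duality -/

section Contractivity

variable {α : Type*} [MeasurableSpace α] {ν : Measure α}

lemma lintegral_enorm_rpow_eq {f : α → ℂ} {p : ℝ} (hp : 0 < p)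
    (hf : MemLp f (ENNReal.ofReal p) ν) :
    ∫⁻ x, ‖f x‖ₑ ^ p ∂ν = ENNReal.ofReal (∫ x, ‖f x‖ ^ p ∂ν) := by
  have h1 : Integrable (fun x => ‖f x‖ ^ p) ν := by
    have := hf.integrable_norm_rpow (by simpa using hp) (by simp)
    rwa [ENNReal.toReal_ofReal hp.le] at this
  rw [ofReal_integral_eq_lintegral_ofReal h1 (.of_forall fun x => by positivity)]
  refine lintegral_congr fun x => ?_
  rw [← ofReal_norm, ENNReal.ofReal_rpow_of_nonneg (norm_nonneg _) hp.le]

lemma eLpNorm_le_of_integral_le {u f : α → ℂ} {p : ℝ} (hp : 0 < p)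
    (hf : MemLp f (ENNReal.ofReal p) ν) {h : ℕ → α → ℝ} (h0 : ∀ n x, 0 ≤ h n x)
    (hi : ∀ n, Integrable (h n) ν) (hle : ∀ n, ∫ x, h n x ∂ν ≤ ∫ x, ‖f x‖ ^ p ∂ν)
    (hlim : ∀ x, Tendsto (fun n => h n x) atTop (𝓝 (‖u x‖ ^ p))) :
    eLpNorm u (ENNReal.ofReal p) ν ≤ eLpNorm f (ENNReal.ofReal p) ν := by
  rw [eLpNorm_eq_lintegral_rpow_enorm_toReal (by simpa using hp) (by simp),
    eLpNorm_eq_lintegral_rpow_enorm_toReal (by simpa using hp) (by simp),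
    ENNReal.toReal_ofReal hp.le]
  refine ENNReal.rpow_le_rpow ?_ (by positivity)
  rw [lintegral_enorm_rpow_eq hp hf]
  have h1 : ∀ x, ‖u x‖ₑ ^ p = liminf (fun n => ENNReal.ofReal (h n x)) atTop := fun x => by
    rw [← ofReal_norm, ENNReal.ofReal_rpow_of_nonneg (norm_nonneg _) hp.le]
    exact ((ENNReal.continuous_ofReal.tendsto _).comp (hlim x)).liminf_eq.symm
  simp_rw [h1]
  refine (lintegral_liminf_le' fun n => (hi n).1.aemeasurable.ennreal_ofReal).trans ?_
  refine liminf_le_of_le (by isBoundedDefault) fun b hb => ?_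
  obtain ⟨n, hn⟩ := hb.exists
  refine hn.trans ?_
  rw [← ofReal_integral_eq_lintegral_ofReal (hi n) (.of_forall (h0 n))]
  exact ENNReal.ofReal_le_ofReal (hle n)

lemma integral_rpow_norm_le_of_lpContractive {p : ℝ} (hp : 0 < p) {J : Lp ℂ 2 ν →L[ℂ] Lp ℂ 2 ν}
    (hJ : LpContractive (ENNReal.ofReal p) J) {f : Lp ℂ 2 ν} (hf : MemLp f (ENNReal.ofReal p) ν) :
    MemLp (J f) (ENNReal.ofReal p) ν ∧ ∫ x, ‖J f x‖ ^ p ∂ν ≤ ∫ x, ‖f x‖ ^ p ∂ν := by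
  have h1 : MemLp (J f) (ENNReal.ofReal p) ν := ⟨Lp.aestronglyMeasurable _, (hJ f hf).trans_lt hf.2⟩
  refine ⟨h1, ?_⟩
  have h2 := hJ f hf
  rw [eLpNorm_eq_lintegral_rpow_enorm_toReal (by simpa using hp) (by simp),
    eLpNorm_eq_lintegral_rpow_enorm_toReal (by simpa using hp) (by simp),
    ENNReal.toReal_ofReal hp.le, ENNReal.rpow_le_rpow_iff (by positivity),
    lintegral_enorm_rpow_eq hp hf, lintegral_enorm_rpow_eq hp h1,
    ENNReal.ofReal_le_ofReal_iff (integral_nonneg fun x => by positivity)] at h2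
  exact h2

/-- Contractivity on `L^p` follows from contractivity of the adjoint on `L^{p'}`. -/
lemma lpContractive_of_adjoint {p q : ℝ} (hp : 1 < p) (hp2 : p < 2) (hpq : p.HolderConjugate q)
    {J J' : Lp ℂ 2 ν →L[ℂ] Lp ℂ 2 ν} (hadj : ∀ f g, inner ℂ (J f) g = inner ℂ f (J' g))
    (hJ' : LpContractive (ENNReal.ofReal q) J') : LpContractive (ENNReal.ofReal p) J := by
  intro f hf
  have hp0 : 0 < p := by linarith
  have hq0 : 0 < q := hpq.symm.pos
  set u := J f
  -- For p < 2 the weight |u|^{p-2} blows up where u is small. Cutting off |u| < 1/(n+1) keeps the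
  -- dual function g = |u|^{p-2}u in L² and in L^q.
  let S : ℕ → Set ℝ := fun n => Ici ((n : ℝ) + 1)⁻¹
  let c : ℕ → ℝ → ℝ := fun n => (S n).indicator fun t => t ^ (p - 2)
  let h : ℕ → α → ℝ := fun n x => c n ‖u x‖ * ‖u x‖ ^ 2
  have hc0 : ∀ n t, 0 ≤ t → 0 ≤ c n t := fun n t ht => indicator_apply_nonneg fun _ => by positivity
  have hcm : ∀ n, Measurable (c n) := fun n =>
    (measurable_id.pow_const (p - 2)).indicator measurableSet_Ici
  have hn0 : ∀ n : ℕ, 0 < ((n : ℝ) + 1)⁻¹ := fun n => by positivity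
  have hcb : ∀ n t, c n t ≤ (((n : ℝ) + 1)⁻¹) ^ (p - 2) := fun n t => by
    by_cases ht : t ∈ S n
    · simp only [c, indicator_of_mem ht]
      exact Real.rpow_le_rpow_of_nonpos (hn0 n) ht (by linarith)
    · simp only [c, indicator_of_notMem ht]
      exact (Real.rpow_pos_of_pos (hn0 n) _).le
  have hum : Measurable fun x => ‖u x‖ := (Lp.stronglyMeasurable u).norm.measurable
  have hcum : ∀ n, Measurable fun x => c n ‖u x‖ := fun n => (hcm n).comp hum
  have hu2 : Integrable (fun x => ‖u x‖ ^ 2) ν := (Lp.memLp u).integrable_norm_pow (by norm_num)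
  have h0 : ∀ n x, 0 ≤ h n x := fun n x => mul_nonneg (hc0 n _ (norm_nonneg _)) (sq_nonneg _)
  have hi : ∀ n, Integrable (h n) ν := fun n => by
    refine (hu2.const_mul ((((n : ℝ) + 1)⁻¹) ^ (p - 2))).mono'
      ((hcum n).mul (hum.pow_const 2)).aestronglyMeasurable (.of_forall fun x => ?_)
    rw [Real.norm_of_nonneg (h0 n x)]
    exact mul_le_mul_of_nonneg_right (hcb n _) (sq_nonneg _)
  have hlim : ∀ x, Tendsto (fun n => h n x) atTop (𝓝 (‖u x‖ ^ p)) := fun x => by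
    rcases (norm_nonneg (u x)).eq_or_lt with h00 | hpos
    · simp only [h, ← h00, Real.zero_rpow hp0.ne']
      simp
    · refine tendsto_const_nhds.congr' ?_
      have := (tendsto_one_div_add_atTop_nhds_zero_nat (𝕜 := ℝ)).eventually_lt_const hpos
      filter_upwards [this] with n hn
      have hmem : ‖u x‖ ∈ S n := by
        rw [one_div] at hn
        exact hn.le
      simp only [h, c, indicator_of_mem hmem]
      rw [← Real.rpow_natCast, ← Real.rpow_add hpos]
      norm_num
  refine eLpNorm_le_of_integral_le hp0 hf h0 hi (fun n => ?_) hlim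
  let g : α → ℂ := fun x => ((c n ‖u x‖ : ℝ) : ℂ) * u x
  have hgm : AEStronglyMeasurable g ν :=
    (Complex.measurable_ofReal.comp (hcum n)).aestronglyMeasurable.mul (Lp.aestronglyMeasurable u)
  have hgn : ∀ x, ‖g x‖ = c n ‖u x‖ * ‖u x‖ := fun x => by
    simp only [g, norm_mul, Complex.norm_real, Real.norm_of_nonneg (hc0 n _ (norm_nonneg (u x)))]
  have hg2 : MemLp g 2 ν := (Lp.memLp u).of_le_mul hgm (.of_forall fun x => by
    rw [hgn]
    exact mul_le_mul_of_nonneg_right (hcb n _) (norm_nonneg _))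
  have hpq' : (p - 2 + 1) * q = p := by
    have := hpq.sub_one_mul_conj
    linarith
  have hgq : ∀ x, ‖g x‖ ^ q = h n x := fun x => by
    rw [hgn]
    by_cases ht : ‖u x‖ ∈ S n
    · have hpos : 0 < ‖u x‖ := (hn0 n).trans_le ht
      simp only [h, c, indicator_of_mem ht]
      rw [← Real.rpow_add_one hpos.ne', ← Real.rpow_mul hpos.le, hpq', ← Real.rpow_natCast,
        ← Real.rpow_add hpos]
      norm_num
    · simp [h, c, indicator_of_notMem ht, Real.zero_rpow hq0.ne']
  have hgLq : MemLp g (ENNReal.ofReal q) ν := by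
    rw [← integrable_norm_rpow_iff hgm (by simpa using hq0) (by simp),
      ENNReal.toReal_ofReal hq0.le]
    simp_rw [hgq]
    exact hi n
  set G := hg2.toLp g
  have hGg : G =ᵐ[ν] g := hg2.coeFn_toLp
  have hGq : MemLp G (ENNReal.ofReal q) ν := hgLq.ae_eq hGg.symm
  obtain ⟨hJG, hJle⟩ := integral_rpow_norm_le_of_lpContractive hq0 hJ' hGq
  have e1 : ∫ x, ‖G x‖ ^ q ∂ν = ∫ x, h n x ∂ν := integral_congr_ae (by
    filter_upwards [hGg] with x hx
    rw [hx, hgq])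
  have e2 : inner ℂ u G = ((∫ x, h n x ∂ν : ℝ) : ℂ) := by
    rw [L2.inner_def, ← integral_complex_ofReal]
    refine integral_congr_ae ?_
    filter_upwards [hGg] with x hx
    rw [hx, RCLike.inner_apply]
    simp only [g, h]
    rw [mul_assoc, Complex.mul_conj, Complex.normSq_eq_norm_sq]
    push_cast
    ring
  have e3 : ∫ x, h n x ∂ν ≤ ∫ x, ‖f x‖ * ‖J' G x‖ ∂ν := by
    have : ∫ x, h n x ∂ν = (inner ℂ f (J' G)).re := by rw [← hadj, e2, Complex.ofReal_re]
    rw [this, L2.inner_def]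
    refine (Complex.re_le_norm _).trans ((norm_integral_le_integral_norm _).trans (le_of_eq ?_))
    refine integral_congr_ae (.of_forall fun x => ?_)
    simp only [RCLike.inner_apply, norm_mul, RCLike.norm_conj]
    ring
  have e4 := integral_mul_norm_le_Lp_mul_Lq hpq hf hJG
  set I := ∫ x, h n x ∂ν
  have hI0 : 0 ≤ I := integral_nonneg (h0 n)
  set N := ∫ x, ‖f x‖ ^ p ∂ν
  have hN0 : 0 ≤ N := integral_nonneg fun x => by positivity
  -- Hölder's inequality and contractivity of the adjoint, with |g|^q = h; dividing by I^{1/q}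
  -- leaves I ≤ N.
  have e5 : I ≤ N ^ (1 / p) * I ^ (1 / q) := by
    refine e3.trans (e4.trans (mul_le_mul_of_nonneg_left ?_ (by positivity)))
    exact Real.rpow_le_rpow (integral_nonneg fun x => by positivity) (hJle.trans_eq e1)
      (by positivity)
  rcases hI0.eq_or_lt with hI | hI
  · rw [← hI]; exact hN0
  · have e6 : I ^ (1 / p) * I ^ (1 / q) = I := by
      rw [← Real.rpow_add hI, one_div, one_div, hpq.inv_add_inv_eq_one, Real.rpow_one]
    have e7 : I ^ (1 / p) ≤ N ^ (1 / p) := by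
      refine le_of_mul_le_mul_right ?_ (Real.rpow_pos_of_pos hI (1 / q))
      rwa [e6]
    exact (Real.rpow_le_rpow_iff hI0 hN0 (by positivity)).1 e7

end Contractivity

/-! ### The test functions for `L^p`-contractivity -/

section TestMap

/-- A regularization of `s ↦ s ^ r`. -/
def regPow (r δ ε s : ℝ) : ℝ := ((δ + s) / (1 + ε * s)) ^ r

/-- The test function `z ↦ |z|^{2r} z`, regularized. -/
def testMap (r δ ε : ℝ) (z : ℂ) : ℂ := regPow r δ ε (‖z‖ ^ 2) • z

/-- The logarithmic derivative of the regularized power. -/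
def regLog (r δ ε s : ℝ) : ℝ := 2 * r * (1 - δ * ε) / ((δ + s) * (1 + ε * s))

variable {r δ ε : ℝ}

lemma regPow_nonneg (hδ : 0 ≤ δ) (hε : 0 < ε) {s : ℝ} (hs : 0 ≤ s) : 0 ≤ regPow r δ ε s := by
  unfold regPow; positivity

/-- The shift δ makes the power smooth at 0 and ε makes it bounded. The condition δε ≤ 1 keeps the
base below its value 1/ε at infinity. -/
lemma regPow_le (hr : 0 ≤ r) (hδ : 0 ≤ δ) (hε : 0 < ε) (hδε : δ * ε ≤ 1) {s : ℝ} (hs : 0 ≤ s) :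
    regPow r δ ε s ≤ (ε⁻¹) ^ r := by
  refine Real.rpow_le_rpow (by positivity) ?_ hr
  rw [div_le_iff₀ (by positivity)]
  have : ε⁻¹ * (1 + ε * s) = ε⁻¹ + s := by field_simp
  rw [this]
  have : δ ≤ ε⁻¹ := by rwa [← one_div, le_div_iff₀ hε]
  linarith

lemma hasDerivAt_regPow (hδ : 0 < δ) (hε : 0 < ε) {s : ℝ} (hs : 0 ≤ s) :
    HasDerivAt (regPow r δ ε) (regPow r δ ε s * (regLog r δ ε s / 2)) s := by
  have h1 : 0 < δ + s := by positivity
  have h2 : 0 < 1 + ε * s := by positivity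
  have hq : HasDerivAt (fun s => (δ + s) / (1 + ε * s))
      ((1 * (1 + ε * s) - (δ + s) * (ε * 1)) / (1 + ε * s) ^ 2) s :=
    ((hasDerivAt_id s).const_add δ).div (((hasDerivAt_id s).const_mul ε).const_add 1) h2.ne'
  have h3 := hq.rpow_const (p := r) (Or.inl (div_pos h1 h2).ne')
  refine HasDerivAt.congr_deriv (f := regPow r δ ε) h3 ?_
  unfold regPow regLog
  rw [Real.rpow_sub_one (div_pos h1 h2).ne']
  field_simp
  ring

lemma regLog_mul_nonneg (hr : 0 ≤ r) (hδ : 0 < δ) (hε : 0 < ε) (hδε : δ * ε ≤ 1) {s : ℝ}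
    (hs : 0 ≤ s) : 0 ≤ regLog r δ ε s := by
  unfold regLog
  have : 0 ≤ 1 - δ * ε := by linarith
  positivity

/-- The regularization never stretches more than the pure power: with 2r = p - 2, the radial factor
1 + `regLog` · |z|² stays at most p - 1. -/
lemma regLog_mul_le (hr : 0 ≤ r) (hδ : 0 < δ) (hε : 0 < ε) {s : ℝ}
    (hs : 0 ≤ s) : regLog r δ ε s * s ≤ 2 * r := by
  unfold regLog
  rw [div_mul_eq_mul_div, div_le_iff₀ (by positivity)]
  have h1 : (1 - δ * ε) * s ≤ (δ + s) * (1 + ε * s) := by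
    have : 0 ≤ δ * ε := by positivity
    have : 0 ≤ ε * s * s := by positivity
    have : 0 ≤ δ * ε * s := by positivity
    nlinarith
  calc 2 * r * (1 - δ * ε) * s = 2 * r * ((1 - δ * ε) * s) := by ring
    _ ≤ 2 * r * ((δ + s) * (1 + ε * s)) := by gcongr

lemma contDiff_testMap (hδ : 0 < δ) (hε : 0 < ε) : ContDiff ℝ ∞ (testMap r δ ε) := by
  have h1 : ContDiff ℝ ∞ fun z : ℂ => ‖z‖ ^ 2 := contDiff_norm_sq ℝ
  have h2 : ContDiff ℝ ∞ fun z : ℂ => (δ + ‖z‖ ^ 2) / (1 + ε * ‖z‖ ^ 2) :=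
    (contDiff_const.add h1).div (contDiff_const.add (contDiff_const.mul h1))
      fun z => by positivity
  exact (h2.rpow_const_of_ne fun z => by positivity).smul contDiff_id

lemma fderiv_testMap_apply (hδ : 0 < δ) (hε : 0 < ε) (z w : ℂ) :
    fderiv ℝ (testMap r δ ε) z w = regPow r δ ε (‖z‖ ^ 2) •
      (w + (regLog r δ ε (‖z‖ ^ 2) * inner ℝ z w) • z) := by
  have h1 : HasFDerivAt (fun z : ℂ => ‖z‖ ^ 2) (2 • innerSL ℝ z) z :=
    (hasStrictFDerivAt_norm_sq z).hasFDerivAt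
  have h2 := (hasDerivAt_regPow (r := r) hδ hε (sq_nonneg ‖z‖)).comp_hasFDerivAt z h1
  have h3 : HasFDerivAt (testMap r δ ε) _ z := h2.smul (hasFDerivAt_id z)
  rw [h3.fderiv]
  simp only [Function.comp_apply, add_apply, smul_apply,
    ContinuousLinearMap.smulRight_apply, ContinuousLinearMap.id_apply, innerSL_apply_apply,
    smul_add, smul_smul, nsmul_eq_mul, smul_eq_mul]
  congr 2
  push_cast
  ring

lemma isNormalMap_testMap (hr : 0 ≤ r) (hδ : 0 < δ) (hε : 0 < ε) (hδε : δ * ε ≤ 1) :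
    IsNormalMap (testMap r δ ε) ((ε⁻¹) ^ r * (1 + 2 * r)) where
  smooth := contDiff_testMap hδ hε
  zero := by simp [testMap]
  bound z := by
    refine ContinuousLinearMap.opNorm_le_bound _ (by positivity) fun w => ?_
    rw [fderiv_testMap_apply hδ hε, norm_smul,
      Real.norm_of_nonneg (regPow_nonneg hδ.le hε (sq_nonneg _)), mul_assoc]
    refine mul_le_mul (regPow_le hr hδ.le hε hδε (sq_nonneg _)) ?_ (norm_nonneg _) (by positivity)
    refine (norm_add_le _ _).trans ?_
    rw [add_mul, one_mul]
    refine add_le_add_right ?_ _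
    have h1 := regLog_mul_nonneg hr hδ hε hδε (sq_nonneg ‖z‖)
    have h2 := regLog_mul_le hr hδ hε (sq_nonneg ‖z‖)
    rw [norm_smul, norm_mul, Real.norm_of_nonneg h1]
    calc regLog r δ ε (‖z‖ ^ 2) * ‖inner ℝ z w‖ * ‖z‖
        ≤ regLog r δ ε (‖z‖ ^ 2) * (‖z‖ * ‖w‖) * ‖z‖ := by
          gcongr; exact norm_inner_le_norm z w
      _ = regLog r δ ε (‖z‖ ^ 2) * ‖z‖ ^ 2 * ‖w‖ := by ring
      _ ≤ 2 * r * ‖w‖ := by gcongr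

variable {d : ℕ}

/-- The expression is affine in τ and nonnegative at both ends: coercivity is the case τ = 1,
nonnegative Re `pForm` the case τ = p - 1. -/
lemma re_inner_cplx_nonneg {L : Matrix (Fin d) (Fin d) ℂ} {p : ℝ} (h1 : CoerciveWith L 0)
    (h2 : ∀ a b, 0 ≤ (pForm L p a b).re) {τ : ℝ} (hτ1 : 1 ≤ τ) (hτ : τ ≤ p - 1)
    (a b : EuclideanSpace ℝ (Fin d)) :
    0 ≤ (inner ℂ (cplx (τ • a) b) (Matrix.toEuclideanCLM (𝕜 := ℂ) L (cplx a b))).re := by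
  have h3 := h1 (cplx a b)
  have h4 := h2 a b
  rw [zero_mul] at h3
  unfold pForm at h4
  rw [inner_cplx_re] at h3 h4 ⊢
  simp only [real_inner_smul_left] at h3 h4 ⊢
  set x := inner ℝ a (Matrix.toEuclideanCLM (𝕜 := ℝ) (L.map Complex.re) a)
  set y := inner ℝ a (Matrix.toEuclideanCLM (𝕜 := ℝ) (L.map Complex.im) b)
  rcases le_total 0 (x - y) with h | h
  · have := mul_le_mul_of_nonneg_right hτ1 h
    linarith
  · have := mul_le_mul_of_nonpos_right hτ h
    linarith

/-- The pointwise inequality behind contractivity. -/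
lemma re_inner_vecApply_testMap_nonneg {L : Matrix (Fin d) (Fin d) ℂ} {p : ℝ} (hp : 2 ≤ p)
    (h1 : CoerciveWith L 0) (h2 : ∀ a b, 0 ≤ (pForm L p a b).re) (hδ : 0 < δ) (hε : 0 < ε)
    (hδε : δ * ε ≤ 1) (z : ℂ) (F : EuclideanSpace ℂ (Fin d)) :
    0 ≤ (inner ℂ (vecApply (fderiv ℝ (testMap ((p - 2) / 2) δ ε) z) F)
      (Matrix.toEuclideanCLM (𝕜 := ℂ) L F)).re := by
  set r := (p - 2) / 2
  have hr : 0 ≤ r := by simp only [r]; linarith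
  set k := regLog r δ ε (‖z‖ ^ 2)
  set g := regPow r δ ε (‖z‖ ^ 2)
  have hk := regLog_mul_nonneg hr hδ hε hδε (sq_nonneg ‖z‖)
  have hk' := regLog_mul_le hr hδ hε (sq_nonneg ‖z‖)
  have hg : 0 ≤ g := regPow_nonneg hδ.le hε (sq_nonneg _)
  -- The phase e of z splits the gradient into a radial part a and a tangential part b; the phase 1
  -- at z = 0 is arbitrary.
  obtain ⟨e, he, hez⟩ : ∃ e : ℂ, ‖e‖ = 1 ∧ z = (‖z‖ : ℂ) * e := by
    rcases eq_or_ne z 0 with rfl | hz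
    · exact ⟨1, by simp, by simp⟩
    · refine ⟨z / ‖z‖, by simp [hz], ?_⟩
      rw [mul_div_cancel₀ _ (by simpa using hz)]
  have hee : (starRingEnd ℂ) e * e = 1 := by
    rw [mul_comm, Complex.mul_conj, Complex.normSq_eq_norm_sq, he]; simp
  let a : EuclideanSpace ℝ (Fin d) := WithLp.toLp 2 fun i => ((starRingEnd ℂ) e * F i).re
  let b : EuclideanSpace ℝ (Fin d) := WithLp.toLp 2 fun i => ((starRingEnd ℂ) e * F i).im
  have hF : F = e • cplx a b := by
    ext i
    have : cplx a b i = (starRingEnd ℂ) e * F i := Complex.ext rfl rfl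
    rw [PiLp.smul_apply, this, smul_eq_mul, ← mul_assoc, mul_comm e, hee, one_mul]
  -- Up to the nonnegative factor g, the derivative of the test map stretches the radial part only.
  have hv : vecApply (fderiv ℝ (testMap r δ ε) z) F =
      (g : ℂ) • e • cplx ((1 + k * ‖z‖ ^ 2) • a) b := by
    ext i
    have h3 : cplx ((1 + k * ‖z‖ ^ 2) • a) b i =
        (starRingEnd ℂ) e * F i + ((k * ‖z‖ ^ 2 * ((starRingEnd ℂ) e * F i).re : ℝ) : ℂ) := by
      refine Complex.ext ?_ ?_
      · change (1 + k * ‖z‖ ^ 2) * ((starRingEnd ℂ) e * F i).re = _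
        rw [Complex.add_re, Complex.ofReal_re]
        ring
      · change ((starRingEnd ℂ) e * F i).im = _
        rw [Complex.add_im, Complex.ofReal_im, add_zero]
    have h4 : inner ℝ z (F i) = ‖z‖ * ((starRingEnd ℂ) e * F i).re := by
      rw [Complex.inner]
      conv_lhs => rw [hez]
      rw [map_mul, Complex.conj_ofReal, mul_comm, mul_assoc, Complex.re_ofReal_mul]
    rw [vecApply_apply, fderiv_testMap_apply hδ hε, PiLp.smul_apply, PiLp.smul_apply, h3, h4,
      smul_eq_mul, smul_eq_mul, Complex.real_smul, Complex.real_smul]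
    have h5 : F i = e * ((starRingEnd ℂ) e * F i) := by
      rw [← mul_assoc, mul_comm e, hee, one_mul]
    have h6 : (((k * (‖z‖ * ((starRingEnd ℂ) e * F i).re) : ℝ) : ℂ)) * z =
        ((k * ‖z‖ ^ 2 * ((starRingEnd ℂ) e * F i).re : ℝ) : ℂ) * e := by
      conv_lhs => enter [2]; rw [hez]
      push_cast
      ring
    change (g : ℂ) * (F i + ((k * (‖z‖ * ((starRingEnd ℂ) e * F i).re) : ℝ) : ℂ) * z) = _
    rw [h6]
    conv_lhs => enter [2, 1]; rw [h5]
    ring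
  rw [hv]
  conv_rhs => rw [hF]
  rw [map_smul, inner_smul_left, inner_smul_left, inner_smul_right, Complex.conj_ofReal,
    ← mul_assoc ((starRingEnd ℂ) e), hee, one_mul, Complex.re_ofReal_mul]
  refine mul_nonneg hg (re_inner_cplx_nonneg h1 h2 ?_ ?_ a b)
  · have := mul_nonneg hk (sq_nonneg ‖z‖)
    linarith
  · have : 2 * r = p - 2 := by simp only [r]; ring
    linarith

end TestMap

/-! ### `L^p`-contractivity of resolvents -/

section Contractivity

variable {d : ℕ} {Ω : Set (EuclideanSpace ℝ (Fin d))}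
  {ν : EuclideanSpace ℝ (Fin d) → Matrix (Fin d) (Fin d) ℂ} {M : L2Vec Ω →L[ℂ] L2Vec Ω}
  {V : Submodule ℂ (LpC Ω 2 × L2Vec Ω)} {p r δ ε : ℝ}

/-- Young's inequality for b/a and 1, multiplied by ga². The weight g need only lie below a^{p-2},
so the term in ga² can later be absorbed. -/
lemma young_weighted {a b g : ℝ} (hp : 1 < p) (ha : 0 ≤ a) (hb : 0 ≤ b) (hg : 0 ≤ g)
    (hga : g ≤ a ^ (p - 2)) : g * (a * b) ≤ (1 - p⁻¹) * (g * a ^ 2) + p⁻¹ * b ^ p := by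
  have hp0 : 0 < p := by linarith
  rcases ha.eq_or_lt with rfl | ha
  · simp only [zero_mul, mul_zero, ne_eq, OfNat.ofNat_ne_zero, not_false_eq_true, zero_pow,
      zero_add]
    positivity
  · have hconj := Real.HolderConjugate.conjExponent hp
    have h1 := Real.young_inequality_of_nonneg (a := b / a) (b := 1) (by positivity) zero_le_one
      hconj
    have h2 : 1 / p.conjExponent = 1 - p⁻¹ := by
      rw [one_div]; linarith [hconj.inv_add_inv_eq_one]
    rw [Real.one_rpow, h2, mul_one] at h1
    have h3 : g * (a * b) = g * a ^ 2 * (b / a) := by field_simp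
    have h4 : g * a ^ 2 * (b / a) ^ p ≤ b ^ p := by
      calc g * a ^ 2 * (b / a) ^ p ≤ a ^ (p - 2) * a ^ 2 * (b / a) ^ p := by gcongr
        _ = b ^ p := by
          rw [← Real.rpow_natCast a 2, ← Real.rpow_add ha, Real.div_rpow hb ha.le]
          have : a ^ p ≠ 0 := (Real.rpow_pos_of_pos ha p).ne'
          norm_num
          field_simp
    rw [h3]
    calc g * a ^ 2 * (b / a) ≤ g * a ^ 2 * ((b / a) ^ p / p + (1 - p⁻¹)) := by gcongr
      _ = (1 - p⁻¹) * (g * a ^ 2) + p⁻¹ * (g * a ^ 2 * (b / a) ^ p) := by ring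
      _ ≤ _ := by gcongr

lemma sq_rpow_half {a : ℝ} (ha : 0 ≤ a) : (a ^ 2) ^ ((p - 2) / 2) = a ^ (p - 2) := by
  rw [← Real.rpow_natCast a 2, ← Real.rpow_mul ha]
  congr 1
  push_cast
  ring

lemma regPow_zero_le (hr : 0 ≤ r) (hε : 0 < ε) {s : ℝ} (hs : 0 ≤ s) : regPow r 0 ε s ≤ s ^ r := by
  refine Real.rpow_le_rpow (by positivity) ?_ hr
  rw [zero_add]
  refine div_le_self hs ?_
  have : 0 ≤ ε * s := by positivity
  linarith

lemma measurable_regPow : Measurable (regPow r δ ε) := by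
  unfold regPow
  fun_prop

lemma aestronglyMeasurable_regPow (u : LpC Ω 2) :
    AEStronglyMeasurable (fun x => regPow r δ ε (‖u x‖ ^ 2)) (volume.restrict Ω) :=
  (measurable_regPow.comp
    ((Lp.stronglyMeasurable u).norm.measurable.pow_const 2)).aestronglyMeasurable

lemma integrable_regPow_mul (hr : 0 ≤ r) (hδ : 0 ≤ δ) (hε : 0 < ε) (hδε : δ * ε ≤ 1)
    (u : LpC Ω 2) {k : EuclideanSpace ℝ (Fin d) → ℝ} (hk : Integrable k (volume.restrict Ω)) :
    Integrable (fun x => regPow r δ ε (‖u x‖ ^ 2) * k x) (volume.restrict Ω) := by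
  refine (hk.norm.const_mul ((ε⁻¹) ^ r)).mono' ((aestronglyMeasurable_regPow u).mul hk.1)
    (.of_forall fun x => ?_)
  rw [norm_mul, Real.norm_of_nonneg (regPow_nonneg hδ hε (sq_nonneg _))]
  exact mul_le_mul_of_nonneg_right (regPow_le hr hδ hε hδε (sq_nonneg _)) (norm_nonneg _)

lemma integrable_norm_mul_norm (u f : LpC Ω 2) :
    Integrable (fun x => ‖u x‖ * ‖f x‖) (volume.restrict Ω) :=
  (Lp.memLp u).norm.integrable_mul (Lp.memLp f).norm

/-- The resolvent equation is tested with the image of its own solution under `testMap`;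
p-ellipticity lets the form term be dropped. -/
lemma integral_regPow_le_of_pos (hp : 2 ≤ p) (hV : IsFormDomain Ω V) (hM : IsMulOp Ω ν M)
    (h1 : ∀ᵐ x ∂(volume.restrict Ω), CoerciveWith (ν x) 0)
    (h2 : ∀ᵐ x ∂(volume.restrict Ω), ∀ a b, 0 ≤ (pForm (ν x) p a b).re) {f : LpC Ω 2}
    {w : LpC Ω 2 × L2Vec Ω} (hw : w ∈ V)
    (hwf : ∀ v ∈ V, inner ℂ v.1 w.1 + inner ℂ v.2 (M w.2) = inner ℂ v.1 f)
    (hδ : 0 < δ) (hε : 0 < ε) (hδε : δ * ε ≤ 1) :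
    ∫ x in Ω, regPow ((p - 2) / 2) δ ε (‖w.1 x‖ ^ 2) * ‖w.1 x‖ ^ 2 ≤
      ∫ x in Ω, regPow ((p - 2) / 2) δ ε (‖w.1 x‖ ^ 2) * (‖w.1 x‖ * ‖f x‖) := by
  have hr : 0 ≤ (p - 2) / 2 := by linarith
  have hG := isNormalMap_testMap hr hδ hε hδε
  have h3 := congrArg Complex.re (hwf _ (hV.pair_mem hG w hw))
  rw [Complex.add_re, hM.re_inner_eq] at h3
  have h4 : 0 ≤ ∫ x in Ω, (inner ℂ ((hG.pair w).2 x)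
      (Matrix.toEuclideanCLM (𝕜 := ℂ) (ν x) (w.2 x))).re := by
    refine integral_nonneg_of_ae ?_
    filter_upwards [h1, h2, hG.snd_pair w] with x h1 h2 h3
    rw [h3]
    exact re_inner_vecApply_testMap_nonneg hp h1 h2 hδ hε hδε _ _
  have hinner : ∀ g : LpC Ω 2, (inner ℂ (hG.pair w).1 g) =
      ∫ x in Ω, ((regPow ((p - 2) / 2) δ ε (‖w.1 x‖ ^ 2) : ℝ) : ℂ) * inner ℂ (w.1 x) (g x) :=
    fun g => by
      rw [L2.inner_def]
      refine integral_congr_ae ?_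
      filter_upwards [hG.fst_pair w] with x hx
      rw [hx, testMap, Complex.real_smul, ← smul_eq_mul, inner_smul_left, Complex.conj_ofReal]
  have h5 : (inner ℂ (hG.pair w).1 w.1).re =
      ∫ x in Ω, regPow ((p - 2) / 2) δ ε (‖w.1 x‖ ^ 2) * ‖w.1 x‖ ^ 2 := by
    rw [hinner, ← Complex.ofReal_re (∫ x in Ω, _), ← integral_complex_ofReal]
    congr 2
    ext x
    rw [inner_self_eq_norm_sq_to_K]
    push_cast
    rfl
  have h6 : (inner ℂ (hG.pair w).1 f).re ≤
      ∫ x in Ω, regPow ((p - 2) / 2) δ ε (‖w.1 x‖ ^ 2) * (‖w.1 x‖ * ‖f x‖) := by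
    rw [hinner]
    refine (Complex.re_le_norm _).trans (norm_integral_le_of_norm_le
      (integrable_regPow_mul hr hδ.le hε hδε _ (integrable_norm_mul_norm _ _)) ?_)
    refine .of_forall fun x => ?_
    rw [norm_mul, Complex.norm_real, Real.norm_of_nonneg (regPow_nonneg hδ.le hε (sq_nonneg _))]
    exact mul_le_mul_of_nonneg_left (norm_inner_le_norm _ _)
      (regPow_nonneg hδ.le hε (sq_nonneg _))
  linarith

lemma tendsto_integral_regPow (hr : 0 ≤ r) (hε : 0 < ε) (u : LpC Ω 2)
    {k : EuclideanSpace ℝ (Fin d) → ℝ} (hk : Integrable k (volume.restrict Ω)) :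
    Tendsto (fun n : ℕ => ∫ x in Ω, regPow r (ε⁻¹ * (1 / ((n : ℝ) + 1))) ε (‖u x‖ ^ 2) * k x) atTop
      (𝓝 (∫ x in Ω, regPow r 0 ε (‖u x‖ ^ 2) * k x)) := by
  have hδε : ∀ n : ℕ, ε⁻¹ * (1 / ((n : ℝ) + 1)) * ε ≤ 1 := fun n => by
    rw [mul_right_comm, inv_mul_cancel₀ hε.ne', one_mul, div_le_one (by positivity)]
    linarith [n.cast_nonneg (α := ℝ)]
  refine tendsto_integral_of_dominated_convergence (fun x => (ε⁻¹) ^ r * ‖k x‖)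
    (fun n => (aestronglyMeasurable_regPow u).mul hk.1) (hk.norm.const_mul _)
    (fun n => .of_forall fun x => ?_) (.of_forall fun x => ?_)
  · rw [norm_mul, Real.norm_of_nonneg (regPow_nonneg (by positivity) hε (sq_nonneg _))]
    exact mul_le_mul_of_nonneg_right (regPow_le hr (by positivity) hε (hδε n) (sq_nonneg _))
      (norm_nonneg _)
  · refine Tendsto.mul_const _ ?_
    have h1 : Tendsto (fun n : ℕ => ε⁻¹ * (1 / ((n : ℝ) + 1))) atTop (𝓝 0) := by
      simpa using (tendsto_one_div_add_atTop_nhds_zero_nat (𝕜 := ℝ)).const_mul ε⁻¹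
    exact ((h1.add_const _).div_const _).rpow_const (Or.inr hr)

/-- First δ tends to 0, because the bound of the weight by |u|^{p-2} needed for Young's inequality
fails for δ > 0. After absorption ε tends to 0 by Fatou's lemma. -/
lemma lpContractive_of_two_le (hp : 2 ≤ p) (hV : IsFormDomain Ω V) (hM : IsMulOp Ω ν M)
    (h1 : ∀ᵐ x ∂(volume.restrict Ω), CoerciveWith (ν x) 0)
    (h2 : ∀ᵐ x ∂(volume.restrict Ω), ∀ a b, 0 ≤ (pForm (ν x) p a b).re)
    {J : LpC Ω 2 →L[ℂ] LpC Ω 2} (hJ : IsFormResolvent V M J) :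
    LpContractive (ENNReal.ofReal p) J := by
  intro f hf
  obtain ⟨w, hw, hwJ, hwf⟩ := hJ f
  rw [← hwJ]
  have hp0 : 0 < p := by linarith
  set r := (p - 2) / 2 with hrdef
  have hr : 0 ≤ r := by linarith
  have hu2 : Integrable (fun x => ‖w.1 x‖ ^ 2) (volume.restrict Ω) :=
    (Lp.memLp w.1).integrable_norm_pow (by norm_num)
  have hfp : Integrable (fun x => ‖f x‖ ^ p) (volume.restrict Ω) := by
    have := hf.integrable_norm_rpow (by simpa using hp0) (by simp)
    rwa [ENNReal.toReal_ofReal hp0.le] at this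
  have hε : ∀ n : ℕ, (0 : ℝ) < 1 / ((n : ℝ) + 1) := fun n => by positivity
  refine eLpNorm_le_of_integral_le (h := fun n x =>
    regPow r 0 (1 / ((n : ℝ) + 1)) (‖w.1 x‖ ^ 2) * ‖w.1 x‖ ^ 2) hp0 hf (fun n x =>
    mul_nonneg (regPow_nonneg le_rfl (hε n) (sq_nonneg _)) (sq_nonneg _))
    (fun n => integrable_regPow_mul hr le_rfl (hε n) (by simp) _ hu2) (fun n => ?_) fun x => ?_
  · have h3 : ∫ x in Ω, regPow r 0 (1 / ((n : ℝ) + 1)) (‖w.1 x‖ ^ 2) * ‖w.1 x‖ ^ 2 ≤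
        ∫ x in Ω, regPow r 0 (1 / ((n : ℝ) + 1)) (‖w.1 x‖ ^ 2) * (‖w.1 x‖ * ‖f x‖) := by
      refine le_of_tendsto_of_tendsto' (tendsto_integral_regPow hr (hε n) w.1 hu2)
        (tendsto_integral_regPow hr (hε n) w.1 (integrable_norm_mul_norm w.1 f)) fun k => ?_
      refine integral_regPow_le_of_pos hp hV hM h1 h2 hw hwf (mul_pos (inv_pos.2 (hε n)) (hε k))
        (hε n) ?_
      rw [mul_right_comm, inv_mul_cancel₀ (hε n).ne', one_mul, div_le_one (by positivity)]
      linarith [k.cast_nonneg (α := ℝ)]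
    have hi := integrable_regPow_mul hr le_rfl (hε n) (by simp) w.1 hu2
    have h4 : ∫ x in Ω, regPow r 0 (1 / ((n : ℝ) + 1)) (‖w.1 x‖ ^ 2) * (‖w.1 x‖ * ‖f x‖) ≤
        (1 - p⁻¹) * (∫ x in Ω, regPow r 0 (1 / ((n : ℝ) + 1)) (‖w.1 x‖ ^ 2) * ‖w.1 x‖ ^ 2) +
          p⁻¹ * ∫ x in Ω, ‖f x‖ ^ p := by
      rw [← integral_const_mul, ← integral_const_mul,
        ← integral_add (hi.const_mul _) (hfp.const_mul _)]
      refine integral_mono (integrable_regPow_mul hr le_rfl (hε n) (by simp) w.1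
        (integrable_norm_mul_norm w.1 f)) ((hi.const_mul _).add (hfp.const_mul _)) fun x => ?_
      refine young_weighted (by linarith) (norm_nonneg _) (norm_nonneg _)
        (regPow_nonneg le_rfl (hε n) (sq_nonneg _)) ?_
      exact (regPow_zero_le hr (hε n) (sq_nonneg _)).trans_eq (sq_rpow_half (norm_nonneg _))
    have h5 := h3.trans h4
    have hpi : 0 < p⁻¹ := inv_pos.2 hp0
    refine le_of_mul_le_mul_left (a := p⁻¹) ?_ hpi
    linarith
  · have h6 : Tendsto (fun n : ℕ => 1 + 1 / ((n : ℝ) + 1) * ‖w.1 x‖ ^ 2) atTop (𝓝 1) := by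
      simpa using ((tendsto_one_div_add_atTop_nhds_zero_nat (𝕜 := ℝ)).mul_const
        (‖w.1 x‖ ^ 2)).const_add 1
    have h7 := ((tendsto_const_nhds (x := 0 + ‖w.1 x‖ ^ 2)).div h6 one_ne_zero).rpow_const
      (p := r) (Or.inr hr)
    rw [zero_add, div_one, hrdef, sq_rpow_half (norm_nonneg _)] at h7
    have h8 := h7.mul_const (‖w.1 x‖ ^ 2)
    have h9 : ‖w.1 x‖ ^ (p - 2) * ‖w.1 x‖ ^ 2 = ‖w.1 x‖ ^ p := by
      rw [← Real.rpow_natCast, ← Real.rpow_add_of_nonneg (norm_nonneg _) (by linarith)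
        (by norm_num)]
      norm_num
    rw [h9] at h8
    refine h8.congr fun n => ?_
    rw [regPow, zero_add]
    rfl

/-- If the form is `p`-elliptic, then the resolvent is a contraction on `L^p`. -/
theorem lpContractive_of_isFormResolvent (hp : 1 < p) (hV : IsFormDomain Ω V)
    (hν : ∀ i j, AEMeasurable (fun x => ν x i j) (volume.restrict Ω)) {C c : ℝ}
    (hC : ∀ᵐ x ∂(volume.restrict Ω), ‖Matrix.toEuclideanCLM (𝕜 := ℂ) (ν x)‖ ≤ C)
    (hc : 0 < c) (h1 : ∀ᵐ x ∂(volume.restrict Ω), CoerciveWith (ν x) c)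
    (h2 : ∀ᵐ x ∂(volume.restrict Ω), ∀ a b, 0 ≤ (pForm (ν x) p a b).re)
    (hM : IsMulOp Ω ν M) {J : LpC Ω 2 →L[ℂ] LpC Ω 2} (hJ : IsFormResolvent V M J) :
    LpContractive (ENNReal.ofReal p) J := by
  have hcz : ∀ {L : Matrix (Fin d) (Fin d) ℂ}, CoerciveWith L c → CoerciveWith L 0 :=
    fun h ξ => (mul_le_mul_of_nonneg_right hc.le (sq_nonneg _)).trans (h ξ)
  rcases le_or_gt 2 p with hp2 | hp2
  · refine lpContractive_of_two_le hp2 hV hM ?_ h2 hJ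
    filter_upwards [h1] with x hx using hcz hx
  -- For p < 2 the adjoint coefficients are p'-elliptic with p' ≥ 2, and their resolvent is the
  -- adjoint of J.
  · have hν' : ∀ i j, AEMeasurable (fun x => (ν x).conjTranspose i j) (volume.restrict Ω) :=
      fun i j => Complex.continuous_conj.measurable.comp_aemeasurable (hν j i)
    have hC' : ∀ᵐ x ∂(volume.restrict Ω),
        ‖Matrix.toEuclideanCLM (𝕜 := ℂ) (ν x).conjTranspose‖ ≤ C := by
      filter_upwards [hC] with x hx
      rwa [norm_toEuclideanCLM_conjTranspose]
    have h1' : ∀ᵐ x ∂(volume.restrict Ω), CoerciveWith (ν x).conjTranspose c := by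
      filter_upwards [h1] with x hx using hx.conjTranspose
    obtain ⟨M', hM'⟩ := exists_isMulOp hν' hC'
    obtain ⟨J', hJ'⟩ := exists_isFormResolvent hV.isClosed hc (hM'.coerciveOp h1')
    have hq : 2 ≤ p.conjExponent := by
      rw [Real.conjExponent, le_div_iff₀ (by linarith)]
      linarith
    refine lpContractive_of_adjoint hp hp2 (Real.HolderConjugate.conjExponent hp)
      (hJ.inner_apply_left hJ' (hM.inner_conjTranspose hM'))
      (lpContractive_of_two_le hq hV hM' ?_ ?_ hJ')
    · filter_upwards [h1'] with x hx using hcz hx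
    · filter_upwards [h2] with x hx a b
      rw [Real.conjExponent, pForm_conjTranspose_re _ hp]
      exact hx _ _

end Contractivity

/-! ### Realizations in `L^p` and their numerical ranges -/

section Realization

variable {d : ℕ} {Ω : Set (EuclideanSpace ℝ (Fin d))}
  {μ : EuclideanSpace ℝ (Fin d) → Matrix (Fin d) (Fin d) ℂ} {M : L2Vec Ω →L[ℂ] L2Vec Ω}
  {V : Submodule ℂ (LpC Ω 2 × L2Vec Ω)} {p : ℝ}

/-- The resolvents of the form operator on `L²(Ω)`, together with their extensions to `L^p(Ω)`. -/
structure IsResolventPair (V : Submodule ℂ (LpC Ω 2 × L2Vec Ω)) (M : L2Vec Ω →L[ℂ] L2Vec Ω)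
    (p : ℝ≥0∞) [Fact (1 ≤ p)] (J : ℝ → LpC Ω 2 →L[ℂ] LpC Ω 2) (K : ℝ → LpC Ω p →L[ℂ] LpC Ω p) :
    Prop where
  isFormResolvent : ∀ t : ℝ, 0 < t → IsFormResolvent V ((t : ℂ) • M) (J t)
  isResolventFamily : IsResolventFamily J
  isResolventFamily_p : IsResolventFamily K
  consistent : ∀ t : ℝ, 0 < t → Consistent (J t) (K t)

lemma coerciveWith_smul {L : Matrix (Fin d) (Fin d) ℂ} {z : ℂ} {c : ℝ} : CoerciveWith (z • L) c ↔
    ∀ ξ : EuclideanSpace ℂ (Fin d),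
      c * ‖ξ‖ ^ 2 ≤ (z * inner ℂ ξ (Matrix.toEuclideanCLM (𝕜 := ℂ) L ξ)).re := by
  simp only [CoerciveWith, map_smul, smul_apply, inner_smul_right]

lemma pForm_smul (L : Matrix (Fin d) (Fin d) ℂ) (z : ℂ) (p : ℝ) (a b : EuclideanSpace ℝ (Fin d)) :
    pForm (z • L) p a b = z * pForm L p a b := by
  simp only [pForm, map_smul, smul_apply, inner_smul_right]

lemma exists_isResolventPair [Fact (1 ≤ ENNReal.ofReal p)] (hp : 1 < p) (hV : IsFormDomain Ω V)
    (hμ : ∀ i j, AEMeasurable (fun x => μ x i j) (volume.restrict Ω)) {C c : ℝ}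
    (hC : ∀ᵐ x ∂(volume.restrict Ω), ‖Matrix.toEuclideanCLM (𝕜 := ℂ) (μ x)‖ ≤ C)
    (hM : IsMulOp Ω μ M) (hc : 0 < c) {z : ℂ}
    (h1 : ∀ᵐ x ∂(volume.restrict Ω), CoerciveWith (z • μ x) c)
    (h2 : ∀ᵐ x ∂(volume.restrict Ω), ∀ a b, 0 ≤ (z * pForm (μ x) p a b).re) :
    ∃ J K, IsResolventPair V (z • M) (ENNReal.ofReal p) J K := by
  have hMt : ∀ t : ℝ, IsMulOp Ω (fun x => (t : ℂ) • z • μ x) ((t : ℂ) • z • M) :=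
    fun t => (hM.smul z).smul t
  have h1t : ∀ t : ℝ, 0 < t →
      ∀ᵐ x ∂(volume.restrict Ω), CoerciveWith ((t : ℂ) • z • μ x) (t * c) := fun t ht => by
    filter_upwards [h1] with x hx
    rw [coerciveWith_smul]
    intro ξ
    rw [Complex.re_ofReal_mul, mul_assoc]
    exact mul_le_mul_of_nonneg_left (hx ξ) ht.le
  have hres : ∀ t : ℝ, ∃ J, 0 < t → IsFormResolvent V ((t : ℂ) • z • M) J := fun t => by
    by_cases ht : 0 < t
    · obtain ⟨J, hJ⟩ := exists_isFormResolvent hV.isClosed (mul_pos ht hc)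
        ((hMt t).coerciveOp (h1t t ht))
      exact ⟨J, fun _ => hJ⟩
    · exact ⟨0, fun h => (ht h).elim⟩
  choose J hJ using hres
  have hcon : ∀ t : ℝ, 0 < t → LpContractive (ENNReal.ofReal p) (J t) := fun t ht => by
    refine lpContractive_of_isFormResolvent hp hV (ν := fun x => (t : ℂ) • z • μ x)
      (fun i j => ((hμ i j).const_mul z).const_mul (t : ℂ)) (C := ‖(t : ℂ)‖ * (‖z‖ * C)) ?_
      (mul_pos ht hc) (h1t t ht) ?_ (hMt t) (hJ t ht)
    · filter_upwards [hC] with x hx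
      rw [map_smul, map_smul, norm_smul, norm_smul]
      gcongr
    · filter_upwards [h2] with x hx a b
      rw [pForm_smul, pForm_smul, Complex.re_ofReal_mul]
      exact mul_nonneg ht.le (hx a b)
  have hK : ∀ t : ℝ, ∃ K : LpC Ω (ENNReal.ofReal p) →L[ℂ] LpC Ω (ENNReal.ofReal p),
      0 < t → ‖K‖ ≤ 1 ∧ Consistent (J t) K := fun t => by
    by_cases ht : 0 < t
    · obtain ⟨K, hK⟩ := exists_consistent (by simp) (hcon t ht)
      exact ⟨K, fun _ => hK⟩
    · exact ⟨0, fun h => (ht h).elim⟩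
  choose K hK using hK
  have hJf := IsFormResolvent.isResolventFamily hJ hc ((hM.smul z).coerciveOp h1) hV.dense_fst
  exact ⟨J, K, hJ, hJf, Consistent.isResolventFamily (by simp) hJf
    (fun t ht => (hK t ht).1) fun t ht => (hK t ht).2, fun t ht => (hK t ht).2⟩

variable {P : ℝ≥0∞} [Fact (1 ≤ P)] {J J' : ℝ → LpC Ω 2 →L[ℂ] LpC Ω 2}
  {K K' : ℝ → LpC Ω P →L[ℂ] LpC Ω P}

lemma IsResolventPair.negGenerator_eq (h : IsResolventPair V M P J K) {c : ℝ} (hc : 0 < c)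
    (hM : CoerciveOp M c) : negGenerator h.isResolventFamily.semigroup = formGraph V M := by
  rw [h.isResolventFamily.negGenerator_semigroup]
  have := h.isFormResolvent 1 one_pos
  rw [Complex.ofReal_one, one_smul] at this
  exact this.resolventGraph_eq hc hM

lemma IsResolventPair.isExtrapolation (h : IsResolventPair V M P J K) {c : ℝ} (hc : 0 < c)
    (hM : CoerciveOp M c) : IsExtrapolation Ω (formGraph V M) P h.isResolventFamily.semigroup
      h.isResolventFamily_p.semigroup where
  semigroup := h.isResolventFamily.isC0Semigroup
  generator := h.negGenerator_eq hc hM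
  semigroup_p := h.isResolventFamily_p.isC0Semigroup
  consistent t f g hfg := semigroup_mem_of_invariant (Z := diagLp (volume.restrict Ω) P)
    isClosed_diagLp h.isResolventFamily h.isResolventFamily_p
    (fun t ht w hw => h.consistent t ht w.1 w.2 hw) t (f, g) hfg

/-- Any admissible T has the accretive, densely defined generator of the constructed semigroup,
hence equals it. Any admissible S then agrees with the constructed one on the dense set L² ∩ L^p. -/
lemma IsResolventPair.realization_subset (h : IsResolventPair V M P J K) (hP : P ≠ ⊤) {c : ℝ}
    (hc : 0 < c) (hM : CoerciveOp M c) :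
    realization Ω (formGraph V M) P ⊆ resolventGraph (K 1) := by
  rintro w ⟨T, S, hTS, hw⟩
  have hE := h.isExtrapolation hc hM
  have hT : T = h.isResolventFamily.semigroup := by
    refine eq_of_negGenerator_eq hTS.semigroup hE.semigroup
      (hTS.generator.trans hE.generator.symm) (fun w hw => ?_) ?_
    · rw [hE.generator] at hw
      exact accretive_formGraph hc hM hw
    · rw [h.isResolventFamily.negGenerator_semigroup]
      refine h.isResolventFamily.denseRange.mono ?_
      rintro _ ⟨y, rfl⟩
      exact ⟨_, ⟨y, rfl⟩, rfl⟩
  have hS : S = h.isResolventFamily_p.semigroup := funext fun t =>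
    Consistent.eq hP (hTS.consistent t) (hT ▸ hE.consistent t)
  rw [hS, h.isResolventFamily_p.negGenerator_semigroup] at hw
  exact hw

/-- With u = K_1 y and A_p u = y - K_1 y, this says that the extended rotated resolvent inverts 1 +
tzA_p on dom(A_p). It is the resolvent identity on L², extended by density. -/
lemma IsResolventPair.apply_smul_add (h : IsResolventPair V M P J K) {z : ℂ}
    (h' : IsResolventPair V (z • M) P J' K') (hP : P ≠ ⊤) {c : ℝ} (hc : 0 < c)
    (hM : CoerciveOp (z • M) c) {t : ℝ} (ht : 0 < t) (y : LpC Ω P) :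
    K' t (K 1 y + ((t : ℂ) * z) • (y - K 1 y)) = K 1 y := by
  have hJ := h.isFormResolvent 1 one_pos
  have hJ' := h'.isFormResolvent t ht
  rw [smul_smul] at hJ'
  have hMt : CoerciveOp (((t : ℂ) * z) • M) (t * c) := fun k => by
    have := mul_le_mul_of_nonneg_left (hM k) ht.le
    rw [smul_apply, inner_smul_right] at this ⊢
    rw [mul_assoc, mul_assoc, Complex.re_ofReal_mul]
    exact this
  have key : (K' t).comp (((t : ℂ) * z) • ContinuousLinearMap.id ℂ _ +
      (1 - (t : ℂ) * z) • K 1) = K 1 := by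
    refine clm_ext_of_memLp_two hP fun f g hfg => Lp.ext ?_
    have h1 := h.consistent 1 one_pos f g hfg
    have h2 := hJ.identity (by simp) hJ' (mul_pos ht hc) hMt f
    rw [Complex.ofReal_one, div_one] at h2
    have h3 : (((t : ℂ) * z) • f + (1 - (t : ℂ) * z) • J 1 f : LpC Ω 2) =ᵐ[volume.restrict Ω]
        (((t : ℂ) * z) • g + (1 - (t : ℂ) * z) • K 1 g : LpC Ω P) := by
      filter_upwards [hfg, h1, Lp.coeFn_add (((t : ℂ) * z) • f) ((1 - (t : ℂ) * z) • J 1 f),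
        Lp.coeFn_add (((t : ℂ) * z) • g) ((1 - (t : ℂ) * z) • K 1 g),
        Lp.coeFn_smul ((t : ℂ) * z) f, Lp.coeFn_smul ((t : ℂ) * z) g,
        Lp.coeFn_smul (1 - (t : ℂ) * z) (J 1 f), Lp.coeFn_smul (1 - (t : ℂ) * z) (K 1 g)]
        with x a1 a2 a3 a4 a5 a6 a7 a8
      rw [a3, a4, Pi.add_apply, Pi.add_apply, a5, a6, a7, a8, Pi.smul_apply, Pi.smul_apply,
        Pi.smul_apply, Pi.smul_apply, a1, a2]
    have h4 := h'.consistent t ht _ _ h3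
    rw [h2] at h4
    exact h4.symm.trans h1
  have h5 := DFunLike.congr_fun key y
  refine Eq.trans (congrArg _ ?_) h5
  change K 1 y + ((t : ℂ) * z) • (y - K 1 y) =
    ((t : ℂ) * z) • y + (1 - (t : ℂ) * z) • K 1 y
  rw [smul_sub, sub_smul, one_smul]
  abel

/-- Contractivity of the rotated resolvents confines the numerical range to a half-plane. -/
lemma IsResolventPair.re_mul_nonneg (h : IsResolventPair V M P J K) {z : ℂ}
    (h' : IsResolventPair V (z • M) P J' K') (hP : P ≠ ⊤) {c : ℝ} (hc : 0 < c)
    (hM : CoerciveOp (z • M) c) {w : LpC Ω P × LpC Ω P} (hw : w ∈ resolventGraph (K 1))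
    {φ : StrongDual ℂ (LpC Ω P)} (hφ : φ ∈ dualityMap w.1) : 0 ≤ (z * φ w.2).re := by
  obtain ⟨y, rfl⟩ := hw
  obtain ⟨hφ1, hφ2⟩ := hφ
  simp only at hφ1 ⊢
  -- With u = K_1 y and f = A_p u, applying φ to K'_t u + tz K'_t f = u gives t Re(z φ(K'_t f)) =
  -- ‖u‖ - Re φ(K'_t u) ≥ 0; then t tends to 0.
  have h1 : ∀ t : ℝ, 0 < t → 0 ≤ (z * φ (K' t (y - K 1 y))).re := fun t ht => by
    have e1 := h.apply_smul_add h' hP hc hM ht y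
    rw [map_add, map_smul] at e1
    have e2 := congrArg φ e1
    rw [map_add, map_smul, smul_eq_mul, hφ1] at e2
    have e3 := congrArg Complex.re e2
    rw [Complex.add_re, mul_assoc, Complex.re_ofReal_mul, Complex.ofReal_re] at e3
    have e4 : (φ (K' t (K 1 y))).re ≤ ‖K 1 y‖ := by
      refine (Complex.re_le_norm _).trans ((φ.le_of_opNorm_le hφ2.le _).trans ?_)
      rw [one_mul]
      simpa using (K' t).le_of_opNorm_le (h'.isResolventFamily_p.norm_le t ht) (K 1 y)
    refine nonneg_of_mul_nonneg_right (a := t) ?_ ht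
    linarith
  have h2 : Tendsto (fun t => (z * φ (K' t (y - K 1 y))).re) (𝓝[>] 0)
      (𝓝 (z * φ (y - K 1 y)).re) := by
    have := ((φ.continuous.tendsto _).comp (h'.isResolventFamily_p.tendsto (y - K 1 y)))
    exact (Complex.continuous_re.tendsto _).comp (this.const_mul z)
  refine ge_of_tendsto h2 ?_
  filter_upwards [self_mem_nhdsWithin] with t ht using h1 t ht

lemma mem_sector_arctan {z : ℂ} {κ : ℝ} (hκ : 0 ≤ κ) (h0 : 0 ≤ z.re)
    (h : ∀ k, κ < k → |z.im| ≤ k * z.re) : z ∈ sector (Real.arctan κ) := by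
  have h1 : |z.im| ≤ κ * z.re := by
    refine ge_of_tendsto (x := 𝓝[>] κ) (f := fun k => k * z.re)
      (((continuous_id.mul continuous_const).tendsto κ).mono_left nhdsWithin_le_nhds) ?_
    filter_upwards [self_mem_nhdsWithin] with k hk using h k hk
  rcases h0.eq_or_lt with h2 | h2
  · refine Or.inr (Complex.ext h2.symm ?_)
    rw [← h2, mul_zero] at h1
    exact abs_nonpos_iff.1 h1
  · refine Or.inl ?_
    have := (abs_arg_le_iff h2 (Real.arctan_nonneg.2 hκ) (Real.arctan_lt_pi_div_two κ)).2
    rw [Real.tan_arctan] at this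
    exact this h1

/-- Only nonnegativity of Re `pForm` is required, with no margin, so the endpoints q and q' are
covered. -/
theorem extrapolates_and_accretive [Fact (1 ≤ ENNReal.ofReal p)] (hp : 1 < p)
    (hV : IsFormDomain Ω V) (hμ : ∀ i j, AEMeasurable (fun x => μ x i j) (volume.restrict Ω))
    {C m₀ : ℝ} (hC : ∀ᵐ x ∂(volume.restrict Ω), ‖Matrix.toEuclideanCLM (𝕜 := ℂ) (μ x)‖ ≤ C)
    (hm₀ : 0 < m₀) (h1 : ∀ᵐ x ∂(volume.restrict Ω), CoerciveWith (μ x) m₀)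
    (h2 : ∀ᵐ x ∂(volume.restrict Ω), ∀ a b, 0 ≤ (pForm (μ x) p a b).re) :
    Extrapolates Ω (formOperator Ω μ V) (ENNReal.ofReal p) ∧
      Accretive (realization Ω (formOperator Ω μ V) (ENNReal.ofReal p)) := by
  obtain ⟨M, hM⟩ := exists_isMulOp hμ hC
  obtain ⟨J, K, h⟩ := exists_isResolventPair hp hV hμ hC hM hm₀ (z := 1) (by simpa using h1)
    (by simpa using h2)
  have hMc := hM.coerciveOp h1
  have h' : IsResolventPair V M (ENNReal.ofReal p) J K := by simpa using h
  rw [hM.formOperator_eq]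
  refine ⟨⟨_, _, h'.isExtrapolation hm₀ hMc⟩, ?_⟩
  rintro _ ⟨w, hw, -, φ, hφ, rfl⟩
  have := h'.re_mul_nonneg h (by simp) hm₀ (by simpa using hMc)
    (h'.realization_subset (by simp) hm₀ hMc hw) hφ
  simpa using this

/-- Multiplication by k ± i with k > κ sends the sector of tangent κ into the right half-plane. The
strict inequality keeps a margin, so that the rotated coefficients are coercive with constant (k -
κ)m₀. -/
theorem numRange_realization_subset [Fact (1 ≤ ENNReal.ofReal p)] (hp : 1 < p)
    (hV : IsFormDomain Ω V) (hμ : ∀ i j, AEMeasurable (fun x => μ x i j) (volume.restrict Ω))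
    {C m₀ κ : ℝ} (hC : ∀ᵐ x ∂(volume.restrict Ω), ‖Matrix.toEuclideanCLM (𝕜 := ℂ) (μ x)‖ ≤ C)
    (hm₀ : 0 < m₀) (hκ : 0 ≤ κ) (h1 : ∀ᵐ x ∂(volume.restrict Ω), CoerciveWith (μ x) m₀)
    (h1' : ∀ᵐ x ∂(volume.restrict Ω), ∀ ξ,
      |(inner ℂ ξ (Matrix.toEuclideanCLM (𝕜 := ℂ) (μ x) ξ)).im| ≤
        κ * (inner ℂ ξ (Matrix.toEuclideanCLM (𝕜 := ℂ) (μ x) ξ)).re)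
    (h2 : ∀ᵐ x ∂(volume.restrict Ω), ∀ a b, 0 ≤ (pForm (μ x) p a b).re ∧
      |(pForm (μ x) p a b).im| ≤ κ * (pForm (μ x) p a b).re) :
    numRange (realization Ω (formOperator Ω μ V) (ENNReal.ofReal p)) ⊆
      sector (Real.arctan κ) := by
  have h2' : ∀ᵐ x ∂(volume.restrict Ω), ∀ a b, 0 ≤ (pForm (μ x) p a b).re := by
    filter_upwards [h2] with x hx a b using (hx a b).1
  have hacc := (extrapolates_and_accretive hp hV hμ hC hm₀ h1 h2').2
  intro ζ hζ
  refine mem_sector_arctan hκ (hacc hζ) fun k hk => ?_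
  obtain ⟨M, hM⟩ := exists_isMulOp hμ hC
  obtain ⟨J, K, h⟩ := exists_isResolventPair hp hV hμ hC hM hm₀ (z := 1) (by simpa using h1)
    (by simpa using h2')
  have hMc := hM.coerciveOp h1
  rw [one_smul] at h
  rw [hM.formOperator_eq] at hζ
  obtain ⟨w, hw, -, φ, hφ, rfl⟩ := hζ
  have hw' := h.realization_subset (by simp) hm₀ hMc hw
  have hre : ∀ (s : ℝ) (ζ : ℂ), ((⟨k, s⟩ : ℂ) * ζ).re = k * ζ.re - s * ζ.im := fun s ζ => rfl
  have key : ∀ s : ℝ, |s| = 1 → 0 ≤ k * (φ w.2).re - s * (φ w.2).im := fun s hs => by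
    -- Re((k + is)ζ) = k Re ζ - s Im ζ. This serves both the L² form and `pForm`.
    have hsle : ∀ ζ : ℂ, |ζ.im| ≤ κ * ζ.re → (k - κ) * ζ.re ≤ ((⟨k, s⟩ : ℂ) * ζ).re :=
      fun ζ hζ => by
        have h3 : s * ζ.im ≤ |ζ.im| := by
          refine (le_abs_self _).trans ?_
          rw [abs_mul, hs, one_mul]
        rw [hre]
        linarith
    have hc : 0 < (k - κ) * m₀ := mul_pos (by linarith) hm₀
    have h4 : ∀ᵐ x ∂(volume.restrict Ω), CoerciveWith ((⟨k, s⟩ : ℂ) • μ x) ((k - κ) * m₀) := by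
      filter_upwards [h1, h1'] with x h5 h6
      rw [coerciveWith_smul]
      intro ξ
      refine le_trans ?_ (hsle _ (h6 ξ))
      rw [mul_assoc]
      exact mul_le_mul_of_nonneg_left (h5 ξ) (by linarith)
    obtain ⟨J', K', h'⟩ := exists_isResolventPair hp hV hμ hC hM hc (z := ⟨k, s⟩) h4 (by
      filter_upwards [h2] with x h5 a b
      exact le_trans (mul_nonneg (by linarith) (h5 a b).1) (hsle _ (h5 a b).2))
    rw [← hre]
    exact h.re_mul_nonneg h' (by simp) hc ((hM.smul _).coerciveOp h4) hw' hφ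
  have k1 := key 1 (by simp)
  have k2 := key (-1) (by simp)
  rw [abs_le]
  constructor <;> linarith

end Realization

end LpSector
end

/-! ### The main theorem -/

theorem theorem3p25 {d : ℕ}
    -- an arbitrary open set and a closed part of its boundary
    (Ω D : Set (EuclideanSpace ℝ (Fin d))) (hΩ : IsOpen Ω) (hD : IsClosed D)
    (hDΩ : D ⊆ frontier Ω)
    -- the form domain: one of the two spaces with a Dirichlet condition on `D`
    (V : Set (LpSector.LpC Ω 2 × LpSector.L2Vec Ω))
    (hV : V = LpSector.closureW12 Ω (LpSector.smoothD Ω D) ∨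
      V = LpSector.closureW12 Ω (LpSector.sobolevD Ω D))
    -- a bounded, measurable, uniformly elliptic coefficient function that is not real
    (μ : EuclideanSpace ℝ (Fin d) → Matrix (Fin d) (Fin d) ℂ)
    (hμ_meas : ∀ i j, AEMeasurable (fun x => μ x i j) (volume.restrict Ω))
    (hμ_bdd : ∃ C : ℝ, ∀ᵐ x ∂(volume.restrict Ω), ∀ i j, ‖μ x i j‖ ≤ C)
    (m : EuclideanSpace ℝ (Fin d) → ℝ) (m₀ : ℝ) (hm₀ : 0 < m₀)
    (hm : ∀ᵐ x ∂(volume.restrict Ω), m₀ ≤ m x ∧ LpSector.CoerciveWith (μ x) (m x))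
    (hIm : ¬ ∀ᵐ x ∂(volume.restrict Ω), (μ x).map Complex.im = 0) :
    ∃ q : ℝ, 2 < q ∧
      -- `q` is the unique solution of `Ψ(q) = η`
      ((LpSector.Psi q : ℝ) : EReal) = LpSector.eta Ω μ m ∧
      (∀ s : ℝ, 2 < s → ((LpSector.Psi s : ℝ) : EReal) = LpSector.eta Ω μ m → s = q) ∧
      -- `A_q` and `A_{q'}` are well-defined and accretive
      (∀ (p : ℝ) [Fact (1 ≤ ENNReal.ofReal p)], p = q ∨ p = q / (q - 1) →
        LpSector.Extrapolates Ω (LpSector.formOperator Ω μ V) (ENNReal.ofReal p) ∧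
        LpSector.Accretive
          (LpSector.realization Ω (LpSector.formOperator Ω μ V) (ENNReal.ofReal p))) ∧
      -- for `q' < p < q`, `A_p` is well-defined with numerical range in `Σ_{α_p}`
      (∀ (p : ℝ) [Fact (1 ≤ ENNReal.ofReal p)], q / (q - 1) < p → p < q →
        LpSector.Extrapolates Ω (LpSector.formOperator Ω μ V) (ENNReal.ofReal p) ∧
        ∃ α : ℝ, 0 ≤ α ∧ α < Real.pi / 2 ∧
          ((Real.tan α : ℝ) : EReal) = LpSector.kappa Ω μ m p ∧
          LpSector.numRange
              (LpSector.realization Ω (LpSector.formOperator Ω μ V) (ENNReal.ofReal p)) ⊆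
            LpSector.sector α) := by
  open LpSector in
  obtain ⟨V', rfl, hV'⟩ := exists_isFormDomain hΩ hD hDΩ hV
  obtain ⟨η, hη0, hη, hηm⟩ := exists_eta_eq hm₀ hμ_bdd hm hIm
  -- Since Ψ = 1/σ, the equation for q is σ_q = 1/η.
  obtain ⟨q, hq, hσ⟩ := exists_sigma_eq (inv_pos.2 hη0)
  obtain ⟨C, -, hC⟩ := exists_norm_bound hμ_bdd
  have hCμ : ∀ᵐ x ∂(volume.restrict Ω), ‖Matrix.toEuclideanCLM (𝕜 := ℂ) (μ x)‖ ≤ C := by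
    filter_upwards [hC] with x hx using hx.1
  have hcoer : ∀ᵐ x ∂(volume.restrict Ω), CoerciveWith (μ x) m₀ := by
    filter_upwards [hm] with x hx ξ
    exact (mul_le_mul_of_nonneg_right hx.1 (sq_nonneg _)).trans (hx.2 ξ)
  have hq' : 1 < q / (q - 1) := by rw [lt_div_iff₀ (by linarith)]; linarith
  have hpos : ∀ p : ℝ, 1 < p → |sigma p| ≤ η⁻¹ →
      ∀ᵐ x ∂(volume.restrict Ω), ∀ a b, 0 ≤ (pForm (μ x) p a b).re := fun p hp hle => by
    filter_upwards [hm, hηm] with x hx hx' a b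
    have hmx : 0 < m x := hm₀.trans_le hx.1
    refine (pForm_bounds hmx hp hx.2 ?_ a b).1
    calc |sigma p| * normIm (μ x) ≤ η⁻¹ * (η * m x) := by
          gcongr
          exact norm_nonneg _
      _ = m x := by rw [← mul_assoc, inv_mul_cancel₀ hη0.ne', one_mul]
  refine ⟨q, hq, ?_, fun s hs hsη => ?_, fun p _ hpq => ?_, fun p _ hp1 hp2 => ?_⟩
  · rw [Psi_eq, hσ, inv_inv, hη]
  · rw [← hη, EReal.coe_eq_coe_iff, Psi_eq] at hsη
    refine strictMonoOn_sigma.injOn (show (1 : ℝ) < s by linarith) (show (1 : ℝ) < q by linarith) ?_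
    rw [hσ, ← hsη, inv_inv]
  · have hp : 1 < p ∧ |sigma p| ≤ η⁻¹ := by
      rcases hpq with rfl | rfl
      · exact ⟨by linarith, by rw [hσ, abs_of_pos (inv_pos.2 hη0)]⟩
      · exact ⟨hq', by rw [sigma_conj (by linarith), hσ, abs_neg, abs_of_pos (inv_pos.2 hη0)]⟩
    exact extrapolates_and_accretive hp.1 hV' hμ_meas hCμ hm₀ hcoer (hpos p hp.1 hp.2)
  · have hp : 1 < p := hq'.trans hp1
    -- Monotonicity of σ with σ_{q'} = -σ_q: the open interval (q', q) corresponds to |σ_p| < 1/η.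
    have hσp : |sigma p| < η⁻¹ := by
      rw [abs_lt, ← hσ]
      refine ⟨?_, strictMonoOn_sigma hp (show (1 : ℝ) < q by linarith) hp2⟩
      rw [← sigma_conj (by linarith)]
      exact strictMonoOn_sigma hq' hp hp1
    have hση : |sigma p| * η < 1 := by rwa [← lt_div_iff₀ hη0, one_div]
    obtain ⟨κ, hκ0, hκ, hκx⟩ := exists_kappa_eq hm₀ hμ_bdd hm hIm hηm hση
    refine ⟨(extrapolates_and_accretive hp hV' hμ_meas hCμ hm₀ hcoer (hpos p hp hσp.le)).1,
      Real.arctan κ, Real.arctan_nonneg.2 hκ0, Real.arctan_lt_pi_div_two κ, ?_, ?_⟩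
    · rw [Real.tan_arctan, hκ]
    · refine numRange_realization_subset hp hV' hμ_meas hCμ hm₀ hκ0 hcoer ?_ ?_
      · filter_upwards [hm, hκx] with x hx hx' ξ
        have hmx : 0 < m x := hm₀.trans_le hx.1
        refine ((im_inner_le_of_coercive hmx hx.2).2.2.2 ξ).trans ?_
        exact mul_le_mul_of_nonneg_right hx'.2.1 ((by positivity : 0 ≤ m x * ‖ξ‖ ^ 2).trans (hx.2 ξ))
      · filter_upwards [hm, hκx] with x hx hx' a b
        have hmx : 0 < m x := hm₀.trans_le hx.1
        have hb := pForm_bounds hmx hp hx.2 hx'.1.le a b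
        exact ⟨hb.1, (hb.2 hx'.1).trans (mul_le_mul_of_nonneg_right hx'.2.2 hb.1)⟩
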